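/- Let $n\ge 0$. An $\mathfrak{sl}_3$-web is an oriented planar graph in a half plane, up to planar isotopy (closed loops allowed), whose internal vertices are trivalent and are either sources or sinks, and whose boundary points are univalent and lie on the bottom line. Let $D^{(n^3)}$ be the $\mathbb C$-vector space spanned by the webs with $3n$ boundary points $1,\dots,3n$ (from left to right), all edges being oriented towards the boundary, modulo the local relations: (R1) a closed loop equals $3$; (R2) a bigon inserted in an edge equals $-2$ times the edge; (R3) a square equals the sum of the two ways of joining its four ends by two disjoint oriented arcs. The symmetric group $S_{3n}$ acts on $D^{(n^3)}$ as follows: $s_i=(i\ i{+}1)$ stacks a crossing of the strands $i,i+1$ at the bottom of a web, where a crossing stands for $H+\mathrm{id}$, with $\mathrm{id}$ two parallel strands and $H$ the web in which the two strands merge into one edge that then splits again. Let $W_0\in D^{(n^3)}$ be the web consisting of $n$ tripods side by side, with boundary points $\{1,2,3\},\{4,5,6\},\dots$. For $\sigma\in S_{3n}$ write $W_0.\sigma$ for the result of the action, in which the end at $j$ is moved to $\sigma(j)$ (products in $S_{3n}$ are read from left to right for this right action). If $\sigma$ preserves the order of the three boundary points of each tripod, $W_0.\sigma$ is called a fork diagram,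 with arcs the triples $(\sigma(3k+1),\sigma(3k+2),\sigma(3k+3))$, $0\le k<n$. For an arc $(a,b,c)$, $(a,b)$ is its left arc and $(b,c)$ its right arc. A fork diagram is an M-diagram if no two of its left arcs cross and no two of its right arcs cross, where $(a,b)$ and $(a',b')$ cross if $a<a'<b<b'$ or $a'<a<b'<b$. Fork diagrams are recorded by their sets of arcs; let $\mathcal M^n$ be the set of M-diagrams with $3n$ boundary points. Let $S^{(n,n,n)}$ be the Specht module over $\mathbb C$, i.e. the span of all polytabloids $v_T$ of shape $(n,n,n)$ inside the permutation module on tabloids, and let $T_0$ be the tableau with columns $1,2,3$; $4,5,6$; and so on. **Theorem.** The rule above defines an action of $S_{3n}$ on $D^{(n^3)}$, and there is an $S_{3n}$-equivariant linear isomorphism $\Phi\colon S^{(n,n,n)}\to D^{(n^3)}$ with $\Phi(v_{T_0})=W_0$. The element $W_0.\sigma$ of an M-diagram depends only on its set of arcs, and the family of M-diagrams $\mathcal M^n$ is a basis of $D^{(n^3)}$. Consequently the family $(\Phi^{-1}(m))_{m\in\mathcal M^n}$, that is, $v_{T_0}.\sigma$ for the M-diagrams $W_0.\sigma$, is a basis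 of $S^{(n,n,n)}$. -/

import Mathlib

noncomputable section

namespace Sl3

/-! ### Planar webs

Webs are drawn in a half plane with all boundary points on the bottom line.  Up to planar isotopy
such a picture is in general position for the height function and every trivalent vertex has its
three edges leaving it downwards; it is then a sequence, from top to bottom, of slices each of
which contains a single cup, cap or vertex.  A horizontal line in general position meets the web in
a word of orientations: `true` for an edge that is oriented downwards (towards the boundary) and
`false` for an edge that is oriented upwards. -/

/-- The elementary pieces, with the words on their upper and lower sides: a local maximum of an edge
(`cup`, which opens downwards and creates two ends), a local minimum of an edge (`cap`, which joins
two neighbouring ends), and a trivalent vertex (`tripod`), which is a source for `s = true` and a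
sink for `s = false`. -/
inductive Piece : List Bool → List Bool → Type
  | cup (s : Bool) : Piece [] [s, !s]
  | cap (s : Bool) : Piece [s, !s] []
  | tripod (s : Bool) : Piece [] [s, s, s]

/-- `Web w` is the type of web pictures in a half plane whose boundary word is `w`.  The constructor
`slice` adds below a picture one elementary piece, with the vertical strands `u` on its left and `v`
on its right. -/
inductive Web : List Bool → Type
  | empty : Web []
  | slice {a b w w' : List Bool} (p : Piece a b) (u v : List Bool)
      (hw : w = u ++ a ++ v) (hw' : w' = u ++ b ++ v) (d : Web w) : Web w'

namespace Web

variable {w w' : List Bool}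

/-- Add the two ends `s, !s` of a new arc between the strands `u` and `v`. -/
def cup (s : Bool) (u v : List Bool) (d : Web w)
    (hw : w = u ++ v := by simp) (hw' : w' = u ++ [s, !s] ++ v := by simp) : Web w' :=
  slice (Piece.cup s) u v (by simp [hw]) hw' d

/-- Join the two neighbouring ends `s, !s` between the strands `u` and `v`. -/
def cap (s : Bool) (u v : List Bool) (d : Web w)
    (hw : w = u ++ [s, !s] ++ v := by simp) (hw' : w' = u ++ v := by simp) : Web w' :=
  slice (Piece.cap s) u v hw (by simp [hw']) d

/-- Add a trivalent vertex with three ends `s` between the strands `u` and `v`. -/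
def tripod (s : Bool) (u v : List Bool) (d : Web w)
    (hw : w = u ++ v := by simp) (hw' : w' = u ++ [s, s, s] ++ v := by simp) : Web w' :=
  slice (Piece.tripod s) u v (by simp [hw]) hw' d

/-- The strand `t` between `u` and `v` ends at a trivalent vertex, whose two other edges go down. -/
def split (t : Bool) (u v : List Bool) (d : Web w)
    (hw : w = u ++ [t] ++ v := by simp) (hw' : w' = u ++ [!t, !t] ++ v := by simp) : Web w' :=
  cap t u ([!t, !t] ++ v)
    (tripod (!t) (u ++ [t]) v d hw : Web (u ++ [t, !t, !t, !t] ++ v))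
    (by simp) (by simp [hw'])

/-- The two neighbouring strands `t, t` between `u` and `v` end at a trivalent vertex, whose third
edge goes down. -/
def merge (t : Bool) (u v : List Bool) (d : Web w)
    (hw : w = u ++ [t, t] ++ v := by simp) (hw' : w' = u ++ [!t] ++ v := by simp) : Web w' :=
  cap t u ([!t] ++ v)
    (cap t (u ++ [t]) ([!t, !t] ++ v)
      (tripod (!t) (u ++ [t, t]) v d hw : Web (u ++ [t, t, !t, !t, !t] ++ v)) :
      Web (u ++ [t, !t, !t] ++ v))
    (by simp) (by simp [hw'])

end Web

/-- A web as a formal linear combination. -/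
abbrev fw {w : List Bool} (d : Web w) : Web w →₀ ℂ := Finsupp.single d 1

/-- The relations between formal linear combinations of web pictures with the same boundary word.
The first five generate planar isotopy: pieces at disjoint places may be exchanged in height,
a zigzag of an edge may be straightened, a trivalent vertex may be rotated.  The relations `loop`,
`bigon`, `square` are the three local web relations.  By `slice` they may be applied locally,
inside any larger web. -/
inductive WebRel : ∀ {w : List Bool}, (Web w →₀ ℂ) → (Web w →₀ ℂ) → Prop
  | exchange {a b a' b' : List Bool} (p : Piece a b) (q : Piece a' b') (u m v : List Bool)
      (d : Web (u ++ a ++ m ++ a' ++ v)) :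
      WebRel
        (fw (Web.slice (w' := u ++ b ++ m ++ b' ++ v) q (u ++ b ++ m) v (by simp) (by simp)
          (Web.slice (w' := u ++ b ++ m ++ a' ++ v) p u (m ++ a' ++ v) (by simp) (by simp) d)))
        (fw (Web.slice (w' := u ++ b ++ m ++ b' ++ v) p u (m ++ b' ++ v) (by simp) (by simp)
          (Web.slice (w' := u ++ a ++ m ++ b' ++ v) q (u ++ a ++ m) v (by simp) (by simp) d)))
  | zigzagLeft (s : Bool) (u v : List Bool) (d : Web (u ++ [s] ++ v)) :
      WebRel
        (fw (Web.cap (!s) (u ++ [s]) v (Web.cup s u ([s] ++ v) d : Web (u ++ [s, !s, s] ++ v))))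
        (fw d)
  | zigzagRight (s : Bool) (u v : List Bool) (d : Web (u ++ [s] ++ v)) :
      WebRel
        (fw (Web.cap s u ([s] ++ v) (Web.cup (!s) (u ++ [s]) v d : Web (u ++ [s, !s, s] ++ v))))
        (fw d)
  | rotateRight (s : Bool) (u v : List Bool) (d : Web (u ++ v)) :
      WebRel
        (fw (Web.cap (w' := u ++ [s, s, s] ++ v) s (u ++ [s, s, s]) v
          (Web.tripod s (u ++ [s]) ([!s] ++ v) (Web.cup s u v d : Web (u ++ [s, !s] ++ v)) :
            Web (u ++ [s, s, s, s, !s] ++ v))))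
        (fw (Web.tripod s u v d))
  | rotateLeft (s : Bool) (u v : List Bool) (d : Web (u ++ v)) :
      WebRel
        (fw (Web.cap (w' := u ++ [s, s, s] ++ v) (!s) u ([s, s, s] ++ v)
          (Web.tripod s (u ++ [!s]) ([s] ++ v) (Web.cup (!s) u v d : Web (u ++ [!s, s] ++ v)) :
            Web (u ++ [!s, s, s, s, s] ++ v))))
        (fw (Web.tripod s u v d))
  | loop (s : Bool) (u v : List Bool) (d : Web (u ++ v)) :
      WebRel
        (fw (Web.cap s u v (Web.cup s u v d : Web (u ++ [s, !s] ++ v))))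
        ((3 : ℂ) • fw d)
  | bigon (t : Bool) (u v : List Bool) (d : Web (u ++ [t] ++ v)) :
      WebRel
        (fw (Web.merge (!t) u v (Web.split t u v d : Web (u ++ [!t, !t] ++ v))))
        ((-2 : ℂ) • fw d)
  | square (s : Bool) (u v : List Bool) (d : Web (u ++ v)) :
      WebRel
        (fw (Web.cap (w' := u ++ [s, !s, s, !s] ++ v) (!s) (u ++ [s, !s]) ([s, !s] ++ v)
          (Web.split (!s) (u ++ [s, !s, !s]) ([!s] ++ v)
            (Web.split s (u ++ [s]) ([!s, !s] ++ v)
              (Web.split s (u ++ [s, s]) v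
                (Web.split (!s) u ([s] ++ v)
                  (Web.cup (!s) u v d : Web (u ++ [!s, s] ++ v)) :
                  Web (u ++ [s, s, s] ++ v)) :
                Web (u ++ [s, s, !s, !s] ++ v)) :
              Web (u ++ [s, !s, !s, !s, !s] ++ v)) :
            Web (u ++ [s, !s, !s, s, s, !s] ++ v))))
        (fw (Web.cup (w' := u ++ [s, !s, s, !s] ++ v) s (u ++ [s, !s]) v
            (Web.cup s u v d : Web (u ++ [s, !s] ++ v))) +
          fw (Web.cup (w' := u ++ [s, !s, s, !s] ++ v) (!s) (u ++ [s]) ([!s] ++ v)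
            (Web.cup s u v d : Web (u ++ [s, !s] ++ v))))
  | slice {a b w w' : List Bool} (p : Piece a b) (u v : List Bool)
      (hw : w = u ++ a ++ v) (hw' : w' = u ++ b ++ v) {x y : Web w →₀ ℂ} :
      WebRel x y →
      WebRel (Finsupp.mapDomain (Web.slice p u v hw hw') x)
        (Finsupp.mapDomain (Web.slice p u v hw hw') y)

/-- The subspace spanned by the web relations. -/
def webRelations (w : List Bool) : Submodule ℂ (Web w →₀ ℂ) :=
  Submodule.span ℂ {z | ∃ x y, WebRel x y ∧ z = x - y}

/-- The vector space spanned by the webs with boundary word `w`, modulo isotopy and the local web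
relations. -/
abbrev WebModule (w : List Bool) : Type := (Web w →₀ ℂ) ⧸ webRelations w

/-- An operation on pictures which respects the web relations. -/
def Compatible {w w' : List Bool} (f : Web w → Web w') : Prop :=
  webRelations w ≤ (webRelations w').comap (Finsupp.lmapDomain ℂ ℂ f)

theorem Compatible.comp {w w' w'' : List Bool} {g : Web w' → Web w''} {f : Web w → Web w'}
    (hg : Compatible g) (hf : Compatible f) : Compatible (fun d => g (f d)) := by
  intro x hx
  have h := hg (hf hx)
  simp only [Submodule.mem_comap, Finsupp.lmapDomain_apply] at h ⊢
  rw [← Finsupp.mapDomain_comp] at h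
  exact h

theorem compatible_slice {a b w w' : List Bool} (p : Piece a b) (u v : List Bool)
    (hw : w = u ++ a ++ v) (hw' : w' = u ++ b ++ v) : Compatible (Web.slice p u v hw hw') := by
  refine Submodule.span_le.2 ?_
  rintro _ ⟨x, y, h, rfl⟩
  simp only [Submodule.comap_coe, Set.mem_preimage, map_sub, Finsupp.lmapDomain_apply,
    SetLike.mem_coe]
  exact Submodule.subset_span ⟨_, _, WebRel.slice p u v hw hw' h, rfl⟩

theorem compatible_split {w w' : List Bool} (t : Bool) (u v : List Bool)
    (hw : w = u ++ [t] ++ v) (hw' : w' = u ++ [!t, !t] ++ v) :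
    Compatible (fun d : Web w => (Web.split t u v d hw hw' : Web w')) :=
  (compatible_slice (Piece.cap t) _ _ _ _).comp (compatible_slice (Piece.tripod (!t)) _ _ _ _)

theorem compatible_merge {w w' : List Bool} (t : Bool) (u v : List Bool)
    (hw : w = u ++ [t, t] ++ v) (hw' : w' = u ++ [!t] ++ v) :
    Compatible (fun d : Web w => (Web.merge t u v d hw hw' : Web w')) :=
  (compatible_slice (Piece.cap t) _ _ _ _).comp
    ((compatible_slice (Piece.cap t) _ _ _ _).comp
      (compatible_slice (Piece.tripod (!t)) _ _ _ _))

/-- The boundary word of a web whose `3n` boundary points all are oriented out of the web. -/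
abbrev outWord (n : ℕ) : List Bool := List.replicate (3 * n) true

/-- The web space `D^{(n^3)}`. -/
abbrev WebSpace (n : ℕ) : Type := WebModule (outWord n)

theorem outWord_eq {n i : ℕ} (hi : i + 1 < 3 * n) :
    outWord n =
      List.replicate i true ++ [true, true] ++ List.replicate (3 * n - i - 2) true := by
  have h : 3 * n = i + (2 + (3 * n - i - 2)) := by omega
  conv_lhs => rw [outWord, h, List.replicate_add, List.replicate_add]
  simp [List.replicate]

/-- The term `H` of the skein relation: the strands at the positions `i` and `i + 1` (counted from
`0`) merge into one edge, which splits again into two strands. -/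
def ladder (n i : ℕ) (hi : i + 1 < 3 * n) (d : Web (outWord n)) : Web (outWord n) :=
  Web.split false (List.replicate i true) (List.replicate (3 * n - i - 2) true)
    (Web.merge true (List.replicate i true) (List.replicate (3 * n - i - 2) true) d
      (outWord_eq hi) :
      Web (List.replicate i true ++ [false] ++ List.replicate (3 * n - i - 2) true))
    (by simp) (outWord_eq hi)

theorem compatible_ladder (n i : ℕ) (hi : i + 1 < 3 * n) : Compatible (ladder n i hi) :=
  (compatible_split _ _ _ _ _).comp (compatible_merge _ _ _ _ _)

/-- Stacking a swap of the strands at the positions `i` and `i + 1` at the bottom of a web, the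
crossing being resolved by the skein relation `crossing = H + two vertical strands`. -/
def crossing (n i : ℕ) (hi : i + 1 < 3 * n) : WebSpace n →ₗ[ℂ] WebSpace n :=
  (webRelations _).mapQ (webRelations _) (Finsupp.lmapDomain ℂ ℂ (ladder n i hi))
    (compatible_ladder n i hi) + LinearMap.id

/-- The picture consisting of `n` tripods next to each other. -/
def tripods : ∀ n : ℕ, Web (outWord n)
  | 0 => Web.empty
  | n + 1 => Web.tripod true (outWord n) [] (tripods n) (by simp)
      (by rw [outWord, Nat.mul_succ, List.replicate_add]; simp [List.replicate])

/-- The web `W_0`, as an element of the web space. -/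
def webZero (n : ℕ) : WebSpace n := (webRelations _).mkQ (fw (tripods n))

/-! ### Fork diagrams and M-diagrams -/

/-- The `j`-th boundary point (`j = 0, 1, 2`) of the `k`-th tripod of `W_0`. -/
def point {n : ℕ} (k : Fin n) (j : Fin 3) : Fin (3 * n) := ⟨3 * k + j, by omega⟩

/-- `σ` keeps the relative order of the three boundary points of each tripod of `W_0`; these are the
minimal length coset representatives `σ` for which `W_0.σ` is a fork diagram. -/
def IsForkPerm {n : ℕ} (σ : Equiv.Perm (Fin (3 * n))) : Prop :=
  ∀ k : Fin n, StrictMono fun j : Fin 3 => σ (point k j)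

/-- The arcs of the fork diagram `W_0.σ`, as triples (left, middle, right endpoint). -/
def arcs {n : ℕ} (σ : Equiv.Perm (Fin (3 * n))) :
    Finset (Fin (3 * n) × Fin (3 * n) × Fin (3 * n)) :=
  Finset.univ.image fun k : Fin n => (σ (point k 0), σ (point k 1), σ (point k 2))

/-- No two left arcs cross and no two right arcs cross. -/
def PartialNonCrossing {n : ℕ} (A : Finset (Fin (3 * n) × Fin (3 * n) × Fin (3 * n))) : Prop :=
  ∀ x ∈ A, ∀ y ∈ A,
    ¬ (x.1 < y.1 ∧ y.1 < x.2.1 ∧ x.2.1 < y.2.1) ∧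
    ¬ (x.2.1 < y.2.1 ∧ y.2.1 < x.2.2 ∧ x.2.2 < y.2.2)

/-- The set `M^n` of M-diagrams with `3n` boundary points; a fork diagram is recorded by its
arcs. -/
def MDiagram (n : ℕ) : Type :=
  {A : Finset (Fin (3 * n) × Fin (3 * n) × Fin (3 * n)) //
    (∃ σ : Equiv.Perm (Fin (3 * n)), IsForkPerm σ ∧ arcs σ = A) ∧ PartialNonCrossing A}

/-! ### The Specht module of shape `(n, n, n)` -/

/-- Tableaux of shape `(n^3)`: fillings of the boxes (row, column). -/
abbrev Tableau (n : ℕ) : Type := Fin 3 × Fin n ≃ Fin (3 * n)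

/-- Row equivalence: each entry is in the same row of both tableaux. -/
def rowSetoid (n : ℕ) : Setoid (Tableau n) :=
  Setoid.ker fun (T : Tableau n) (p : Fin (3 * n)) => (T.symm p).1

/-- Tabloids of shape `(n^3)`. -/
def Tabloid (n : ℕ) : Type := Quotient (rowSetoid n)

/-- The tabloid of a tableau. -/
def Tabloid.mk {n : ℕ} (T : Tableau n) : Tabloid n := Quotient.mk (rowSetoid n) T

/-- The symmetric group permutes the entries of tabloids. -/
instance (n : ℕ) : MulAction (Equiv.Perm (Fin (3 * n))) (Tabloid n) where
  smul σ := Quotient.map (fun T : Tableau n => T.trans σ) (by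
    intro T T' h
    funext p
    exact congrFun h (σ.symm p))
  one_smul t := by
    induction t using Quotient.inductionOn
    rfl
  mul_smul σ τ t := by
    induction t using Quotient.inductionOn
    rfl

/-- `σ` maps the set of entries of each column of `T` to itself. -/
def IsColumnStabilizer {n : ℕ} (T : Tableau n) (σ : Equiv.Perm (Fin (3 * n))) : Prop :=
  ∀ p, (T.symm (σ p)).2 = (T.symm p).2

open Classical in
/-- The polytabloid `v_T`. -/
def polytabloid {n : ℕ} (T : Tableau n) : Tabloid n →₀ ℂ :=
  ∑ σ : Equiv.Perm (Fin (3 * n)) with IsColumnStabilizer T σ,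
    Finsupp.single (Tabloid.mk (T.trans σ)) ((Equiv.Perm.sign σ : ℤ) : ℂ)

/-- The Specht module `S^{(n^3)}`: the span of all polytabloids. -/
def Specht (n : ℕ) : Submodule ℂ (Tabloid n →₀ ℂ) :=
  Submodule.span ℂ (Set.range (polytabloid (n := n)))

/-- The linear action of a permutation on the span of the tabloids. -/
def permTabloids {n : ℕ} (τ : Equiv.Perm (Fin (3 * n))) :
    (Tabloid n →₀ ℂ) →ₗ[ℂ] (Tabloid n →₀ ℂ) :=
  Finsupp.lmapDomain ℂ ℂ fun t => τ • t

theorem perm_polytabloid {n : ℕ} (τ : Equiv.Perm (Fin (3 * n))) (T : Tableau n) :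
    permTabloids τ (polytabloid T) =
      polytabloid (T.trans τ) := by
  classical
  simp only [polytabloid, permTabloids, map_sum, Finsupp.lmapDomain_apply,
    Finsupp.mapDomain_single]
  refine Finset.sum_bij' (fun σ _ => τ * σ * τ⁻¹) (fun σ _ => τ⁻¹ * σ * τ) ?_ ?_ ?_ ?_ ?_
  · intro σ hσ
    simp only [Finset.mem_filter, Finset.mem_univ, true_and] at hσ ⊢
    intro p
    simpa using hσ (τ⁻¹ p)
  · intro σ hσ
    simp only [Finset.mem_filter, Finset.mem_univ, true_and] at hσ ⊢
    intro p
    simpa using hσ (τ p)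
  · intro σ _
    group
  · intro σ _
    group
  · intro σ _
    have h : τ • Tabloid.mk (T.trans σ) = Tabloid.mk ((T.trans σ).trans τ) := rfl
    have h' : (T.trans σ).trans τ = (T.trans τ).trans (τ * σ * τ⁻¹) := by
      ext x
      simp
    have hs : Equiv.Perm.sign (τ * σ * τ⁻¹) = Equiv.Perm.sign σ := by
      rw [Equiv.Perm.sign_mul, Equiv.Perm.sign_mul, Equiv.Perm.sign_inv,
        mul_comm (Equiv.Perm.sign τ), mul_assoc, Int.units_mul_self, mul_one]
    rw [h, h', hs]

theorem specht_invariant (n : ℕ) (τ : Equiv.Perm (Fin (3 * n))) :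
    ∀ x ∈ Specht n,
      permTabloids τ x ∈ Specht n := by
  intro x hx
  have h : Specht n ≤ (Specht n).comap
      (permTabloids τ) := by
    refine Submodule.span_le.2 ?_
    rintro _ ⟨T, rfl⟩
    simp only [Submodule.comap_coe, Set.mem_preimage, SetLike.mem_coe, perm_polytabloid]
    exact Submodule.subset_span ⟨_, rfl⟩
  exact h hx

/-- The action of the symmetric group on the Specht module. -/
def spechtRep (n : ℕ) : Representation ℂ (Equiv.Perm (Fin (3 * n))) (Specht n) where
  toFun τ := (permTabloids τ).restrict
    (specht_invariant n τ)
  map_one' := by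
    ext x : 2
    simp only [permTabloids, one_smul]
    exact Finsupp.mapDomain_id
  map_mul' σ τ := by
    ext x : 2
    simp [permTabloids, mul_smul, ← Finsupp.mapDomain_comp, Function.comp_def]

/-- The tableau `T_0` whose columns, read downwards, are `1 2 3`, `4 5 6`, and so on. -/
def tableauZero (n : ℕ) : Tableau n where
  toFun x := point x.2 x.1
  invFun p := (⟨p % 3, by omega⟩, ⟨p / 3, by omega⟩)
  left_inv x := by
    obtain ⟨r, k⟩ := x
    ext <;> simp only [point] <;> omega
  right_inv p := by
    ext
    simp only [point]
    omega

/-- The polytabloid `v_{T_0}`, as an element of the Specht module. -/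
def spechtZero (n : ℕ) : Specht n :=
  ⟨polytabloid (tableauZero n), Submodule.subset_span ⟨_, rfl⟩⟩

end Sl3

end

noncomputable section

namespace Sl3

open DirectSum

/-! ### Webs with arbitrary boundary words, and pieces attached at numbered positions -/

/-! The proof rests on two opposite statements about M-diagrams: they span the web space, and their
images under a linear map to combinations of tabloids are linearly independent. Together these give
the basis of webs, the injectivity of the map, and so an isomorphism onto its image. No dimension is
computed beforehand on either side.

Action. A ladder is a tripod and a sink sharing one edge (`lad_eq_snk_right`, `lad_eq_snk_left`).
Relations between ladders H_i therefore reduce to sliding tripods and sinks past each other,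
together with the bigon and square relations. The result is H_i^2 = -2 H_i and H_i H_{i+1} H_i - H_i
= H_{i+1} H_i H_{i+1} - H_{i+1}, which are the Coxeter relations for the crossings H_i + 1
(`coxeterRel_crs`). The presentation of the symmetric group (`exists_hom_of_coxeterRel`) turns them
into an action.

Spanning. The permuted rows of tripods span all webs (`tripodSpan_eq_top`). A picture is built slice
by slice, and a vertex is attached to each inward oriented end; by the bigon relation this can be
undone up to the factor -2. With only outward ends left, the slices amount to tripods, ladders and
sinks, and each of these preserves the span. For a sink, double cosets leave just four relative
positions of the sink and one tripod (`snk_zero_mem`). Next, the square relation yields a Garnir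
type exchange relation between two tripods (`forkVec_eq_sum`). Applied to a crossing of left arcs or
of right arcs it produces only terms of larger `rank`, so straightening stops at M-diagrams
(`mSpan_eq_top`).

Independence. Webs evaluate to tensors over a three-dimensional space, with the alternating tensor
at every vertex. This respects the web relations (`evLin_eq_of_rel`) and turns a crossing into the
flip of two factors (`evF_crs`). The coefficients at colorings that use every color n times form a
combination of tabloids. The web W_0 becomes v_{T_0} by the Leibniz formula (`tabloidMap_w0`), so
the image is the Specht module. In the image of an M-diagram, the tabloid whose rows are the left,
middle and right ends has coefficient 1 and is the unique highest one (`height_le_of_ne_zero`). It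
determines the diagram, because a noncrossing matching is determined by its left ends and its right
ends (`matching_unique`). -/

/-- The class of a web picture. -/
def webClass {w : List Bool} (d : Web w) : WebModule w := (webRelations w).mkQ (fw d)

theorem webModule_hom_ext {w : List Bool} {V : Type*} [AddCommMonoid V] [Module ℂ V]
    {F G : WebModule w →ₗ[ℂ] V} (h : ∀ d, F (webClass d) = G (webClass d)) : F = G := by
  have h' : F ∘ₗ (webRelations w).mkQ = G ∘ₗ (webRelations w).mkQ := by
    apply Finsupp.lhom_ext'
    intro d
    ext
    exact h d
  ext x
  obtain ⟨y, rfl⟩ := (webRelations w).mkQ_surjective x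
  exact LinearMap.congr_fun h' y

theorem mkQ_eq_of_rel {w : List Bool} {x y : Web w →₀ ℂ} (h : WebRel x y) :
    (webRelations w).mkQ x = (webRelations w).mkQ y := by
  rw [← sub_eq_zero, ← map_sub, Submodule.mkQ_apply, Submodule.Quotient.mk_eq_zero]
  exact Submodule.subset_span ⟨x, y, h, rfl⟩

/-- Attaching a piece, as a linear map. -/
def sliceMap {a b w w' : List Bool} (p : Piece a b) (u v : List Bool)
    (hw : w = u ++ a ++ v) (hw' : w' = u ++ b ++ v) : WebModule w →ₗ[ℂ] WebModule w' :=
  (webRelations w).mapQ (webRelations w') (Finsupp.lmapDomain ℂ ℂ (Web.slice p u v hw hw'))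
    (compatible_slice p u v hw hw')

theorem sliceMap_webClass {a b w w' : List Bool} (p : Piece a b) (u v : List Bool)
    (hw : w = u ++ a ++ v) (hw' : w' = u ++ b ++ v) (d : Web w) :
    sliceMap p u v hw hw' (webClass d) = webClass (Web.slice p u v hw hw' d) := by
  change (webRelations w').mkQ (Finsupp.mapDomain _ (fw d)) = _
  rw [Finsupp.mapDomain_single]
  rfl

/-- The direct sum of the web spaces of all boundary words. -/
abbrev BigWeb : Type := ⨁ w : List Bool, WebModule w

/-- The class of a web picture in the sum of all web spaces. -/
def pic {w : List Bool} (d : Web w) : BigWeb := lof ℂ (List Bool) WebModule w (webClass d)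

theorem bigWeb_ext {V : Type*} [AddCommMonoid V] [Module ℂ V]
    {F G : BigWeb →ₗ[ℂ] V} (h : ∀ w (d : Web w), F (pic d) = G (pic d)) (x : BigWeb) :
    F x = G x := by
  have : F = G := by
    apply DirectSum.linearMap_ext
    intro w
    exact webModule_hom_ext fun d => h w d
  rw [this]

theorem bigWeb_mem (S : Submodule ℂ BigWeb) (h : ∀ w (d : Web w), pic d ∈ S) (x : BigWeb) :
    x ∈ S := by
  induction x using DirectSum.induction_on with
  | zero => exact S.zero_mem
  | add y z hy hz => exact S.add_mem hy hz
  | of w y =>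
    obtain ⟨z, rfl⟩ := (webRelations w).mkQ_surjective y
    change z ∈ S.comap (lof ℂ (List Bool) WebModule w ∘ₗ (webRelations w).mkQ)
    induction z using Finsupp.induction_linear with
    | zero => exact Submodule.zero_mem _
    | add y z hy hz => exact Submodule.add_mem _ hy hz
    | single d c =>
      have e : Finsupp.single d c = c • fw d := by simp [fw]
      rw [e]
      exact Submodule.smul_mem _ _ (h w d)

open Classical in
/-- Attach a piece to the right of the first `k` strands; zero where this is impossible. -/
def op {a b : List Bool} (p : Piece a b) (k : ℕ) : BigWeb →ₗ[ℂ] BigWeb :=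
  DirectSum.toModule ℂ (List Bool) BigWeb fun w =>
    -- The bound on `k` is not implied by the equation: for empty `a` the latter also holds when `k`
    -- exceeds the length of `w`.
    if h : w = w.take k ++ a ++ w.drop (k + a.length) ∧ k ≤ w.length then
      lof ℂ (List Bool) WebModule (w.take k ++ b ++ w.drop (k + a.length)) ∘ₗ
        sliceMap p _ _ h.1 rfl
    else 0

theorem op_pic {a b w w' : List Bool} (p : Piece a b) (u v : List Bool)
    (hw : w = u ++ a ++ v) (hw' : w' = u ++ b ++ v) (d : Web w) {k : ℕ} (hk : k = u.length) :
    op p k (pic d) = pic (Web.slice p u v hw hw' d) := by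
  subst hk
  have h1 : w.take u.length = u := by simp [hw]
  have h2 : w.drop (u.length + a.length) = v := by
    rw [hw, ← List.length_append, List.drop_left]
  have h : w = w.take u.length ++ a ++ w.drop (u.length + a.length) ∧ u.length ≤ w.length := by
    rw [h1, h2]
    exact ⟨hw, by simp [hw]⟩
  have key : ∀ (u' v' : List Bool) (e : w = u' ++ a ++ v'), u' = u → v' = v →
      lof ℂ (List Bool) WebModule (u' ++ b ++ v') (sliceMap p u' v' e rfl (webClass d)) =
        pic (Web.slice p u v hw hw' d) := by
    rintro u' v' e rfl rfl
    subst hw'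
    rw [sliceMap_webClass, pic]
  rw [op, pic, toModule_lof, dif_pos h]
  exact key _ _ _ h1 h2

theorem op_pic_of_not {a b w : List Bool} (p : Piece a b) (d : Web w) {k : ℕ}
    (h : ¬ ∃ u v, w = u ++ a ++ v ∧ k = u.length) : op p k (pic d) = 0 := by
  rw [op, pic, toModule_lof, dif_neg, LinearMap.zero_apply]
  rintro ⟨h1, h2⟩
  exact h ⟨_, _, h1, by simp [h2]⟩

theorem pic_eq_of_rel {w : List Bool} {d d' : Web w} (h : WebRel (fw d) (fw d')) :
    pic d = pic d' := by
  rw [pic, pic, webClass, mkQ_eq_of_rel h, webClass]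

theorem pic_eq_smul_of_rel {w : List Bool} {d d' : Web w} {c : ℂ}
    (h : WebRel (fw d) (c • fw d')) : pic d = c • pic d' := by
  rw [pic, pic, webClass, mkQ_eq_of_rel h, map_smul, map_smul, webClass]

theorem pic_eq_add_of_rel {w : List Bool} {d d' d'' : Web w}
    (h : WebRel (fw d) (fw d' + fw d'')) : pic d = pic d' + pic d'' := by
  rw [pic, pic, pic, webClass, mkQ_eq_of_rel h, map_add, map_add, webClass, webClass]

theorem append_eq_append_split {α : Type*} {u a v u' z : List α} (h : u ++ a ++ v = u' ++ z)
    (hl : u.length + a.length ≤ u'.length) : ∃ m, u' = u ++ a ++ m ∧ v = m ++ z := by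
  rcases List.append_eq_append_iff.1 h with ⟨m, h1, h2⟩ | ⟨m, h1, h2⟩
  · exact ⟨m, h1, h2⟩
  · have : m = [] := by
      have := congrArg List.length h1
      simp only [List.length_append] at this
      exact List.length_eq_zero_iff.1 (by omega)
    subst this
    exact ⟨[], by simpa using h1.symm, by simpa using h2.symm⟩

/-- Pieces at disjoint places may be exchanged in height. -/
theorem op_comm {a b a' b' : List Bool} (p : Piece a b) (q : Piece a' b') (k j j' : ℕ)
    (x : BigWeb)
    (h1 : k + b.length ≤ j := by simp only [List.length_cons, List.length_nil] <;> omega)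
    (h2 : j + a.length = j' + b.length := by
      simp only [List.length_cons, List.length_nil] <;> omega) :
    op q j (op p k x) = op p k (op q j' x) := by
  refine bigWeb_ext (F := op q j ∘ₗ op p k) (G := op p k ∘ₗ op q j') ?_ x
  intro w d
  simp only [LinearMap.comp_apply]
  by_cases hp : ∃ u v, w = u ++ a ++ v ∧ k = u.length
  · obtain ⟨u, v, rfl, rfl⟩ := hp
    by_cases hq : ∃ m v', v = m ++ a' ++ v' ∧ j' = u.length + a.length + m.length
    · obtain ⟨m, v', rfl, rfl⟩ := hq
      have e : u ++ a ++ (m ++ a' ++ v') = u ++ a ++ m ++ a' ++ v' := by simp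
      revert d
      rw [e]
      intro d
      rw [op_pic p u (m ++ a' ++ v') (by simp) (w' := u ++ b ++ m ++ a' ++ v') (by simp) d rfl,
        op_pic q (u ++ b ++ m) v' (by simp) (w' := u ++ b ++ m ++ b' ++ v') (by simp) _
          (by simp; omega),
        op_pic q (u ++ a ++ m) v' (by simp) (w' := u ++ a ++ m ++ b' ++ v') (by simp) d
          (by simp; omega),
        op_pic p u (m ++ b' ++ v') (by simp) (w' := u ++ b ++ m ++ b' ++ v') (by simp) _ rfl]
      exact pic_eq_of_rel (WebRel.exchange p q u m v' d)
    -- The piece `p` leaves the word on its right unchanged, so `q` fits below `p` exactly when it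
    -- fits above it. Otherwise both sides are zero.
    · rw [op_pic_of_not q d, map_zero, op_pic p u v rfl rfl d rfl, op_pic_of_not q]
      · rintro ⟨u', v', h, h'⟩
        rw [List.append_assoc u'] at h
        obtain ⟨m, rfl, rfl⟩ := append_eq_append_split h (by omega)
        refine hq ⟨m, v', by simp, ?_⟩
        simp at h'
        omega
      · rintro ⟨u', v', h, h'⟩
        rw [List.append_assoc u'] at h
        obtain ⟨m, rfl, rfl⟩ := append_eq_append_split h (by omega)
        refine hq ⟨m, v', by simp, ?_⟩
        simp at h'
        omega
  · rw [op_pic_of_not p d hp, map_zero]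
    by_cases hq : ∃ u v, w = u ++ a' ++ v ∧ j' = u.length
    · obtain ⟨u, v, rfl, rfl⟩ := hq
      rw [op_pic q u v rfl rfl d rfl, op_pic_of_not p]
      rintro ⟨u', v', h, rfl⟩
      rw [List.append_assoc u] at h
      obtain ⟨m, rfl, h⟩ := append_eq_append_split h.symm (by omega)
      exact hp ⟨u', m ++ (a' ++ v), by simp, rfl⟩
    · rw [op_pic_of_not q d hq, map_zero]

/-! ### Letters of the boundary word -/

/-- The part of the sum of all web spaces where the boundary word has the letter `s` at `k`. -/
def letterSub (k : ℕ) (s : Bool) : Submodule ℂ BigWeb :=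
  Submodule.span ℂ {x | ∃ (w : List Bool) (d : Web w), w[k]? = some s ∧ x = pic d}

/-- The zigzag and bigon relations need a strand of known orientation at `k`. An identity under such
a hypothesis is reduced here to pictures whose boundary word is cut at that letter. -/
theorem eq_of_mem_letterSub {V : Type*} [AddCommMonoid V] [Module ℂ V] {k : ℕ} {s : Bool}
    (F G : BigWeb →ₗ[ℂ] V)
    (h : ∀ (u v : List Bool) (d : Web (u ++ [s] ++ v)), k = u.length → F (pic d) = G (pic d))
    {x : BigWeb} (hx : x ∈ letterSub k s) : F x = G x := by
  have : letterSub k s ≤ LinearMap.eqLocus F G := by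
    refine Submodule.span_le.2 ?_
    rintro _ ⟨w, d, hw, rfl⟩
    obtain ⟨hk, hs⟩ := List.getElem?_eq_some_iff.1 hw
    have e : w = w.take k ++ [s] ++ w.drop (k + 1) := by
      rw [← hs]; simp
    have hl : (w.take k).length = k := by simp; omega
    generalize w.take k = u at e hl
    generalize w.drop (k + 1) = v at e
    subst e
    exact h u v d hl.symm
  exact this hx

theorem op_pic_cases {a b w : List Bool} (p : Piece a b) (d : Web w) (k : ℕ)
    (S : Submodule ℂ BigWeb)
    (h : ∀ (u v : List Bool), w = u ++ a ++ v → k = u.length →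
      ∀ d' : Web (u ++ b ++ v), pic d' ∈ S) : op p k (pic d) ∈ S := by
  by_cases hp : ∃ u v, w = u ++ a ++ v ∧ k = u.length
  · obtain ⟨u, v, hw, hk⟩ := hp
    rw [op_pic p u v hw rfl d hk]
    exact h u v hw hk _
  · rw [op_pic_of_not p d hp]
    exact S.zero_mem

theorem letterSub_op_of_lt {a b : List Bool} (p : Piece a b) {k j : ℕ} {s : Bool} {x : BigWeb}
    (hx : x ∈ letterSub k s) (h : k < j) : op p j x ∈ letterSub k s := by
  have : letterSub k s ≤ (letterSub k s).comap (op p j) := by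
    refine Submodule.span_le.2 ?_
    rintro _ ⟨w, d, hw, rfl⟩
    refine op_pic_cases p d j (letterSub k s) fun u v e hj d' =>
      Submodule.subset_span ⟨_, d', ?_, rfl⟩
    rw [e, List.append_assoc, List.getElem?_append_left (by omega)] at hw
    rw [List.append_assoc, List.getElem?_append_left (by omega), hw]
  exact this hx

theorem letterSub_op_of_ge {a b : List Bool} (p : Piece a b) {k k' j : ℕ} {s : Bool} {x : BigWeb}
    (hx : x ∈ letterSub k s)
    (h : j + a.length ≤ k := by simp only [List.length_cons, List.length_nil] <;> omega)
    (h' : k' + a.length = k + b.length := by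
      simp only [List.length_cons, List.length_nil] <;> omega) : op p j x ∈ letterSub k' s := by
  have : letterSub k s ≤ (letterSub k' s).comap (op p j) := by
    refine Submodule.span_le.2 ?_
    rintro _ ⟨w, d, hw, rfl⟩
    refine op_pic_cases p d j (letterSub k' s) fun u v e hj d' =>
      Submodule.subset_span ⟨_, d', ?_, rfl⟩
    rw [e, List.getElem?_append_right (by simp; omega)] at hw
    rw [List.getElem?_append_right (by simp; omega), ← hw]
    congr 1
    simp
    omega
  exact this hx

theorem letterSub_op_new {a b : List Bool} (p : Piece a b) {j i k : ℕ} {s : Bool} (x : BigWeb)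
    (h : b[i]? = some s) (hk : k = j + i) : op p j x ∈ letterSub k s := by
  refine bigWeb_mem ((letterSub k s).comap (op p j)) (fun w d => ?_) x
  refine op_pic_cases p d j (letterSub k s) fun u v e hj d' =>
    Submodule.subset_span ⟨_, d', ?_, rfl⟩
  have hi := (List.getElem?_eq_some_iff.1 h).1
  rw [List.append_assoc, List.getElem?_append_right (by omega),
    List.getElem?_append_left (by omega), ← h]
  congr 1
  omega

theorem op_eq_zero_of_letter {a b : List Bool} (p : Piece a b) {j k i : ℕ} {s : Bool} {x : BigWeb}
    (hx : x ∈ letterSub k s) (h : a[i]? = some (!s)) (hk : k = j + i) : op p j x = 0 := by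
  refine eq_of_mem_letterSub (op p j) 0 ?_ hx
  intro u v d hu
  rw [op_pic_of_not, LinearMap.zero_apply]
  rintro ⟨u', v', e, rfl⟩
  have h1 : (u ++ [s] ++ v)[k]? = some s := by simp [hu]
  have hi := (List.getElem?_eq_some_iff.1 h).1
  rw [e, List.append_assoc, List.getElem?_append_right (by omega),
    List.getElem?_append_left (by omega), hk, Nat.add_sub_cancel_left, h] at h1
  cases s <;> simp at h1

/-! ### The relations for attached pieces -/

theorem op_zigzagLeft (s : Bool) (k : ℕ) {x : BigWeb} (hx : x ∈ letterSub k s) :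
    op (Piece.cap (!s)) (k + 1) (op (Piece.cup s) k x) = x := by
  refine eq_of_mem_letterSub (op (Piece.cap (!s)) (k + 1) ∘ₗ op (Piece.cup s) k) LinearMap.id ?_ hx
  rintro u v d rfl
  rw [LinearMap.comp_apply, op_pic (Piece.cup s) u ([s] ++ v) (by simp)
    (w' := u ++ [s, !s, s] ++ v) (by simp) d rfl,
    op_pic (Piece.cap (!s)) (u ++ [s]) v (by simp) (w' := u ++ [s] ++ v) (by simp) _ (by simp)]
  exact pic_eq_of_rel (WebRel.zigzagLeft s u v d)

theorem op_zigzagRight (s : Bool) (k : ℕ) {x : BigWeb} (hx : x ∈ letterSub k s) :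
    op (Piece.cap s) k (op (Piece.cup (!s)) (k + 1) x) = x := by
  refine eq_of_mem_letterSub (op (Piece.cap s) k ∘ₗ op (Piece.cup (!s)) (k + 1)) LinearMap.id ?_ hx
  rintro u v d rfl
  rw [LinearMap.comp_apply, op_pic (Piece.cup (!s)) (u ++ [s]) v (by simp)
    (w' := u ++ [s, !s, s] ++ v) (by simp) d (by simp),
    op_pic (Piece.cap s) u ([s] ++ v) (by simp) (w' := u ++ [s] ++ v) (by simp) _ (by simp)]
  exact pic_eq_of_rel (WebRel.zigzagRight s u v d)

theorem op_rotateLeft (s : Bool) (k : ℕ) (x : BigWeb) :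
    op (Piece.cap (!s)) k (op (Piece.tripod s) (k + 1) (op (Piece.cup (!s)) k x)) =
      op (Piece.tripod s) k x := by
  refine bigWeb_ext (F := op (Piece.cap (!s)) k ∘ₗ op (Piece.tripod s) (k + 1) ∘ₗ
    op (Piece.cup (!s)) k) (G := op (Piece.tripod s) k) ?_ x
  intro w d
  simp only [LinearMap.comp_apply]
  by_cases hk : k ≤ w.length
  · have e : w = w.take k ++ w.drop k := by simp
    have hl : (w.take k).length = k := by simp [hk]
    generalize w.take k = u at e hl
    generalize w.drop k = v at e
    subst e hl
    rw [op_pic (Piece.cup (!s)) u v (by simp) (w' := u ++ [!s, s] ++ v) (by simp) d rfl,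
      op_pic (Piece.tripod s) (u ++ [!s]) ([s] ++ v) (by simp)
        (w' := u ++ [!s, s, s, s, s] ++ v) (by simp) _ (by simp),
      op_pic (Piece.cap (!s)) u ([s, s, s] ++ v) (by simp) (w' := u ++ [s, s, s] ++ v) (by simp) _
        rfl,
      op_pic (Piece.tripod s) u v (by simp) (w' := u ++ [s, s, s] ++ v) (by simp) d rfl]
    exact pic_eq_of_rel (WebRel.rotateLeft s u v d)
  · rw [op_pic_of_not (Piece.cup (!s)), op_pic_of_not (Piece.tripod s)]
    · simp
    all_goals
      rintro ⟨u, v, rfl, rfl⟩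
      simp at hk

theorem op_loop (s : Bool) (u v : List Bool) (d : Web (u ++ v)) {k : ℕ} (hk : k = u.length) :
    op (Piece.cap s) k (op (Piece.cup s) k (pic d)) = (3 : ℂ) • pic d := by
  subst hk
  rw [op_pic (Piece.cup s) u v (by simp) (w' := u ++ [s, !s] ++ v) (by simp) d rfl,
    op_pic (Piece.cap s) u v (by simp) (w' := u ++ v) (by simp) _ rfl]
  exact pic_eq_smul_of_rel (WebRel.loop s u v d)

/-- Attach a vertex to the strand at `k`. -/
def splitOp (t : Bool) (k : ℕ) : BigWeb →ₗ[ℂ] BigWeb :=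
  op (Piece.cap t) k ∘ₗ op (Piece.tripod (!t)) (k + 1)

/-- Join the strands at `k` and `k + 1` at a vertex. -/
def mergeOp (t : Bool) (k : ℕ) : BigWeb →ₗ[ℂ] BigWeb :=
  op (Piece.cap t) k ∘ₗ op (Piece.cap t) (k + 1) ∘ₗ op (Piece.tripod (!t)) (k + 2)

theorem splitOp_apply (t : Bool) (k : ℕ) (x : BigWeb) :
    splitOp t k x = op (Piece.cap t) k (op (Piece.tripod (!t)) (k + 1) x) := rfl

theorem mergeOp_apply (t : Bool) (k : ℕ) (x : BigWeb) :
    mergeOp t k x =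
      op (Piece.cap t) k (op (Piece.cap t) (k + 1) (op (Piece.tripod (!t)) (k + 2) x)) := rfl

theorem splitOp_pic {w w' : List Bool} (t : Bool) (u v : List Bool)
    (hw : w = u ++ [t] ++ v) (hw' : w' = u ++ [!t, !t] ++ v) (d : Web w) {k : ℕ}
    (hk : k = u.length) : splitOp t k (pic d) = pic (Web.split t u v d hw hw') := by
  subst hk
  rw [splitOp_apply, op_pic (Piece.tripod (!t)) (u ++ [t]) v (by simp [hw])
      (w' := u ++ [t, !t, !t, !t] ++ v) (by simp) d (by simp),
    op_pic (Piece.cap t) u ([!t, !t] ++ v) (by simp) (w' := w') (by simp [hw']) _ (by simp)]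
  rfl

theorem mergeOp_pic {w w' : List Bool} (t : Bool) (u v : List Bool)
    (hw : w = u ++ [t, t] ++ v) (hw' : w' = u ++ [!t] ++ v) (d : Web w) {k : ℕ}
    (hk : k = u.length) : mergeOp t k (pic d) = pic (Web.merge t u v d hw hw') := by
  subst hk
  rw [mergeOp_apply, op_pic (Piece.tripod (!t)) (u ++ [t, t]) v (by simp [hw])
      (w' := u ++ [t, t, !t, !t, !t] ++ v) (by simp) d (by simp),
    op_pic (Piece.cap t) (u ++ [t]) ([!t, !t] ++ v) (by simp)
      (w' := u ++ [t, !t, !t] ++ v) (by simp) _ (by simp),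
    op_pic (Piece.cap t) u ([!t] ++ v) (by simp) (w' := w') (by simp [hw']) _ (by simp)]
  rfl

theorem op_bigon (t : Bool) (k : ℕ) {x : BigWeb} (hx : x ∈ letterSub k t) :
    mergeOp (!t) k (splitOp t k x) = (-2 : ℂ) • x := by
  refine eq_of_mem_letterSub (mergeOp (!t) k ∘ₗ splitOp t k) ((-2 : ℂ) • LinearMap.id) ?_ hx
  rintro u v d hk
  rw [LinearMap.comp_apply, splitOp_pic t u v rfl rfl d hk,
    mergeOp_pic (!t) u v rfl (w' := u ++ [t] ++ v) (by simp) _ hk]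
  exact pic_eq_smul_of_rel (WebRel.bigon t u v d)

theorem op_square (u v : List Bool) (d : Web (u ++ v)) {k : ℕ} (hk : k = u.length) :
    op (Piece.cap false) (k + 2) (splitOp false (k + 3) (splitOp true (k + 1) (splitOp true (k + 2)
      (splitOp false k (op (Piece.cup false) k (pic d)))))) =
    op (Piece.cup true) (k + 2) (op (Piece.cup true) k (pic d)) +
      op (Piece.cup false) (k + 1) (op (Piece.cup true) k (pic d)) := by
  subst hk
  rw [op_pic (Piece.cup false) u v (by simp) (w' := u ++ [false, true] ++ v) (by simp) d rfl,
    splitOp_pic false u ([true] ++ v) (by simp)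
      (w' := u ++ [true, true, true] ++ v) (by simp) _ rfl,
    splitOp_pic true (u ++ [true, true]) v (by simp)
      (w' := u ++ [true, true, false, false] ++ v) (by simp) _ (by simp),
    splitOp_pic true (u ++ [true]) ([false, false] ++ v) (by simp)
      (w' := u ++ [true, false, false, false, false] ++ v)
      (by simp) _ (by simp),
    splitOp_pic false (u ++ [true, false, false]) ([false] ++ v) (by simp)
      (w' := u ++ [true, false, false, true, true, false] ++ v) (by simp) _ (by simp),
    op_pic (Piece.cap false) (u ++ [true, false]) ([true, false] ++ v) (by simp)
      (w' := u ++ [true, false, true, false] ++ v) (by simp) _ (by simp),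
    op_pic (Piece.cup true) u v (by simp) (w' := u ++ [true, false] ++ v) (by simp) d rfl,
    op_pic (Piece.cup true) (u ++ [true, false]) v (by simp)
      (w' := u ++ [true, false, true, false] ++ v) (by simp) _ (by simp),
    op_pic (Piece.cup false) (u ++ [true]) ([false] ++ v) (by simp)
      (w' := u ++ [true, false, true, false] ++ v) (by simp) _ (by simp)]
  exact pic_eq_add_of_rel (WebRel.square true u v d)

end Sl3

namespace Sl3

/-! ### Planar computations -/

local notation "tT" => op (Piece.tripod true)
local notation "tF" => op (Piece.tripod false)
local notation "dT" => op (Piece.cap true)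
local notation "dF" => op (Piece.cap false)
local notation "cT" => op (Piece.cup true)
local notation "cF" => op (Piece.cup false)

/-- Join the three strands at `k`, `k + 1`, `k + 2` at a sink. -/
def sinkOp (k : ℕ) : BigWeb →ₗ[ℂ] BigWeb := dT k ∘ₗ mergeOp true (k + 1)

/-- The ladder at the strands `k`, `k + 1`. -/
def ladderOp (k : ℕ) : BigWeb →ₗ[ℂ] BigWeb := splitOp false k ∘ₗ mergeOp true k

theorem sinkOp_apply (k : ℕ) (x : BigWeb) :
    sinkOp k x = dT k (dT (k + 1) (dT (k + 2) (tF (k + 3) x))) := rfl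

theorem ladderOp_apply (k : ℕ) (x : BigWeb) :
    ladderOp k x = dF k (tT (k + 1) (mergeOp true k x)) := rfl

theorem mergeOp_true_apply (k : ℕ) (x : BigWeb) :
    mergeOp true k x = dT k (dT (k + 1) (tF (k + 2) x)) := rfl

/-- Writing the vertex in rotated form produces a zigzag, which is then straightened: a strand may
enter a vertex through its leftmost or its rightmost leg. The later planar computations use the
rotation of vertices only through this lemma and `splitOp_false_eq`. -/
theorem splitOp_true_eq {k : ℕ} {x : BigWeb} (hx : x ∈ letterSub k true) :
    dT k (tF (k + 1) x) = dF (k + 2) (tF k x) := by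
  have h : tF k x = dT k (tF (k + 1) (cT k x)) := (op_rotateLeft false k x).symm
  have hz : dF (k + 1) (cT k x) = x := op_zigzagLeft true k hx
  rw [h, op_comm (Piece.cap true) (Piece.cap false) k (k + 2) (k + 4),
    op_comm (Piece.tripod false) (Piece.cap false) (k + 1) (k + 4) (k + 1), hz]

theorem splitOp_false_eq {k : ℕ} {x : BigWeb} (hx : x ∈ letterSub k false) :
    dF k (tT (k + 1) x) = dT (k + 2) (tT k x) := by
  have h : tT k x = dF k (tT (k + 1) (cF k x)) := (op_rotateLeft true k x).symm
  have hz : dT (k + 1) (cF k x) = x := op_zigzagLeft false k hx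
  rw [h, op_comm (Piece.cap false) (Piece.cap true) k (k + 2) (k + 4),
    op_comm (Piece.tripod true) (Piece.cap true) (k + 1) (k + 4) (k + 1), hz]

theorem mergeOp_mem_letterSub (k : ℕ) (x : BigWeb) : mergeOp true k x ∈ letterSub k false := by
  rw [mergeOp_true_apply]
  refine letterSub_op_of_ge (k := k + 2) _ (letterSub_op_of_ge (k := k + 4) _ ?_)
  exact letterSub_op_new (i := 2) _ _ rfl rfl

theorem splitOp_true_mem_left (k : ℕ) (x : BigWeb) : splitOp true k x ∈ letterSub k false := by
  rw [splitOp_apply]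
  refine letterSub_op_of_ge (k := k + 2) _ ?_
  exact letterSub_op_new (i := 1) _ _ rfl rfl

theorem splitOp_true_mem_right (k : ℕ) (x : BigWeb) :
    splitOp true k x ∈ letterSub (k + 1) false := by
  rw [splitOp_apply]
  refine letterSub_op_of_ge (k := k + 3) _ ?_
  exact letterSub_op_new (i := 2) _ _ rfl rfl

/-- The middle edge of the ladder is read as a leg of a tripod: a tripod is inserted left of the two
strands, and its rightmost leg meets them in a sink. In this form only outward oriented words occur.
-/
theorem ladderOp_eq_sinkOp_right (k : ℕ) (x : BigWeb) :
    ladderOp k x = sinkOp (k + 2) (tT k x) := by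
  rw [ladderOp_apply, splitOp_false_eq (mergeOp_mem_letterSub k x), mergeOp_true_apply,
    ← op_comm (Piece.tripod true) (Piece.cap true) k (k + 3) k,
    ← op_comm (Piece.tripod true) (Piece.cap true) k (k + 4) (k + 1),
    ← op_comm (Piece.tripod true) (Piece.tripod false) k (k + 5) (k + 2)]
  rfl

theorem ladderOp_eq_sinkOp_left (k : ℕ) (x : BigWeb) :
    ladderOp k x = sinkOp k (tT (k + 2) x) := by
  have h : tT (k + 2) x ∈ letterSub (k + 2) true := letterSub_op_new (i := 0) _ _ rfl rfl
  rw [sinkOp_apply, splitOp_true_eq h, ladderOp_apply, mergeOp_true_apply,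
    op_comm (Piece.cap true) (Piece.tripod true) k (k + 1) (k + 3),
    op_comm (Piece.cap true) (Piece.tripod true) (k + 1) (k + 3) (k + 5),
    op_comm (Piece.cap true) (Piece.cap false) k k (k + 2),
    op_comm (Piece.cap true) (Piece.cap false) (k + 1) (k + 2) (k + 4),
    op_comm (Piece.tripod false) (Piece.tripod true) (k + 2) (k + 5) (k + 2)]

/-- Two legs of the tripod end in the sink and form a bigon; the third leg and the third edge of the
sink are the two halves of the strand. -/
theorem sinkOp_succ_tripod {k : ℕ} {x : BigWeb} (hx : x ∈ letterSub k true) :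
    sinkOp (k + 1) (tT k x) = (-2 : ℂ) • x := by
  have hb : dF k (dF (k + 1) (tT (k + 2) (splitOp true k x))) = (-2 : ℂ) • x :=
    op_bigon true k hx
  have h1 : dF (k + 1) (tT (k + 2) (splitOp true k x)) =
      dT (k + 3) (tT (k + 1) (splitOp true k x)) :=
    splitOp_false_eq (splitOp_true_mem_right k x)
  rw [← hb, h1, ← op_comm (Piece.cap false) (Piece.cap true) k (k + 1) (k + 3),
    splitOp_false_eq (splitOp_true_mem_left k x), splitOp_apply,
    ← op_comm (Piece.tripod true) (Piece.cap true) k (k + 3) k]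
  erw [← op_comm (Piece.tripod true) (Piece.tripod false) k (k + 4) (k + 1)]
  rfl

theorem sinkOp_tripod_succ {k : ℕ} {x : BigWeb} (hx : x ∈ letterSub k true) :
    sinkOp k (tT (k + 1) x) = (-2 : ℂ) • x := by
  have hb : dF k (dF (k + 1) (tT (k + 2) (splitOp true k x))) = (-2 : ℂ) • x :=
    op_bigon true k hx
  have h1 : tT (k + 1) x ∈ letterSub (k + 1) true := letterSub_op_new (i := 0) _ _ rfl rfl
  have h2 : tT (k + 1) x ∈ letterSub (k + 2) true := letterSub_op_new (i := 1) _ _ rfl rfl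
  rw [sinkOp_apply, splitOp_true_eq h2,
    ← op_comm (Piece.cap true) (Piece.cap false) (k + 1) (k + 2) (k + 4),
    splitOp_true_eq h1,
    ← op_comm (Piece.tripod false) (Piece.tripod true) (k + 1) (k + 4) (k + 1), ← hb,
    ← op_comm (Piece.cap true) (Piece.cap false) k k (k + 2),
    ← op_comm (Piece.cap true) (Piece.cap false) k (k + 1) (k + 3),
    ← op_comm (Piece.cap true) (Piece.tripod true) k (k + 2) (k + 4)]
  rfl

/-- Splitting the right end of a new arc gives a tripod. -/
theorem splitOp_cup_true (k : ℕ) (x : BigWeb) : splitOp false (k + 1) (cT k x) = tT k x := by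
  have h1 : tT k x ∈ letterSub k true := letterSub_op_new (i := 0) _ _ rfl rfl
  have hz : dF (k + 1) (cT k (tT k x)) = tT k x := op_zigzagLeft true k h1
  rw [← hz]
  change dF (k + 1) (tT (k + 2) (cT k x)) = _
  rw [op_comm (Piece.cup true) (Piece.tripod true) k (k + 2) k]

/-- Splitting the left end of a new arc gives a tripod. -/
theorem splitOp_cup_false (k : ℕ) (x : BigWeb) : splitOp false k (cF k x) = tT k x := by
  have h1 : tT k x ∈ letterSub (k + 2) true := letterSub_op_new (i := 2) _ _ rfl rfl
  have h2 : cF k x ∈ letterSub k false := letterSub_op_new (i := 0) _ _ rfl rfl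
  have hz : dT (k + 2) (cF (k + 3) (tT k x)) = tT k x := op_zigzagRight true (k + 2) h1
  rw [← hz]
  change dF k (tT (k + 1) (cF k x)) = _
  rw [splitOp_false_eq h2, op_comm (Piece.tripod true) (Piece.cup false) k (k + 3) k]

theorem mergeOp_splitOp {k : ℕ} {x : BigWeb} (hx : x ∈ letterSub k false) :
    mergeOp true k (splitOp false k x) = (-2 : ℂ) • x := op_bigon false k hx

/-- The closed theta graph is a bigon inserted in a loop, whence (-2) · 3. The bound on `k` is
needed because `op` vanishes beyond the end of the word. -/
theorem sinkOp_tripod {w : List Bool} (d : Web w) {k : ℕ} (hk : k ≤ w.length) :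
    sinkOp k (tT k (pic d)) = (-6 : ℂ) • pic d := by
  have h2 : cT k (pic d) ∈ letterSub (k + 1) false := letterSub_op_new (i := 1) _ _ rfl rfl
  have hl : dT k (cT k (pic d)) = (3 : ℂ) • pic d := by
    have e : w = w.take k ++ w.drop k := by simp
    have hl : (w.take k).length = k := by simp [hk]
    generalize w.take k = u at e hl
    generalize w.drop k = v at e
    subst e
    exact op_loop true u v d hl.symm
  rw [← splitOp_cup_true, sinkOp, LinearMap.comp_apply, mergeOp_splitOp h2, map_smul, hl]
  exact (smul_smul (-2 : ℂ) (3 : ℂ) (pic d)).trans (by norm_num)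

theorem cap_false_mergeOp {k : ℕ} {x : BigWeb} (hx : x ∈ letterSub (k + 2) true) :
    dF k (mergeOp true k x) = sinkOp k x := by
  rw [sinkOp_apply, splitOp_true_eq hx, mergeOp_true_apply,
    op_comm (Piece.cap true) (Piece.cap false) k k (k + 2),
    op_comm (Piece.cap true) (Piece.cap false) (k + 1) (k + 2) (k + 4)]

/-- Both sides draw the tree with one source and one sink joined by an edge, started once from the
sink and once from the source. -/
theorem splitOp_sink (k : ℕ) (x : BigWeb) :
    splitOp false k (tF k x) = splitOp true (k + 2) (tT k x) := by
  have h2 : tF k x ∈ letterSub k false := letterSub_op_new (i := 0) _ _ rfl rfl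
  change dF k (tT (k + 1) (tF k x)) = dT (k + 2) (tF (k + 3) (tT k x))
  rw [splitOp_false_eq h2, op_comm (Piece.tripod true) (Piece.tripod false) k (k + 3) k]

theorem splitOp_splitOp (k : ℕ) (x : BigWeb) :
    splitOp false (k + 1) (splitOp true k x) = mergeOp true k (tT (k + 1) x) := by
  have h2 : tT (k + 1) x ∈ letterSub (k + 1) true := letterSub_op_new (i := 0) _ _ rfl rfl
  rw [mergeOp_true_apply, splitOp_true_eq h2,
    ← op_comm (Piece.tripod false) (Piece.tripod true) (k + 1) (k + 4) (k + 1),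
    ← op_comm (Piece.cap true) (Piece.cap false) k (k + 1) (k + 3),
    ← op_comm (Piece.cap true) (Piece.tripod true) k (k + 2) (k + 4)]
  rfl

/-- A sink whose three legs have all received a vertex is a tree with six outward ends. It can be
drawn as two neighbouring tripods with a ladder between their facing legs. -/
theorem splitOp_splitOp_splitOp_sink (k : ℕ) (x : BigWeb) :
    splitOp false (k + 2) (splitOp false (k + 3) (splitOp false k (tF k x))) =
      ladderOp (k + 2) (tT (k + 3) (tT k x)) := by
  rw [splitOp_sink, splitOp_splitOp (k + 2)]
  rfl

theorem cap_false_splitOp {k : ℕ} {x : BigWeb} (hx : x ∈ letterSub (k + 1) true) :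
    dF (k + 1) (splitOp true k x) = mergeOp true k x := by
  rw [mergeOp_true_apply, splitOp_true_eq hx,
    ← op_comm (Piece.cap true) (Piece.cap false) k (k + 1) (k + 3)]
  rfl

/-- Two tripods one of which is joined to a strand by a ladder. -/
theorem ladderOp_tripod_add_two (k : ℕ) (x : BigWeb) :
    ladderOp (k + 2) (tT k x) = ladderOp k (tT (k + 1) x) := by
  rw [ladderOp_eq_sinkOp_left, ladderOp_eq_sinkOp_right,
    op_comm (Piece.tripod true) (Piece.tripod true) k (k + 4) (k + 1)]

theorem op_square_strand {k : ℕ} {x : BigWeb} (hx : x ∈ letterSub k true) :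
    mergeOp true (k + 1) (ladderOp k (tT (k + 1) x)) = cF (k + 1) x + cT k x := by
  have hsq : dF (k + 2) (splitOp false (k + 3) (splitOp true (k + 1) (splitOp true (k + 2)
      (splitOp false k (cF k x))))) = cT (k + 2) (cT k x) + cF (k + 1) (cT k x) := by
    refine eq_of_mem_letterSub (dF (k + 2) ∘ₗ splitOp false (k + 3) ∘ₗ splitOp true (k + 1) ∘ₗ
      splitOp true (k + 2) ∘ₗ splitOp false k ∘ₗ cF k) (cT (k + 2) ∘ₗ cT k + cF (k + 1) ∘ₗ cT k)
      ?_ hx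
    intro u v d hk
    have e : u ++ [true] ++ v = u ++ ([true] ++ v) := by simp
    revert d
    rw [e]
    intro d
    exact op_square u ([true] ++ v) d hk
  have hz : dF (k + 3) (cT (k + 2) (cT k x)) = cT k x :=
    op_zigzagLeft true (k + 2) (letterSub_op_of_ge (k := k) _ hx)
  have hz' : dF (k + 1) (cT k x) = x := op_zigzagLeft true k hx
  have hy : tT k x ∈ letterSub (k + 3) true := letterSub_op_of_ge (k := k) _ hx
  rw [splitOp_cup_false] at hsq
  -- The last end of the square is bent into the strand on its right. In each of the two arc
  -- pictures this creates a zigzag, which is straightened.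
  have h := congrArg (dF (k + 3)) hsq
  rw [map_add, hz, op_comm (Piece.cup false) (Piece.cap false) (k + 1) (k + 3) (k + 1), hz'] at h
  rw [add_comm (cF (k + 1) x), ← h, ← ladderOp_tripod_add_two]
  have hm : dF (k + 3) (splitOp true (k + 2) (tT k x)) = mergeOp true (k + 2) (tT k x) :=
    cap_false_splitOp hy
  have hl : splitOp false (k + 2) (mergeOp true (k + 2) (tT k x)) ∈ letterSub (k + 2) true := by
    refine letterSub_op_of_ge (k := k + 4) _ ?_
    exact letterSub_op_new (i := 1) _ _ rfl rfl
  have hc := cap_false_splitOp (k := k + 1) hl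
  rw [op_comm (Piece.cap false) (Piece.cap false) (k + 2) (k + 3) (k + 5),
    splitOp_apply false (k + 3),
    op_comm (Piece.cap false) (Piece.cap false) (k + 3) (k + 5) (k + 7)]
  change _ = dF (k + 2) (dF (k + 3) (dF (k + 7) (tT (k + 4) _)))
  rw [op_comm (Piece.tripod true) (Piece.cap false) (k + 4) (k + 7) (k + 4),
    splitOp_apply true (k + 1),
    op_comm (Piece.cap true) (Piece.cap false) (k + 1) (k + 4) (k + 6)]
  change _ = dF (k + 2) (dF (k + 3) (tT (k + 4) (dT (k + 1) (dF (k + 6) (tF (k + 2) _)))))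
  rw [op_comm (Piece.tripod false) (Piece.cap false) (k + 2) (k + 6) (k + 3), hm,
    op_comm (Piece.cap true) (Piece.tripod true) (k + 1) (k + 4) (k + 6),
    op_comm (Piece.tripod false) (Piece.tripod true) (k + 2) (k + 6) (k + 3),
    op_comm (Piece.cap true) (Piece.cap false) (k + 1) (k + 3) (k + 5),
    op_comm (Piece.tripod false) (Piece.cap false) (k + 2) (k + 5) (k + 2)]
  exact hc.symm

/-- A vertex is put on the remaining inward end in `op_square_strand`, which turns each of the two
arcs into a tripod. -/
theorem ladderOp_ladderOp_tripod {k : ℕ} {x : BigWeb} (hx : x ∈ letterSub k true) :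
    ladderOp (k + 1) (ladderOp k (tT (k + 1) x)) = tT k x + tT (k + 1) x := by
  rw [ladderOp, LinearMap.comp_apply, op_square_strand hx, map_add, splitOp_cup_true,
    splitOp_cup_false, add_comm]

/-! ### Operations at disjoint places -/

theorem splitOp_op {a b : List Bool} (p : Piece a b) (s : Bool) (i k k' : ℕ) (x : BigWeb)
    (h : i + b.length ≤ k' := by simp only [List.length_cons, List.length_nil] <;> omega)
    (h' : k' + a.length = k + b.length := by
      simp only [List.length_cons, List.length_nil] <;> omega) :
    splitOp s k' (op p i x) = op p i (splitOp s k x) := by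
  rw [splitOp_apply, splitOp_apply, op_comm p (Piece.tripod !s) i (k' + 1) (k + 1) x (by omega)
    (by omega), op_comm p (Piece.cap s) i k' k _ (by omega) (by omega)]

theorem op_splitOp {a b : List Bool} (p : Piece a b) (s : Bool) (i k : ℕ) (x : BigWeb)
    (h : k + 1 ≤ i := by omega) :
    op p (i + 1) (splitOp s k x) = splitOp s k (op p i x) := by
  rw [splitOp_apply, splitOp_apply, op_comm (Piece.cap s) p k (i + 1) (i + 3),
    op_comm (Piece.tripod !s) p (k + 1) (i + 3) i]

theorem sinkOp_op {a b : List Bool} (p : Piece a b) (i j j' : ℕ) (x : BigWeb)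
    (h : i + b.length ≤ j := by simp only [List.length_cons, List.length_nil] <;> omega)
    (h' : j + a.length = j' + b.length := by
      simp only [List.length_cons, List.length_nil] <;> omega) :
    sinkOp j (op p i x) = op p i (sinkOp j' x) := by
  rw [sinkOp_apply, sinkOp_apply,
    op_comm p (Piece.tripod false) i (j + 3) (j' + 3) x (by omega) (by omega),
    op_comm p (Piece.cap true) i (j + 2) (j' + 2) _ (by omega) (by omega),
    op_comm p (Piece.cap true) i (j + 1) (j' + 1) _ (by omega) (by omega),
    op_comm p (Piece.cap true) i j j' _ (by omega) (by omega)]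

theorem op_sinkOp {a b : List Bool} (p : Piece a b) (i j : ℕ) (x : BigWeb)
    (h : j ≤ i := by omega) : op p i (sinkOp j x) = sinkOp j (op p (i + 3) x) := by
  rw [sinkOp_apply, sinkOp_apply, op_comm (Piece.cap true) p j i (i + 2),
    op_comm (Piece.cap true) p (j + 1) (i + 2) (i + 4),
    op_comm (Piece.cap true) p (j + 2) (i + 4) (i + 6),
    op_comm (Piece.tripod false) p (j + 3) (i + 6) (i + 3)]

theorem sinkOp_sinkOp (i j : ℕ) (x : BigWeb) (h : i ≤ j := by omega) :
    sinkOp i (sinkOp (j + 3) x) = sinkOp j (sinkOp i x) := by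
  rw [sinkOp_apply j, sinkOp_apply (j + 3), op_sinkOp _ (j + 3) i, op_sinkOp _ (j + 2) i,
    op_sinkOp _ (j + 1) i, op_sinkOp _ j i]

theorem sinkOp_splitOp (s : Bool) (i k : ℕ) (x : BigWeb) (h : k + 1 ≤ i := by omega) :
    sinkOp (i + 1) (splitOp s k x) = splitOp s k (sinkOp i x) := by
  rw [sinkOp_apply, sinkOp_apply, ← op_splitOp _ s i k, ← op_splitOp _ s (i + 1) k,
    ← op_splitOp _ s (i + 2) k, ← op_splitOp _ s (i + 3) k]

theorem splitOp_sinkOp (s : Bool) (i k : ℕ) (x : BigWeb) (h : i ≤ k := by omega) :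
    splitOp s k (sinkOp i x) = sinkOp i (splitOp s (k + 3) x) := by
  rw [splitOp_apply, splitOp_apply, op_sinkOp _ (k + 1) i, op_sinkOp _ k i]

end Sl3

namespace Sl3

open DirectSum

/-! ### Webs all of whose boundary points are oriented outwards -/

/-- The web space of `N` outward oriented boundary points. -/
def WebN (N : ℕ) : Type := WebModule (List.replicate N true)

instance (N : ℕ) : AddCommGroup (WebN N) :=
  inferInstanceAs (AddCommGroup (WebModule (List.replicate N true)))

instance (N : ℕ) : Module ℂ (WebN N) :=
  inferInstanceAs (Module ℂ (WebModule (List.replicate N true)))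

/-- The inclusion into the sum of all web spaces. -/
def incl (N : ℕ) : WebN N →ₗ[ℂ] BigWeb := lof ℂ (List Bool) WebModule (List.replicate N true)

/-- The projection from the sum of all web spaces. -/
def projN (N : ℕ) : BigWeb →ₗ[ℂ] WebN N :=
  component ℂ (List Bool) WebModule (List.replicate N true)

theorem projN_incl {N : ℕ} (x : WebN N) : projN N (incl N x) = x :=
  DFinsupp.single_eq_same

theorem incl_injective (N : ℕ) : Function.Injective (incl N) :=
  Function.LeftInverse.injective projN_incl

/-- The class of a web picture. -/
def clN {N : ℕ} (d : Web (List.replicate N true)) : WebN N := webClass d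

theorem incl_clN {N : ℕ} (d : Web (List.replicate N true)) : incl N (clN d) = pic d := rfl

theorem webN_hom_ext {N : ℕ} {V : Type*} [AddCommMonoid V] [Module ℂ V]
    {F G : WebN N →ₗ[ℂ] V}
    (h : ∀ d : Web (List.replicate N true), F (clN d) = G (clN d)) : F = G :=
  webModule_hom_ext h

/-- The restriction of an operation to outward oriented boundary points. -/
def restr (f : BigWeb →ₗ[ℂ] BigWeb) (N M : ℕ) : WebN N →ₗ[ℂ] WebN M := projN M ∘ₗ f ∘ₗ incl N

/-- An operation that sends outward pictures to outward pictures or to zero loses nothing under the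
projection. -/
theorem incl_restr {f : BigWeb →ₗ[ℂ] BigWeb} {N M : ℕ}
    (h : ∀ d : Web (List.replicate N true), f (pic d) = 0 ∨
      ∃ d' : Web (List.replicate M true), f (pic d) = pic d') (x : WebN N) :
    incl M (restr f N M x) = f (incl N x) := by
  have : incl M ∘ₗ restr f N M = f ∘ₗ incl N := by
    apply webN_hom_ext
    intro d
    change incl M (projN M (f (incl N (clN d)))) = f (incl N (clN d))
    rw [incl_clN]
    rcases h d with h | ⟨d', h⟩
    · rw [h, map_zero, map_zero]
    · rw [h]
      rw [← incl_clN, projN_incl]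
  exact LinearMap.congr_fun this x

theorem replicate_split {N i k : ℕ} (h : i + k ≤ N) (s : Bool) :
    List.replicate N s = List.replicate i s ++ List.replicate k s ++
      List.replicate (N - i - k) s := by
  rw [← List.replicate_add, ← List.replicate_add]
  congr 1
  omega

/-- Insert a tripod to the right of the first `i` strands. -/
def tri {N : ℕ} (i : ℕ) : WebN N →ₗ[ℂ] WebN (N + 3) :=
  restr (op (Piece.tripod true) i) N (N + 3)

/-- Join three neighbouring strands at a sink. -/
def snk {N : ℕ} (i : ℕ) : WebN (N + 3) →ₗ[ℂ] WebN N := restr (sinkOp i) (N + 3) N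

/-- The ladder at the strands `i`, `i + 1`. -/
def lad {N : ℕ} (i : ℕ) : WebN N →ₗ[ℂ] WebN N := restr (ladderOp i) N N

theorem length_of_replicate_eq {N : ℕ} {s : Bool} {u v : List Bool}
    (h : List.replicate N s = u ++ v) : u.length ≤ N := by
  have := congrArg List.length h
  simp at this
  omega

theorem incl_tri {N : ℕ} (i : ℕ) (x : WebN N) :
    incl (N + 3) (tri i x) = op (Piece.tripod true) i (incl N x) := by
  refine incl_restr (fun d => ?_) x
  by_cases hi : i ≤ N
  · refine Or.inr ⟨_, op_pic (Piece.tripod true) (List.replicate i true)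
      (List.replicate (N - i) true) (by simpa using replicate_split (k := 0) (by omega) true)
      ?_ d (by simp)⟩
    exact (replicate_split (i := i) (k := 3) (by omega) true).trans (by
      congr 2
      omega)
  · refine Or.inl (op_pic_of_not _ d ?_)
    rintro ⟨u, v, h, rfl⟩
    exact hi (length_of_replicate_eq (by simpa using h))

theorem mergeOp_pic_of_not {N k : ℕ} (d : Web (List.replicate N true)) (h : N < k + 2) :
    mergeOp true k (pic d) = 0 := by
  rw [mergeOp_apply, op_pic_of_not (Piece.tripod (!true)) d, map_zero, map_zero]
  rintro ⟨u, v, h', hk⟩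
  have := length_of_replicate_eq (u := u) (v := v) (by simpa using h')
  omega

theorem incl_snk {N : ℕ} (i : ℕ) (x : WebN (N + 3)) :
    incl N (snk i x) = sinkOp i (incl (N + 3) x) := by
  refine incl_restr (fun d => ?_) x
  by_cases hi : i ≤ N
  · rw [sinkOp, LinearMap.comp_apply]
    rw [mergeOp_pic true (List.replicate (i + 1) true) (List.replicate (N - i) true)
        ((replicate_split (i := i + 1) (k := 2) (by omega) true).trans (by
          congr 2
          omega)) rfl d (by simp),
      op_pic (Piece.cap true) (List.replicate i true) (List.replicate (N - i) true)
        (by simp [List.replicate_succ']) (w' := List.replicate N true)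
        (by simpa using replicate_split (i := i) (k := 0) (by omega) true) _ (by simp)]
    exact Or.inr ⟨_, rfl⟩
  · refine Or.inl ?_
    rw [sinkOp, LinearMap.comp_apply, mergeOp_pic_of_not d (by omega), map_zero]

theorem ladderOp_pic {N i : ℕ} (hi : i + 2 ≤ N) (d : Web (List.replicate N true)) :
    ladderOp i (pic d) = pic (Web.split false (List.replicate i true)
      (List.replicate (N - i - 2) true)
      (Web.merge true (List.replicate i true) (List.replicate (N - i - 2) true) d
        (replicate_split hi true) :
        Web (List.replicate i true ++ [false] ++ List.replicate (N - i - 2) true))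
      (by simp) (replicate_split hi true) : Web (List.replicate N true)) := by
  rw [ladderOp, LinearMap.comp_apply,
    mergeOp_pic true (List.replicate i true) (List.replicate (N - i - 2) true)
      (replicate_split hi true) rfl d (by simp)]
  exact splitOp_pic false _ _ (by simp) (replicate_split hi true) _ (by simp)

theorem incl_lad {N : ℕ} (i : ℕ) (x : WebN N) :
    incl N (lad i x) = ladderOp i (incl N x) := by
  refine incl_restr (fun d => ?_) x
  by_cases hi : i + 2 ≤ N
  · exact Or.inr ⟨_, ladderOp_pic hi d⟩
  · refine Or.inl ?_
    rw [ladderOp, LinearMap.comp_apply, mergeOp_pic_of_not d (by omega), map_zero]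

theorem incl_mem_letterSub {N i : ℕ} (hi : i < N) (x : WebN N) :
    incl N x ∈ letterSub i true := by
  obtain ⟨z, rfl⟩ := (webRelations (List.replicate N true)).mkQ_surjective x
  change z ∈ (letterSub i true).comap (incl N ∘ₗ (webRelations (List.replicate N true)).mkQ)
  induction z using Finsupp.induction_linear with
  | zero => exact Submodule.zero_mem _
  | add y z hy hz => exact Submodule.add_mem _ hy hz
  | single d c =>
    have e : Finsupp.single d c = c • fw d := by simp [fw]
    rw [e]
    exact Submodule.smul_mem _ _ (Submodule.subset_span ⟨_, d, by simp [hi], rfl⟩)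

theorem tri_tri {N : ℕ} (i j : ℕ) (x : WebN N) (h : i ≤ j := by omega) :
    tri i (tri j x) = tri (j + 3) (tri i x) := by
  apply incl_injective
  rw [incl_tri, incl_tri, incl_tri, incl_tri,
    op_comm (Piece.tripod true) (Piece.tripod true) i (j + 3) j]

theorem snk_snk {N : ℕ} (i j : ℕ) (x : WebN (N + 3 + 3)) (h : i ≤ j := by omega) :
    snk i (snk (j + 3) x) = snk j (snk i x) := by
  apply incl_injective
  rw [incl_snk, incl_snk, incl_snk, incl_snk, sinkOp_sinkOp _ _ _ h]

theorem snk_tri_of_le {N : ℕ} (i j : ℕ) (x : WebN (N + 3)) (h : i ≤ j := by omega) :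
    snk (j + 3) (tri i x) = tri i (snk j x) := by
  apply incl_injective
  rw [incl_snk, incl_tri, incl_tri, incl_snk, sinkOp_op _ i (j + 3) j _ (by simp; omega)]

theorem tri_snk_of_le {N : ℕ} (i j : ℕ) (x : WebN (N + 3)) (h : j ≤ i := by omega) :
    tri i (snk j x) = snk j (tri (i + 3) x) := by
  apply incl_injective
  rw [incl_snk, incl_tri, incl_tri, incl_snk, op_sinkOp _ _ _ _ h]

theorem lad_eq_snk_right {N : ℕ} (i : ℕ) (x : WebN N) : lad i x = snk (i + 2) (tri i x) := by
  apply incl_injective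
  rw [incl_snk, incl_tri, incl_lad, ladderOp_eq_sinkOp_right]

theorem lad_eq_snk_left {N : ℕ} (i : ℕ) (x : WebN N) : lad i x = snk i (tri (i + 2) x) := by
  apply incl_injective
  rw [incl_snk, incl_tri, incl_lad, ladderOp_eq_sinkOp_left]

theorem snk_succ_tri {N : ℕ} (i : ℕ) (x : WebN N) (h : i < N) :
    snk (i + 1) (tri i x) = (-2 : ℂ) • x := by
  apply incl_injective
  rw [incl_snk, incl_tri, sinkOp_succ_tripod (incl_mem_letterSub h x), map_smul]

theorem snk_tri_succ {N : ℕ} (i : ℕ) (x : WebN N) (h : i < N) :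
    snk i (tri (i + 1) x) = (-2 : ℂ) • x := by
  apply incl_injective
  rw [incl_snk, incl_tri, sinkOp_tripod_succ (incl_mem_letterSub h x), map_smul]

theorem snk_tri_self {N : ℕ} (i : ℕ) (x : WebN N) (h : i ≤ N) :
    snk i (tri i x) = (-6 : ℂ) • x := by
  have : snk i ∘ₗ tri i = (-6 : ℂ) • (LinearMap.id : WebN N →ₗ[ℂ] WebN N) := by
    apply webN_hom_ext
    intro d
    apply incl_injective
    rw [LinearMap.comp_apply, incl_snk, incl_tri, LinearMap.smul_apply, map_smul]
    exact sinkOp_tripod d (by simpa using h)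
  exact LinearMap.congr_fun this x

theorem lad_lad_tri {N : ℕ} (i : ℕ) (x : WebN N) (h : i < N) :
    lad (i + 1) (lad i (tri (i + 1) x)) = tri i x + tri (i + 1) x := by
  apply incl_injective
  rw [incl_lad, incl_lad, incl_tri, map_add, incl_tri, incl_tri,
    ladderOp_ladderOp_tripod (incl_mem_letterSub h x)]

/-- The web space of `3n` points is the space of webs with outward oriented boundary. -/
def webSpaceEquiv (n : ℕ) : WebSpace n ≃ₗ[ℂ] WebN (3 * n) :=
  LinearEquiv.refl ℂ (WebModule (List.replicate (3 * n) true))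

theorem webSpaceEquiv_crossing (n i : ℕ) (hi : i + 1 < 3 * n) (x : WebSpace n) :
    webSpaceEquiv n (crossing n i hi x) = lad i (webSpaceEquiv n x) + webSpaceEquiv n x := by
  have : (webSpaceEquiv n).toLinearMap ∘ₗ crossing n i hi =
      lad i ∘ₗ (webSpaceEquiv n).toLinearMap + (webSpaceEquiv n).toLinearMap := by
    apply webModule_hom_ext
    intro d
    have h1 : crossing n i hi (webClass d) = webClass (ladder n i hi d) + webClass d := by
      change (webRelations _).mkQ (Finsupp.mapDomain _ (fw d)) + webClass d = _
      rw [Finsupp.mapDomain_single]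
      rfl
    have h2 : clN (ladder n i hi d) = lad i (clN d) := by
      apply incl_injective
      rw [incl_lad, incl_clN, incl_clN]
      exact (ladderOp_pic (by omega) d).symm
    rw [LinearMap.comp_apply, h1, LinearMap.add_apply, LinearMap.comp_apply]
    rw [map_add]
    exact congrArg (· + clN d) h2
  exact LinearMap.congr_fun this x

end Sl3

namespace Sl3

/-! ### The Coxeter presentation of the symmetric group -/

/-- The Coxeter relations of type `A` for the elements `t i` with `i + 1 < N`. -/
structure CoxeterRel {K : Type*} [Monoid K] (t : ℕ → K) (N : ℕ) : Prop where
  mul_self : ∀ i, i + 1 < N → t i * t i = 1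
  comm : ∀ i j, i + 2 ≤ j → j + 1 < N → t i * t j = t j * t i
  braid : ∀ i, i + 2 < N → t i * t (i + 1) * t i = t (i + 1) * t i * t (i + 1)

/-- The product `t j * t (j + 1) * ⋯` with `m` factors. -/
def ascProd {K : Type*} [Monoid K] (t : ℕ → K) (j : ℕ) : ℕ → K
  | 0 => 1
  | m + 1 => t j * ascProd t (j + 1) m

theorem mul_ascProd_of_lt {K : Type*} [Monoid K] {t : ℕ → K} {N : ℕ} (h : CoxeterRel t N)
    {i : ℕ} (m : ℕ) : ∀ j, i + 1 < j → j + m + 1 ≤ N →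
      t i * ascProd t j m = ascProd t j m * t i := by
  induction m with
  | zero => intro j _ _; simp [ascProd]
  | succ m ih =>
    intro j hj hm
    rw [ascProd, ← mul_assoc, h.comm i j (by omega) (by omega), mul_assoc,
      ih (j + 1) (by omega) (by omega), mul_assoc]

/-- The product behaves like a cycle, conjugation by which shifts generators by one. The generator
commutes with the factors before `t i`, the braid relation is used once, and the remaining factors
commute with `t i`. -/
theorem mul_ascProd_of_gt {K : Type*} [Monoid K] {t : ℕ → K} {N : ℕ} (h : CoxeterRel t N)
    {i : ℕ} (m : ℕ) : ∀ j, j ≤ i → i + 1 < j + m → j + m + 1 ≤ N →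
      t (i + 1) * ascProd t j m = ascProd t j m * t i := by
  induction m with
  | zero => intro j _ _ _; omega
  | succ m ih =>
    intro j hj hi hm
    rcases Nat.eq_or_lt_of_le hj with rfl | hj
    · obtain ⟨m, rfl⟩ : ∃ m', m = m' + 1 := ⟨m - 1, by omega⟩
      rw [ascProd, ascProd, ← mul_assoc, ← mul_assoc, ← h.braid j (by omega), mul_assoc,
        mul_ascProd_of_lt h m (j + 1 + 1) (by omega) (by omega)]
      simp only [mul_assoc]
    · rw [ascProd, ← mul_assoc, ← h.comm j (i + 1) (by omega) (by omega), mul_assoc,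
        ih (j + 1) (by omega) (by omega) (by omega), mul_assoc]

theorem CoxeterRel.mono {K : Type*} [Monoid K] {t : ℕ → K} {N M : ℕ} (h : CoxeterRel t N)
    (hM : M ≤ N) : CoxeterRel t M where
  mul_self i hi := h.mul_self i (by omega)
  comm i j hi hj := h.comm i j hi (by omega)
  braid i hi := h.braid i (by omega)

/-- The N + 1 products t_j ⋯ t_{N-1} meet every left coset of the subgroup generated without
t_{N-1}. Left multiplication by t_i keeps the coset, except that it lengthens the product when i + 1
= j and shortens it when i = j. -/
theorem exists_ascProd_mul {K : Type*} [Group K] {t : ℕ → K} {N : ℕ} (h : CoxeterRel t (N + 1))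
    {g : K} (hg : g ∈ Subgroup.closure {x | ∃ i, i + 1 < N + 1 ∧ x = t i}) :
    ∃ (j : Fin (N + 1)) (g' : Subgroup.closure {x | ∃ i, i + 1 < N ∧ x = t i}),
      g = ascProd t j (N - j) * g' := by
  have hmul : ∀ i, i + 1 < N + 1 → ∀ (x : K), (∃ (j : Fin (N + 1))
      (g' : Subgroup.closure {x | ∃ i, i + 1 < N ∧ x = t i}), x = ascProd t j (N - j) * g') →
      ∃ (j : Fin (N + 1)) (g' : Subgroup.closure {x | ∃ i, i + 1 < N ∧ x = t i}),
        t i * x = ascProd t j (N - j) * g' := by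
    rintro i hi _ ⟨⟨j, hj⟩, g', rfl⟩
    simp only
    rcases lt_trichotomy (i + 1) j with h1 | h1 | h1
    · have ht : t i ∈ Subgroup.closure {x | ∃ i, i + 1 < N ∧ x = t i} :=
        Subgroup.subset_closure ⟨i, by omega, rfl⟩
      refine ⟨⟨j, hj⟩, ⟨t i, ht⟩ * g', ?_⟩
      rw [← mul_assoc, mul_ascProd_of_lt h _ j h1 (by omega), mul_assoc]
      rfl
    · refine ⟨⟨i, by omega⟩, g', ?_⟩
      have e : N - i = (N - j) + 1 := by omega
      simp only [e, ascProd, h1, mul_assoc]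
    · rcases Nat.eq_or_lt_of_le (Nat.lt_succ_iff.1 h1) with rfl | h1
      · refine ⟨⟨j + 1, by omega⟩, g', ?_⟩
        have e : N - j = (N - (j + 1)) + 1 := by omega
        simp only [e, ascProd]
        rw [← mul_assoc, ← mul_assoc, h.mul_self j hi, one_mul]
      · obtain ⟨i, rfl⟩ : ∃ i', i = i' + 1 := ⟨i - 1, by omega⟩
        have ht : t i ∈ Subgroup.closure {x | ∃ i, i + 1 < N ∧ x = t i} :=
          Subgroup.subset_closure ⟨i, by omega, rfl⟩
        refine ⟨⟨j, hj⟩, ⟨t i, ht⟩ * g', ?_⟩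
        rw [← mul_assoc, mul_ascProd_of_gt h _ j (by omega) (by omega) (by omega), mul_assoc]
        rfl
  induction hg using Subgroup.closure_induction_left with
  | one => exact ⟨⟨N, by omega⟩, 1, by simp [ascProd]⟩
  | mul_left x hx y _ ih =>
    obtain ⟨i, hi, rfl⟩ := hx
    exact hmul i hi y ih
  | inv_mul_cancel x hx y _ ih =>
    obtain ⟨i, hi, rfl⟩ := hx
    rw [inv_eq_of_mul_eq_one_left (h.mul_self i hi)]
    exact hmul i hi y ih

/-- Only this upper bound is required: the opposite one comes from a surjection onto the symmetric
group. -/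
theorem finite_card_closure_le {K : Type*} [Group K] {t : ℕ → K} (N : ℕ) (h : CoxeterRel t N) :
    Finite (Subgroup.closure {x | ∃ i, i + 1 < N ∧ x = t i}) ∧
      Nat.card (Subgroup.closure {x | ∃ i, i + 1 < N ∧ x = t i}) ≤ N.factorial := by
  induction N with
  | zero =>
    have e : {x | ∃ i, i + 1 < 0 ∧ x = t i} = (∅ : Set K) := by
      ext x; simp
    rw [e, Subgroup.closure_empty]
    exact ⟨inferInstance, by simp⟩
  | succ N ih =>
    obtain ⟨hf, hc⟩ := ih (h.mono (Nat.le_succ N))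
    choose j g hjg using fun x : Subgroup.closure {x | ∃ i, i + 1 < N + 1 ∧ x = t i} =>
      exists_ascProd_mul h x.2
    have hinj : Function.Injective fun x => (j x, g x) := by
      intro x y hxy
      simp only [Prod.mk.injEq] at hxy
      apply Subtype.ext
      rw [hjg x, hjg y, hxy.1, hxy.2]
    refine ⟨Finite.of_injective _ hinj, (Nat.card_le_card_of_injective _ hinj).trans ?_⟩
    rw [Nat.card_prod, Nat.card_fin, Nat.factorial_succ]
    exact Nat.mul_le_mul_left _ hc

/-- The exchange of the neighbouring points `i`, `i + 1`. -/
def adj {N : ℕ} (i : ℕ) : Equiv.Perm (Fin N) :=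
  if h : i + 1 < N then Equiv.swap ⟨i, Nat.lt_of_succ_lt h⟩ ⟨i + 1, h⟩ else 1

theorem adj_of_lt {N i : ℕ} (h : i + 1 < N) :
    (adj i : Equiv.Perm (Fin N)) = Equiv.swap ⟨i, Nat.lt_of_succ_lt h⟩ ⟨i + 1, h⟩ := dif_pos h

theorem closure_adj (N : ℕ) :
    Submonoid.closure {x : Equiv.Perm (Fin N) | ∃ i, i + 1 < N ∧ x = adj i} = ⊤ := by
  cases N with
  | zero =>
    refine top_unique fun x _ => ?_
    rw [Subsingleton.elim x 1]
    exact Submonoid.one_mem _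
  | succ N =>
    rw [← Equiv.Perm.mclosure_swap_castSucc_succ N]
    congr 1
    ext x
    constructor
    · rintro ⟨i, hi, rfl⟩
      exact ⟨⟨i, by omega⟩, (adj_of_lt hi).symm⟩
    · rintro ⟨i, rfl⟩
      exact ⟨i, by omega, (adj_of_lt (by omega)).symm⟩

/-- Induction over products of exchanges of neighbours. -/
theorem adj_induction {N : ℕ} {p : Equiv.Perm (Fin N) → Prop} (one : p 1)
    (mul : ∀ i σ, i + 1 < N → p σ → p (adj i * σ)) (σ : Equiv.Perm (Fin N)) : p σ := by
  have h : σ ∈ Submonoid.closure {x : Equiv.Perm (Fin N) | ∃ i, i + 1 < N ∧ x = adj i} := by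
    rw [closure_adj]; trivial
  induction h using Submonoid.closure_induction_left with
  | one => exact one
  | mul_left x hx y _ ih =>
    obtain ⟨i, hi, rfl⟩ := hx
    exact mul i y hi ih

theorem swap_braid {α : Type*} [DecidableEq α] {a b c : α} (hab : a ≠ b) (hac : a ≠ c)
    (hbc : b ≠ c) : Equiv.swap a b * Equiv.swap b c * Equiv.swap a b =
      Equiv.swap b c * Equiv.swap a b * Equiv.swap b c := by
  rw [Equiv.swap_mul_swap_mul_swap hab hac, Equiv.swap_comm a b, Equiv.swap_comm b c,
    Equiv.swap_mul_swap_mul_swap hbc.symm hac.symm, Equiv.swap_comm]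

theorem coxeterRel_adj (N : ℕ) : CoxeterRel (adj (N := N)) N where
  mul_self i hi := by rw [adj_of_lt hi, Equiv.swap_mul_self]
  comm i j hij hj := by
    rw [adj_of_lt hj, adj_of_lt (by omega)]
    refine (Equiv.Perm.Disjoint.commute ?_).eq
    rw [Equiv.Perm.disjoint_iff_disjoint_support, Equiv.Perm.support_swap (by simp),
      Equiv.Perm.support_swap (by simp)]
    simp [Fin.ext_iff]
    omega
  braid i hi := by
    rw [adj_of_lt hi, adj_of_lt (by omega)]
    exact swap_braid (by simp) (by simp; omega) (by simp)

/-- Elements which satisfy the Coxeter relations define a homomorphism from the symmetric group. -/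
theorem exists_hom_of_coxeterRel {G : Type*} [Group G] {s : ℕ → G} {N : ℕ}
    (h : CoxeterRel s N) :
    ∃ φ : Equiv.Perm (Fin N) →* G, ∀ i, i + 1 < N → φ (adj i) = s i := by
  -- The subgroup generated by these pairs maps onto the symmetric group and has at most N!
  -- elements. It is therefore the graph of a homomorphism.
  let t : ℕ → Equiv.Perm (Fin N) × G := fun i => (adj i, s i)
  have ht : CoxeterRel t N :=
    { mul_self := fun i hi => Prod.ext ((coxeterRel_adj N).mul_self i hi) (h.mul_self i hi)
      comm := fun i j hij hj => Prod.ext ((coxeterRel_adj N).comm i j hij hj) (h.comm i j hij hj)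
      braid := fun i hi => Prod.ext ((coxeterRel_adj N).braid i hi) (h.braid i hi) }
  obtain ⟨hf, hc⟩ := finite_card_closure_le N ht
  set K := Subgroup.closure {x | ∃ i, i + 1 < N ∧ x = t i}
  have hK : ∀ i, i + 1 < N → t i ∈ K := fun i hi => Subgroup.subset_closure ⟨i, hi, rfl⟩
  let π : K →* Equiv.Perm (Fin N) := (MonoidHom.fst _ _).comp K.subtype
  have hs : Function.Surjective π := by
    intro σ
    induction σ using adj_induction with
    | one => exact ⟨1, map_one π⟩
    | mul i σ hi ih =>
      obtain ⟨x, rfl⟩ := ih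
      exact ⟨⟨t i, hK i hi⟩ * x, rfl⟩
  have hb : Function.Bijective π := by
    have : Fintype K := Fintype.ofFinite K
    refine (Fintype.bijective_iff_surjective_and_card π).2 ⟨hs, le_antisymm ?_
      (Fintype.card_le_of_surjective π hs)⟩
    rw [Fintype.card_perm, Fintype.card_fin, ← Nat.card_eq_fintype_card]
    exact hc
  let e : K ≃* Equiv.Perm (Fin N) := MulEquiv.ofBijective π hb
  refine ⟨((MonoidHom.snd _ _).comp K.subtype).comp e.symm.toMonoidHom, fun i hi => ?_⟩
  have : e.symm (adj i) = ⟨t i, hK i hi⟩ := by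
    rw [MulEquiv.symm_apply_eq]
    rfl
  change ((e.symm (adj i) : K) : Equiv.Perm (Fin N) × G).2 = s i
  rw [this]

end Sl3

namespace Sl3

/-! ### Relations between ladders, tripods and sinks -/

variable {N : ℕ}

theorem lad_tri_of_le (i j : ℕ) (x : WebN N) (h : j ≤ i := by omega) :
    lad (i + 3) (tri j x) = tri j (lad i x) := by
  rw [lad_eq_snk_left, lad_eq_snk_left, ← snk_tri_of_le j i, ← tri_tri j (i + 2)]

theorem lad_tri_of_ge (i j : ℕ) (x : WebN N) (h : i + 2 ≤ j := by omega) :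
    lad i (tri j x) = tri j (lad i x) := by
  rw [lad_eq_snk_right, lad_eq_snk_right, tri_snk_of_le j (i + 2), tri_tri i j]

theorem lad_snk_of_le (i j : ℕ) (x : WebN (N + 3)) (h : j ≤ i := by omega) :
    lad i (snk j x) = snk j (lad (i + 3) x) := by
  rw [lad_eq_snk_left, lad_eq_snk_left, tri_snk_of_le (i + 2) j, snk_snk j i]

theorem lad_snk_of_ge (i j : ℕ) (x : WebN (N + 3)) (h : i + 2 ≤ j := by omega) :
    lad i (snk j x) = snk j (lad i x) := by
  rw [lad_eq_snk_right, lad_eq_snk_right, ← snk_tri_of_le i j, snk_snk (i + 2) j]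

theorem lad_comm (i j : ℕ) (x : WebN N) (h : i + 2 ≤ j := by omega) :
    lad i (lad j x) = lad j (lad i x) := by
  rw [lad_eq_snk_right j, lad_eq_snk_right j, lad_snk_of_ge i (j + 2), lad_tri_of_ge i j]

theorem lad_tri_self (i : ℕ) (x : WebN N) (h : i ≤ N) : lad i (tri i x) = (-2 : ℂ) • tri i x := by
  rw [lad_eq_snk_right, tri_tri i i, snk_tri_succ (i + 2) _ (by omega)]

theorem lad_succ_tri (i : ℕ) (x : WebN N) (h : i ≤ N) :
    lad (i + 1) (tri i x) = (-2 : ℂ) • tri i x := by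
  rw [lad_eq_snk_left, ← tri_tri i i, snk_succ_tri i _ (by omega)]

theorem snk_lad_self (i : ℕ) (x : WebN (N + 3)) (h : i ≤ N) :
    snk i (lad i x) = (-2 : ℂ) • snk i x := by
  rw [lad_eq_snk_left, ← snk_snk i i, snk_succ_tri (i + 2) _ (by omega), map_smul]

theorem snk_lad_succ (i : ℕ) (x : WebN (N + 3)) (h : i ≤ N) :
    snk i (lad (i + 1) x) = (-2 : ℂ) • snk i x := by
  rw [lad_eq_snk_right, snk_snk i i, snk_tri_succ i _ (by omega), map_smul]

theorem lad_lad_self (i : ℕ) (x : WebN N) (h : i + 1 < N) :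
    lad i (lad i x) = (-2 : ℂ) • lad i x := by
  rw [lad_eq_snk_left i x, lad_snk_of_le i i, lad_succ_tri (i + 2) _ (by omega), map_smul]

theorem lad_tri_add_two (i : ℕ) (x : WebN N) : lad (i + 2) (tri i x) = lad i (tri (i + 1) x) := by
  rw [lad_eq_snk_left, lad_eq_snk_right, tri_tri i (i + 1)]

theorem lad_lad_tri' (i : ℕ) (x : WebN N) (h : i < N) :
    lad (i + 1) (lad (i + 2) (tri i x)) = tri i x + tri (i + 1) x := by
  rw [lad_tri_add_two, lad_lad_tri i x h]

/-- The ladder applied first is opened into a tripod and a sink. The other two pass the sink and act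
on the tripod, where the square relation applies. The extra term agrees with the one in
`lad_succ_lad_lad_succ`, and this agreement is the braid relation. -/
theorem lad_lad_lad (i : ℕ) (x : WebN (N + 3)) (h : i ≤ N) :
    lad i (lad (i + 1) (lad i x)) = lad i x + tri i (snk i x) := by
  rw [lad_eq_snk_left i x, lad_snk_of_le (i + 1) i, lad_snk_of_le i i,
    lad_lad_tri' (i + 2) x (by omega), map_add, tri_snk_of_le i i]

theorem lad_succ_lad_lad_succ (i : ℕ) (x : WebN (N + 3)) (h : i ≤ N) :
    lad (i + 1) (lad i (lad (i + 1) x)) = lad (i + 1) x + tri i (snk i x) := by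
  rw [lad_eq_snk_right (i + 1) x, lad_snk_of_ge i (i + 3), lad_snk_of_ge (i + 1) (i + 3),
    lad_lad_tri i x (by omega), map_add, snk_tri_of_le i i]
  exact add_comm _ _

/-- The sink at i + 1 is applied to `lad_succ_lad_lad_succ`; every term then acquires a factor -2,
which cancels. -/
theorem snk_lad_lad (i : ℕ) (x : WebN (N + 3)) (h : i < N) :
    snk (i + 1) (lad i (lad (i + 1) x)) = snk i x + snk (i + 1) x := by
  have h1 := snk_lad_self (i + 1) (lad i (lad (i + 1) x)) (by omega)
  rw [lad_succ_lad_lad_succ i x (by omega), map_add, snk_lad_self (i + 1) x (by omega),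
    snk_succ_tri i _ h, ← smul_add] at h1
  rw [← smul_right_injective _ (by norm_num : (-2 : ℂ) ≠ 0) h1, add_comm]

theorem snk_lad_add_two (i : ℕ) (x : WebN (N + 3)) :
    snk i (lad (i + 2) x) = snk (i + 1) (lad i x) := by
  rw [lad_eq_snk_right (i + 2), lad_eq_snk_left i, ← snk_snk i (i + 1)]

/-! ### The action of the symmetric group on webs -/

/-- The crossing of the strands `i`, `i + 1`. -/
def crs (i : ℕ) : Module.End ℂ (WebN N) := lad i + LinearMap.id

theorem crs_apply (i : ℕ) (x : WebN N) : crs i x = lad i x + x := rfl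

theorem crs_tri_of_le (i j : ℕ) (x : WebN N) (h : j ≤ i := by omega) :
    crs (i + 3) (tri j x) = tri j (crs i x) := by
  rw [crs_apply, crs_apply, map_add, lad_tri_of_le i j]

theorem crs_tri_of_ge (i j : ℕ) (x : WebN N) (h : i + 2 ≤ j := by omega) :
    crs i (tri j x) = tri j (crs i x) := by
  rw [crs_apply, crs_apply, map_add, lad_tri_of_ge i j]

theorem crs_snk_of_le (i j : ℕ) (x : WebN (N + 3)) (h : j ≤ i := by omega) :
    crs i (snk j x) = snk j (crs (i + 3) x) := by
  rw [crs_apply, crs_apply, map_add, lad_snk_of_le i j]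

theorem crs_tri_self (i : ℕ) (x : WebN N) (h : i ≤ N) : crs i (tri i x) = -tri i x := by
  rw [crs_apply, lad_tri_self i x h]
  module

theorem crs_succ_tri (i : ℕ) (x : WebN N) (h : i ≤ N) : crs (i + 1) (tri i x) = -tri i x := by
  rw [crs_apply, lad_succ_tri i x h]
  module

theorem snk_crs_self (i : ℕ) (x : WebN (N + 3)) (h : i ≤ N) : snk i (crs i x) = -snk i x := by
  rw [crs_apply, map_add, snk_lad_self i x h]
  module

theorem snk_crs_succ (i : ℕ) (x : WebN (N + 3)) (h : i ≤ N) :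
    snk i (crs (i + 1) x) = -snk i x := by
  rw [crs_apply, map_add, snk_lad_succ i x h]
  module

theorem crs_crs (i : ℕ) (x : WebN N) (h : i + 1 < N) : crs i (crs i x) = x := by
  simp only [crs_apply, map_add, lad_lad_self i x h]
  module

/-- For a = H_i and b = H_{i+1} with a^2 = -2a and b^2 = -2b, the braid relation of 1 + a and 1 + b
is equivalent to aba - a = bab - b. -/
theorem coxeterRel_crs : CoxeterRel (crs (N := N)) N where
  mul_self i hi := LinearMap.ext fun x => crs_crs i x hi
  comm i j hij hj := LinearMap.ext fun x => by
    simp only [Module.End.mul_apply, crs_apply, map_add, lad_comm i j x hij]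
    module
  braid i hi := LinearMap.ext fun x => by
    obtain ⟨N, rfl⟩ : ∃ M, N = M + 3 := ⟨N - 3, by omega⟩
    simp only [Module.End.mul_apply, crs_apply, map_add, lad_lad_lad i x (by omega),
      lad_succ_lad_lad_succ i x (by omega), lad_lad_self i x (by omega),
      lad_lad_self (i + 1) x (by omega)]
    module

/-- A tripod slides below a strand. -/
theorem crs_crs_crs_tri (i : ℕ) (x : WebN N) (h : i < N) :
    crs i (crs (i + 1) (crs (i + 2) (tri i x))) = tri (i + 1) x := by
  simp only [crs_apply, map_add, map_smul, lad_lad_tri i x h, lad_tri_self i x h.le,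
    lad_succ_tri i x h.le, lad_tri_add_two, lad_lad_self i (tri (i + 1) x) (by omega)]
  module

theorem crs_crs_crs_tri_succ (i : ℕ) (x : WebN N) (h : i < N) :
    crs (i + 2) (crs (i + 1) (crs i (tri (i + 1) x))) = tri i x := by
  rw [← crs_crs_crs_tri i x h, crs_crs i _ (by omega), crs_crs (i + 1) _ (by omega),
    crs_crs (i + 2) _ (by omega)]

/-- The exchange relation. -/
theorem tri_exchange (i : ℕ) (x : WebN N) (h : i < N) :
    crs (i + 2) (tri i x) - crs (i + 1) (crs (i + 2) (tri i x)) +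
      crs i (crs (i + 1) (crs (i + 2) (tri i x))) = tri i x := by
  rw [crs_crs_crs_tri i x h]
  simp only [crs_apply, map_add, lad_lad_tri' i x h, lad_succ_tri i x h.le]
  module

/-- A sink slides below a strand. -/
theorem snk_crs_crs_crs (i : ℕ) (x : WebN (N + 3)) (h : i < N) :
    snk (i + 1) (crs i (crs (i + 1) (crs (i + 2) x))) = snk i x := by
  have h1 := snk_lad_lad i x h
  have h2 := snk_lad_lad i (lad (i + 2) x) h
  have h3 := snk_lad_succ (i + 1) (lad i x) (by omega)
  have h4 := snk_lad_add_two i x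
  simp only [crs_apply, map_add, h1, h2, snk_lad_self (i + 1) _ (show i + 1 ≤ N by omega),
    snk_lad_succ (i + 1) _ (show i + 1 ≤ N by omega), lad_comm i (i + 2) x, h4]
  module

/-- The action of the symmetric group on webs with outward oriented boundary. -/
theorem exists_webHom (N : ℕ) : ∃ φ : Equiv.Perm (Fin N) →* Module.End ℂ (WebN N),
    ∀ i, i + 1 < N → φ (adj i) = crs i := by
  let s : ℕ → (Module.End ℂ (WebN N))ˣ := fun i =>
    if h : i + 1 < N then ⟨crs i, crs i, coxeterRel_crs.mul_self i h, coxeterRel_crs.mul_self i h⟩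
    else 1
  have hs : ∀ i, i + 1 < N → (s i : Module.End ℂ (WebN N)) = crs i := by
    intro i hi
    simp only [s, dif_pos hi]
  have h : CoxeterRel s N :=
    { mul_self := fun i hi => Units.ext (by
        rw [Units.val_mul, hs i hi]; exact coxeterRel_crs.mul_self i hi)
      comm := fun i j hij hj => Units.ext (by
        rw [Units.val_mul, Units.val_mul, hs i (by omega), hs j hj]
        exact coxeterRel_crs.comm i j hij hj)
      braid := fun i hi => Units.ext (by
        simp only [Units.val_mul]
        rw [hs i (by omega), hs (i + 1) hi]
        exact coxeterRel_crs.braid i hi) }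
  obtain ⟨φ, hφ⟩ := exists_hom_of_coxeterRel h
  exact ⟨(Units.coeHom _).comp φ, fun i hi => by
    rw [MonoidHom.comp_apply, hφ i hi, Units.coeHom_apply, hs i hi]⟩

/-- The action of the symmetric group on webs with outward oriented boundary. -/
def webHom (N : ℕ) : Equiv.Perm (Fin N) →* Module.End ℂ (WebN N) := (exists_webHom N).choose

theorem webHom_adj {i : ℕ} (h : i + 1 < N) : webHom N (adj i) = crs i :=
  (exists_webHom N).choose_spec i h

end Sl3

namespace Sl3

variable {N : ℕ}

/-! ### The cyclic submodule generated by a row of tripods -/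

/-- Tripods next to each other (zero when `N` is not divisible by `3`). -/
def w0 : ∀ N : ℕ, WebN N
  | 0 => clN (N := 0) Web.empty
  | 1 => 0
  | 2 => 0
  | N + 3 => tri N (w0 N)

theorem w0_add_three (N : ℕ) : w0 (N + 3) = tri N (w0 N) := by rw [w0]

/-- The span of the permutations of a row of tripods. -/
def tripodSpan (N : ℕ) : Submodule ℂ (WebN N) :=
  Submodule.span ℂ (Set.range fun σ => webHom N σ (w0 N))

theorem webHom_w0_mem (σ : Equiv.Perm (Fin N)) : webHom N σ (w0 N) ∈ tripodSpan N :=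
  Submodule.subset_span ⟨σ, rfl⟩

theorem w0_mem : w0 N ∈ tripodSpan N := by
  simpa using webHom_w0_mem (N := N) 1

theorem webHom_mem (σ : Equiv.Perm (Fin N)) {x : WebN N} (hx : x ∈ tripodSpan N) :
    webHom N σ x ∈ tripodSpan N := by
  have : tripodSpan N ≤ (tripodSpan N).comap (webHom N σ) := by
    refine Submodule.span_le.2 ?_
    rintro _ ⟨τ, rfl⟩
    simp only [Submodule.comap_coe, Set.mem_preimage, SetLike.mem_coe]
    rw [← Module.End.mul_apply, ← map_mul]
    exact webHom_w0_mem _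
  exact this hx

theorem crs_mem {i : ℕ} (hi : i + 1 < N) {x : WebN N} (hx : x ∈ tripodSpan N) :
    crs i x ∈ tripodSpan N := by
  rw [← webHom_adj hi]
  exact webHom_mem _ hx

theorem tripodSpan_le {S : Submodule ℂ (WebN N)} (h0 : w0 N ∈ S)
    (h : ∀ i x, i + 1 < N → x ∈ S → crs i x ∈ S) : tripodSpan N ≤ S := by
  refine Submodule.span_le.2 ?_
  rintro _ ⟨σ, rfl⟩
  induction σ using adj_induction with
  | one => simpa using h0
  | mul i σ hi ih =>
    change webHom N (adj i * σ) (w0 N) ∈ S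
    rw [map_mul, Module.End.mul_apply, webHom_adj hi]
    exact h i _ hi ih

theorem tri_last_mem {x : WebN N} (hx : x ∈ tripodSpan N) : tri N x ∈ tripodSpan (N + 3) := by
  have : tripodSpan N ≤ (tripodSpan (N + 3)).comap (tri N) := by
    refine tripodSpan_le ?_ ?_
    · rw [Submodule.mem_comap, ← w0_add_three]
      exact w0_mem
    · intro i x hi hx
      rw [Submodule.mem_comap] at hx ⊢
      rw [← crs_tri_of_ge i N]
      exact crs_mem (by omega) hx
  exact this hx

theorem tri_eq_zero {i : ℕ} (h : N < i) (x : WebN N) : tri i x = 0 := by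
  have : tri i = (0 : WebN N →ₗ[ℂ] WebN (N + 3)) := by
    apply webN_hom_ext
    intro d
    apply incl_injective
    rw [incl_tri, incl_clN, op_pic_of_not, LinearMap.zero_apply, map_zero]
    rintro ⟨u, v, h', rfl⟩
    have := length_of_replicate_eq (u := u) (v := v) (by simpa using h')
    omega
  rw [this, LinearMap.zero_apply]

/-- At the right end a new tripod prolongs the row. From there it slides to the place `i`, past one
strand at a time. -/
theorem tri_mem (i : ℕ) {x : WebN N} (hx : x ∈ tripodSpan N) : tri i x ∈ tripodSpan (N + 3) := by
  rcases Nat.lt_or_ge N i with h | h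
  · rw [tri_eq_zero h]
    exact Submodule.zero_mem _
  · induction h using Nat.decreasingInduction with
    | of_succ i hi ih =>
      rw [← crs_crs_crs_tri_succ i x hi]
      exact crs_mem (by omega) (crs_mem (by omega) (crs_mem (by omega) ih))
    | self => exact tri_last_mem hx

/-! ### Permutations preserving the first three points -/

theorem adj_val {i : ℕ} (hi : i + 1 < N) (x : Fin N) :
    (adj i x : Fin N).val = if x.val = i then i + 1 else if x.val = i + 1 then i else x.val := by
  rw [adj_of_lt hi, Equiv.swap_apply_def]
  simp only [Fin.ext_iff]
  split_ifs <;> rfl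

theorem adj_isSwap {i : ℕ} (hi : i + 1 < N) : (adj i : Equiv.Perm (Fin N)).IsSwap :=
  ⟨_, _, by simp, adj_of_lt hi⟩

/-- A group generated by transpositions contains every permutation that maps each point into its own
orbit. Omitting the exchange of the points 2 and 3 leaves as orbits the first three points and the
rest. -/
theorem mem_closure_of_preserves {M : ℕ} {g : Equiv.Perm (Fin M)}
    (hg : ∀ x : Fin M, (g x).val < 3 ↔ x.val < 3) :
    g ∈ Subgroup.closure {x : Equiv.Perm (Fin M) | ∃ i, i + 1 < M ∧ i ≠ 2 ∧ x = adj i} := by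
  set G := Subgroup.closure {x : Equiv.Perm (Fin M) | ∃ i, i + 1 < M ∧ i ≠ 2 ∧ x = adj i}
  have hle : ∀ (m : ℕ) (a b : Fin M), b.val = a.val + m → (a.val < 3 ↔ b.val < 3) →
      b ∈ MulAction.orbit G a := by
    intro m
    induction m with
    | zero =>
      intro a b h _
      rw [show b = a from Fin.ext h]
      exact MulAction.mem_orbit_self a
    | succ m ih =>
      intro a b h hs
      have hb := b.2
      have hc := ih a ⟨a.val + m, by omega⟩ rfl (by simp only; omega)
      have hG : (adj (a.val + m) : Equiv.Perm (Fin M)) ∈ G :=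
        Subgroup.subset_closure ⟨_, by omega, by omega, rfl⟩
      rw [← MulAction.orbit_eq_iff.2 hc]
      refine ⟨⟨_, hG⟩, Fin.ext ?_⟩
      change (adj (a.val + m) (⟨a.val + m, _⟩ : Fin M)).val = _
      rw [adj_val (by omega), if_pos rfl, h]
      rfl
  refine (mem_closure_isSwap ?_).2 ⟨Set.toFinite _, fun x => ?_⟩
  · rintro _ ⟨i, hi, -, rfl⟩
    exact adj_isSwap hi
  · rcases Nat.le_total x.val (g x).val with h | h
    · exact hle ((g x).val - x.val) _ _ (by omega) (hg x).symm
    · exact MulAction.orbit_eq_iff.2 (hle (x.val - (g x).val) _ _ (by omega) (hg x)) ▸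
        MulAction.mem_orbit_self _

theorem preserves_induction {M : ℕ} {p : Equiv.Perm (Fin M) → Prop} (one : p 1)
    (mul : ∀ i σ, i + 1 < M → i ≠ 2 → p σ → p (adj i * σ)) {g : Equiv.Perm (Fin M)}
    (hg : ∀ x : Fin M, (g x).val < 3 ↔ x.val < 3) : p g := by
  have hm := mem_closure_of_preserves hg
  clear hg
  induction hm using Subgroup.closure_induction_left with
  | one => exact one
  | mul_left x hx y _ ih =>
    obtain ⟨i, hi, h2, rfl⟩ := hx
    exact mul i y hi h2 ih
  | inv_mul_cancel x hx y _ ih =>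
    obtain ⟨i, hi, h2, rfl⟩ := hx
    rw [inv_eq_of_mul_eq_one_left ((coxeterRel_adj M).mul_self i hi)]
    exact mul i y hi h2 ih

/-- A permutation preserving the first three points acts on the webs with a tripod there. -/
theorem exists_webHom_tri_zero {g : Equiv.Perm (Fin (N + 3))}
    (hg : ∀ x : Fin (N + 3), (g x).val < 3 ↔ x.val < 3) (y : WebN N) :
    ∃ y', webHom (N + 3) g (tri 0 y) = tri 0 y' ∧ (y ∈ tripodSpan N → y' ∈ tripodSpan N) := by
  refine preserves_induction (p := fun g => ∃ y', webHom (N + 3) g (tri 0 y) = tri 0 y' ∧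
    (y ∈ tripodSpan N → y' ∈ tripodSpan N)) ⟨y, by simp, id⟩ ?_ hg
  · intro i σ hi h2 ih
    obtain ⟨y', h, hy⟩ := ih
    rw [map_mul, Module.End.mul_apply, h, webHom_adj hi]
    match i, hi, h2 with
    | 0, _, _ =>
      exact ⟨-y', by rw [crs_tri_self 0 y' (by omega), map_neg],
        fun h => Submodule.neg_mem _ (hy h)⟩
    | 1, _, _ =>
      exact ⟨-y', by rw [crs_succ_tri 0 y' (by omega), map_neg],
        fun h => Submodule.neg_mem _ (hy h)⟩
    | i + 3, hi, _ =>
      exact ⟨crs i y', crs_tri_of_le i 0 y', fun h => crs_mem (by omega) (hy h)⟩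

/-- Such a permutation passes through the sink: crossings of the three joined strands become signs,
and the others become crossings of the remaining strands. -/
theorem snk_zero_webHom_mem {g : Equiv.Perm (Fin (N + 3))}
    (hg : ∀ x : Fin (N + 3), (g x).val < 3 ↔ x.val < 3) (x : WebN (N + 3))
    (hx : snk 0 x ∈ tripodSpan N) : snk 0 (webHom (N + 3) g x) ∈ tripodSpan N := by
  refine preserves_induction (p := fun g => snk 0 (webHom (N + 3) g x) ∈ tripodSpan N)
    (by simpa using hx) ?_ hg
  · intro i σ hi h2 ih
    rw [map_mul, Module.End.mul_apply, webHom_adj hi]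
    match i, hi, h2 with
    | 0, _, _ =>
      rw [snk_crs_self 0 _ (by omega)]
      exact Submodule.neg_mem _ ih
    | 1, _, _ =>
      rw [snk_crs_succ 0 _ (by omega)]
      exact Submodule.neg_mem _ ih
    | i + 3, hi, _ =>
      rw [← crs_snk_of_le i 0]
      exact crs_mem (by omega) ih

/-- The permutation which moves a tripod from the left end to the place `k`. -/
theorem exists_webHom_tri (k : ℕ) (hk : k ≤ N) : ∃ τ : Equiv.Perm (Fin (N + 3)),
    (∀ y : WebN N, webHom (N + 3) τ (tri 0 y) = tri k y) ∧
    ∀ x : Fin (N + 3), x.val < 3 → (τ x).val = k + x.val := by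
  induction k with
  | zero => exact ⟨1, by simp, by simp⟩
  | succ k ih =>
    obtain ⟨τ, h1, h2⟩ := ih (by omega)
    refine ⟨adj k * (adj (k + 1) * (adj (k + 2) * τ)), fun y => ?_, fun x hx => ?_⟩
    · rw [map_mul, map_mul, map_mul, Module.End.mul_apply, Module.End.mul_apply,
        Module.End.mul_apply, h1, webHom_adj (by omega), webHom_adj (by omega),
        webHom_adj (by omega), crs_crs_crs_tri k y (by omega)]
    · have := h2 x hx
      simp only [Equiv.Perm.mul_apply]
      rw [adj_val (by omega), adj_val (by omega), adj_val (by omega), this]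
      split_ifs <;> omega

/-! ### Double cosets of the stabilizer of the first three points. -/

theorem card_filter_apply_lt_three {M : ℕ} (σ : Equiv.Perm (Fin M)) :
    (Finset.univ.filter fun x : Fin M => (σ x).val < 3).card =
      (Finset.univ.filter fun x : Fin M => x.val < 3).card := by
  refine Finset.card_bij (fun x _ => σ x) ?_ ?_ ?_
  · intro x hx; simpa using hx
  · intro x _ y _ hxy; exact σ.injective hxy
  · intro y hy; exact ⟨σ.symm y, by simpa using hy, by simp⟩

/-- Points are sorted by whether they and their images lie among the first three. The given number
determines the sizes of all four classes, so some bijection g' matches the classes of τ with those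
of τ'; then g is forced. -/
theorem exists_preserves_mul {M : ℕ} (τ τ' : Equiv.Perm (Fin M))
    (h : (Finset.univ.filter fun x : Fin M => x.val < 3 ∧ (τ x).val < 3).card =
      (Finset.univ.filter fun x : Fin M => x.val < 3 ∧ (τ' x).val < 3).card) :
    ∃ g g' : Equiv.Perm (Fin M), (∀ x : Fin M, (g x).val < 3 ↔ x.val < 3) ∧
      (∀ x : Fin M, (g' x).val < 3 ↔ x.val < 3) ∧ τ = g * τ' * g' := by
  classical
  let f : Equiv.Perm (Fin M) → Fin M → Prop × Prop := fun σ x => (x.val < 3, (σ x).val < 3)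
  have hcard : ∀ c, Nat.card {x // f τ x = c} = Nat.card {x // f τ' x = c} := by
    have key : ∀ σ : Equiv.Perm (Fin M), ∀ c, Nat.card {x // f σ x = c} =
        (Finset.univ.filter fun x : Fin M => ((x.val < 3) = c.1) ∧ ((σ x).val < 3) = c.2).card := by
      intro σ c
      rw [Nat.card_eq_fintype_card, Fintype.card_subtype]
      congr 1
      ext x
      simp [f, Prod.ext_iff]
    have e1 : ∀ σ : Equiv.Perm (Fin M),
        (Finset.univ.filter fun x : Fin M => x.val < 3 ∧ (σ x).val < 3).card +
        (Finset.univ.filter fun x : Fin M => x.val < 3 ∧ ¬ (σ x).val < 3).card =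
        (Finset.univ.filter fun x : Fin M => x.val < 3).card := by
      intro σ
      rw [← Finset.filter_filter, ← Finset.filter_filter, Finset.card_filter_add_card_filter_not]
    have e2 : ∀ σ : Equiv.Perm (Fin M),
        (Finset.univ.filter fun x : Fin M => x.val < 3 ∧ (σ x).val < 3).card +
        (Finset.univ.filter fun x : Fin M => ¬ x.val < 3 ∧ (σ x).val < 3).card =
        (Finset.univ.filter fun x : Fin M => x.val < 3).card := by
      intro σ
      rw [← card_filter_apply_lt_three σ]
      simp only [and_comm (b := (σ _).val < 3)]
      rw [← Finset.filter_filter, ← Finset.filter_filter, Finset.card_filter_add_card_filter_not]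
    have e3 : ∀ σ : Equiv.Perm (Fin M),
        (Finset.univ.filter fun x : Fin M => ¬ x.val < 3 ∧ (σ x).val < 3).card +
        (Finset.univ.filter fun x : Fin M => ¬ x.val < 3 ∧ ¬ (σ x).val < 3).card =
        (Finset.univ.filter fun x : Fin M => ¬ x.val < 3).card := by
      intro σ
      rw [← Finset.filter_filter, ← Finset.filter_filter, Finset.card_filter_add_card_filter_not]
    rintro ⟨c1, c2⟩
    rw [key, key]
    have a1 := e1 τ; have b1 := e1 τ'
    have a2 := e2 τ; have b2 := e2 τ'
    have a3 := e3 τ; have b3 := e3 τ'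
    by_cases h1 : c1 <;> by_cases h2 : c2 <;>
      simp only [h1, h2, eq_iff_iff, iff_true, iff_false] <;>
      omega
  have hne : ∀ c, Nonempty ({x // f τ x = c} ≃ {x // f τ' x = c}) := fun c =>
    Finite.card_eq.1 (hcard c)
  let g' : Equiv.Perm (Fin M) := Equiv.ofFiberEquiv fun c => (hne c).some
  have hg' : ∀ x, f τ' (g' x) = f τ x := fun x => Equiv.ofFiberEquiv_map _ x
  have h1 : ∀ x, (g' x).val < 3 ↔ x.val < 3 := fun x => iff_of_eq (congrArg Prod.fst (hg' x))
  have h2 : ∀ x, (τ' (g' x)).val < 3 ↔ (τ x).val < 3 :=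
    fun x => iff_of_eq (congrArg Prod.snd (hg' x))
  refine ⟨τ * g'⁻¹ * τ'⁻¹, g', fun x => ?_, h1, by group⟩
  have := h2 (g'⁻¹ (τ'⁻¹ x))
  simpa using this.symm

/-- Only one tripod of the row is compared with the sink. Up to permutations absorbed by the tripod
and by the sink, it sits at a place k ≤ 3 and has 3 - k ends in the sink. For k = 0, 1, 2 this is a
theta graph, a bigon and a ladder; for k = 3 the sink meets only the other strands, and induction
applies. -/
theorem snk_zero_mem (N : ℕ) : ∀ x ∈ tripodSpan (N + 3), snk 0 x ∈ tripodSpan N := by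
  induction N using Nat.strong_induction_on with
  | _ N ihN =>
  have hrep : ∀ k ≤ 3, k ≤ N → ∀ y ∈ tripodSpan N, snk 0 (tri k y) ∈ tripodSpan N := by
    intro k hk hkN y hy
    match k, hk, hkN with
    | 0, _, _ =>
      rw [snk_tri_self 0 y (by omega)]
      exact Submodule.smul_mem _ _ hy
    | 1, _, hN =>
      rw [snk_tri_succ 0 y (by omega)]
      exact Submodule.smul_mem _ _ hy
    | 2, _, hN =>
      have := lad_eq_snk_left 0 y
      rw [← this]
      have hc := Submodule.sub_mem _ (crs_mem (i := 0) (by omega) hy) hy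
      rwa [crs_apply, add_sub_cancel_right] at hc
    | 3, _, hN =>
      obtain ⟨M, rfl⟩ : ∃ M, N = M + 3 := ⟨N - 3, by omega⟩
      rw [← tri_snk_of_le 0 0]
      exact tri_mem 0 (ihN M (by omega) y hy)
  obtain ⟨τN, hτN, -⟩ := exists_webHom_tri N le_rfl
  have hw : w0 (N + 3) = webHom (N + 3) τN (tri 0 (w0 N)) := by rw [hτN, w0_add_three]
  have hle : tripodSpan (N + 3) ≤ (tripodSpan N).comap (snk 0) := by
    refine Submodule.span_le.2 ?_
    rintro _ ⟨σ, rfl⟩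
    simp only [Submodule.comap_coe, Set.mem_preimage, SetLike.mem_coe]
    rw [hw, ← Module.End.mul_apply, ← map_mul]
    generalize σ * τN = τ
    have hcount : ∃ k ≤ 3, k ≤ N ∧
        (Finset.univ.filter fun x : Fin (N + 3) => x.val < 3 ∧ (τ x).val < 3).card = 3 - k := by
      have h3 := card_filter_apply_lt_three τ
      have hA : (Finset.univ.filter fun x : Fin (N + 3) => x.val < 3).card = 3 := by
        rw [Fin.card_filter_val_lt]; omega
      have hA' := Finset.card_filter_add_card_filter_not (s := Finset.univ)
        (fun x : Fin (N + 3) => x.val < 3)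
      have h4 := Finset.card_filter_add_card_filter_not
        (s := Finset.univ.filter fun x : Fin (N + 3) => (τ x).val < 3) (fun x => x.val < 3)
      rw [Finset.filter_filter, Finset.filter_filter] at h4
      have h5 : (Finset.univ.filter fun x : Fin (N + 3) => (τ x).val < 3 ∧ ¬ x.val < 3).card ≤
          (Finset.univ.filter fun x : Fin (N + 3) => ¬ x.val < 3).card :=
        Finset.card_le_card fun x hx => by
          simp only [Finset.mem_filter, Finset.mem_univ, true_and] at hx ⊢
          exact hx.2
      simp only [and_comm (a := (τ _).val < 3)] at h4 h5
      rw [Finset.card_univ, Fintype.card_fin] at hA'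
      -- The witness k counts the points outside the first three that are sent among them; it is at
      -- most N because there are only N points outside.
      exact ⟨_, by omega, by omega, (Nat.sub_eq_of_eq_add (by omega :
        3 = (Finset.univ.filter fun x : Fin (N + 3) => x.val < 3 ∧ (τ x).val < 3).card +
          (Finset.univ.filter fun x : Fin (N + 3) => ¬ x.val < 3 ∧ (τ x).val < 3).card)).symm⟩
    obtain ⟨k, hk, hkN, hc⟩ := hcount
    obtain ⟨τ', h1, h2⟩ := exists_webHom_tri k hkN
    have hc' : (Finset.univ.filter fun x : Fin (N + 3) => x.val < 3 ∧ (τ' x).val < 3).card =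
        3 - k := by
      have e : (Finset.univ.filter fun x : Fin (N + 3) => x.val < 3 ∧ (τ' x).val < 3) =
          Finset.univ.filter fun x : Fin (N + 3) => x.val < 3 - k := by
        ext x
        simp only [Finset.mem_filter, Finset.mem_univ, true_and]
        constructor
        · rintro ⟨hx, hx'⟩
          rw [h2 x hx] at hx'
          omega
        · intro hx
          have hx3 : x.val < 3 := by omega
          rw [h2 x hx3]
          omega
      rw [e, Fin.card_filter_val_lt]
      omega
    obtain ⟨g, g', hg, hg', rfl⟩ := exists_preserves_mul τ τ' (hc.trans hc'.symm)
    obtain ⟨y, hy, hy'⟩ := exists_webHom_tri_zero hg' (w0 N)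
    rw [map_mul, map_mul, Module.End.mul_apply, Module.End.mul_apply, hy, h1]
    exact snk_zero_webHom_mem hg _ (hrep k hk hkN y (hy' w0_mem))
  exact hle

theorem snk_mem {i : ℕ} (hi : i ≤ N) : ∀ {x : WebN (N + 3)}, x ∈ tripodSpan (N + 3) →
    snk i x ∈ tripodSpan N := by
  induction i with
  | zero => exact fun hx => snk_zero_mem N _ hx
  | succ i ih =>
    intro x hx
    have h := snk_crs_crs_crs i (crs (i + 2) (crs (i + 1) (crs i x))) (by omega)
    rw [crs_crs (i + 2) _ (by omega), crs_crs (i + 1) _ (by omega), crs_crs i _ (by omega)] at h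
    rw [h]
    exact ih (by omega) (crs_mem (by omega) (crs_mem (by omega) (crs_mem (by omega) hx)))

end Sl3

namespace Sl3

open DirectSum

/-! ### Every web is a combination of permutations of a row of tripods -/

/-- The part of the sum of all web spaces where the boundary word has the length `n`. -/
def lengthSub (n : ℕ) : Submodule ℂ BigWeb :=
  Submodule.span ℂ {x | ∃ (w : List Bool) (d : Web w), w.length = n ∧ x = pic d}

theorem lengthSub_op {a b : List Bool} (p : Piece a b) {n n' j : ℕ} {x : BigWeb}
    (hx : x ∈ lengthSub n)
    (h : n' + a.length = n + b.length := by
      simp only [List.length_cons, List.length_nil] <;> omega) : op p j x ∈ lengthSub n' := by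
  have : lengthSub n ≤ (lengthSub n').comap (op p j) := by
    refine Submodule.span_le.2 ?_
    rintro _ ⟨w, d, hw, rfl⟩
    refine op_pic_cases p d j (lengthSub n') fun u v e hj d' =>
      Submodule.subset_span ⟨_, d', ?_, rfl⟩
    subst e
    simp only [List.length_append] at hw ⊢
    omega
  exact this hx

theorem op_eq_zero_of_length {a b : List Bool} (p : Piece a b) {n j : ℕ} {x : BigWeb}
    (hx : x ∈ lengthSub n)
    (h : n < j + a.length := by simp only [List.length_cons, List.length_nil] <;> omega) :
    op p j x = 0 := by
  have : lengthSub n ≤ LinearMap.ker (op p j) := by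
    refine Submodule.span_le.2 ?_
    rintro _ ⟨w, d, hw, rfl⟩
    refine op_pic_of_not p d ?_
    rintro ⟨u, v, rfl, rfl⟩
    simp only [List.length_append] at hw
    omega
  exact this hx

theorem sinkOp_eq_zero_of_letter {k i : ℕ} {x : BigWeb} (hx : x ∈ letterSub k false)
    (h : i ≤ k) (h' : k < i + 3) : sinkOp i x = 0 := by
  rw [sinkOp_apply]
  have h3 := letterSub_op_of_lt (Piece.tripod false) (j := i + 3) hx (by omega)
  rcases (by omega : k = i + 2 ∨ k < i + 2) with hk | hk
  · rw [op_eq_zero_of_letter (Piece.cap true) h3 (i := 0) rfl hk, map_zero, map_zero]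
  have h2 := letterSub_op_of_lt (Piece.cap true) (j := i + 2) h3 hk
  rcases (by omega : k = i + 1 ∨ k < i + 1) with hk | hk
  · rw [op_eq_zero_of_letter (Piece.cap true) h2 (i := 0) rfl hk, map_zero]
  have h1 := letterSub_op_of_lt (Piece.cap true) (j := i + 1) h2 hk
  exact op_eq_zero_of_letter (Piece.cap true) h1 (i := 0) rfl (by omega)

theorem letterSub_sinkOp_of_lt {k i : ℕ} {s : Bool} {x : BigWeb} (hx : x ∈ letterSub k s)
    (h : k < i) : sinkOp i x ∈ letterSub k s := by
  rw [sinkOp_apply]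
  exact letterSub_op_of_lt _ (letterSub_op_of_lt _ (letterSub_op_of_lt _ (letterSub_op_of_lt _ hx
    (by omega)) (by omega)) (by omega)) h

theorem letterSub_sinkOp_of_ge {k i : ℕ} {s : Bool} {x : BigWeb} (hx : x ∈ letterSub (k + 3) s)
    (h : i ≤ k) : sinkOp i x ∈ letterSub k s := by
  rw [sinkOp_apply]
  refine letterSub_op_of_ge (k := k + 2) _ (letterSub_op_of_ge (k := k + 4) _
    (letterSub_op_of_ge (k := k + 6) _ (letterSub_op_of_ge (k := k + 3) _ hx)))

theorem sinkOp_eq_zero_of_length {n i : ℕ} {x : BigWeb} (hx : x ∈ lengthSub n) (h : n < i + 3) :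
    sinkOp i x = 0 := by
  rw [sinkOp_apply, op_eq_zero_of_length (Piece.tripod false) hx, map_zero, map_zero, map_zero]

/-- If the letter at k + 2 is missing or inward, both sides vanish, so the hypothesis of
`cap_false_mergeOp` can be dropped. -/
theorem cap_false_mergeOp' (k : ℕ) (x : BigWeb) :
    op (Piece.cap false) k (mergeOp true k x) = sinkOp k x := by
  refine bigWeb_ext (F := op (Piece.cap false) k ∘ₗ mergeOp true k) (G := sinkOp k) ?_ x
  intro w d
  rw [LinearMap.comp_apply]
  rcases h : w[k + 2]? with _ | (_ | _)
  · have hw : w.length ≤ k + 2 := List.getElem?_eq_none_iff.1 h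
    have hd : pic d ∈ lengthSub w.length := Submodule.subset_span ⟨w, d, rfl, rfl⟩
    rw [sinkOp_eq_zero_of_length hd (by omega), mergeOp_true_apply]
    rcases Nat.lt_or_eq_of_le hw with hw | hw
    · rw [op_eq_zero_of_length (Piece.tripod false) hd, map_zero, map_zero, map_zero]
    · rw [hw] at hd
      refine op_eq_zero_of_length (n := k + 1) _ (lengthSub_op (n := k + 3) _
        (lengthSub_op (n := k + 5) _ (lengthSub_op _ hd)))
  · have hd : pic d ∈ letterSub (k + 2) false := Submodule.subset_span ⟨w, d, h, rfl⟩
    rw [sinkOp_eq_zero_of_letter hd (by omega) (by omega), mergeOp_true_apply]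
    refine op_eq_zero_of_letter (k := k + 1) (i := 1) (s := false) _ ?_ rfl rfl
    exact letterSub_op_of_ge (k := k + 3) _ (letterSub_op_of_ge (k := k + 5) _
      (letterSub_op_of_ge (k := k + 2) _ hd))
  · exact cap_false_mergeOp (Submodule.subset_span ⟨w, d, h, rfl⟩)

/-- The elements which become combinations of permuted rows of tripods after vertices have been
attached to all inward oriented boundary points. -/
inductive IsTripodSpanned : BigWeb → Prop
  | incl {N : ℕ} {x : WebN N} : x ∈ tripodSpan N → IsTripodSpanned (incl N x)
  | split {k : ℕ} {x : BigWeb} : x ∈ letterSub k false → IsTripodSpanned (splitOp false k x) →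
      IsTripodSpanned x

theorem IsTripodSpanned.smul {x : BigWeb} (hx : IsTripodSpanned x) (c : ℂ) :
    IsTripodSpanned (c • x) := by
  induction hx with
  | incl hx =>
    rw [← map_smul]
    exact .incl (Submodule.smul_mem _ _ hx)
  | split hk _ ih =>
    refine .split (Submodule.smul_mem _ _ hk) ?_
    rwa [map_smul]

theorem IsTripodSpanned.zero : IsTripodSpanned 0 := by
  rw [← map_zero (Sl3.incl 0)]
  exact .incl (Submodule.zero_mem _)

/-- Inserting a piece commutes with attaching vertices to the inward strands, which only change
their numbers. This leaves the words that are already outward. -/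
theorem IsTripodSpanned.insert {b : List Bool} (p : Piece [] b)
    (h : ∀ (N : ℕ) (x : WebN N), x ∈ tripodSpan N → ∀ i, IsTripodSpanned (op p i (Sl3.incl N x)))
    {x : BigWeb} (hx : IsTripodSpanned x) : ∀ i, IsTripodSpanned (op p i x) := by
  induction hx with
  | incl hx => exact h _ _ hx
  | @split k x hk _ ih =>
    intro i
    rcases Nat.lt_or_ge k i with hi | hi
    · refine .split (letterSub_op_of_lt p hk hi) ?_
      rw [← op_splitOp p false i k x hi]
      exact ih _
    · refine .split (k := k + b.length) (letterSub_op_of_ge p hk (by simpa using hi) (by simp)) ?_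
      rw [splitOp_op p false i k (k + b.length) x (by omega) (by simp)]
      exact ih i

theorem IsTripodSpanned.tripod_true {x : BigWeb} (hx : IsTripodSpanned x) (i : ℕ) :
    IsTripodSpanned (op (Piece.tripod true) i x) := by
  refine .insert _ (fun N x hx i => ?_) hx i
  rw [← incl_tri]
  exact .incl (tri_mem i hx)

theorem IsTripodSpanned.cup {x : BigWeb} (hx : IsTripodSpanned x) (s : Bool) (i : ℕ) :
    IsTripodSpanned (op (Piece.cup s) i x) := by
  refine .insert _ (fun N x hx i => ?_) hx i
  cases s with
  | true =>
    refine .split (k := i + 1) (letterSub_op_new (i := 1) _ _ rfl rfl) ?_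
    rw [splitOp_cup_true]
    exact tripod_true (.incl hx) i
  | false =>
    refine .split (k := i) (letterSub_op_new (i := 0) _ _ rfl rfl) ?_
    rw [splitOp_cup_false]
    exact tripod_true (.incl hx) i

theorem lad_mem {N i : ℕ} (hi : i + 1 < N) {x : WebN N} (hx : x ∈ tripodSpan N) :
    lad i x ∈ tripodSpan N := by
  have h := Submodule.sub_mem _ (crs_mem hi hx) hx
  rwa [crs_apply, add_sub_cancel_right] at h

/-- Vertices are attached to the left, the right and then the middle leg of the new sink. The
outcome is a ladder between two inserted tripods. -/
theorem IsTripodSpanned.tripod_false {x : BigWeb} (hx : IsTripodSpanned x) (i : ℕ) :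
    IsTripodSpanned (op (Piece.tripod false) i x) := by
  refine .insert _ (fun N x hx i => ?_) hx i
  refine .split (k := i) (letterSub_op_new (i := 0) _ _ rfl rfl) ?_
  have h1 : splitOp false i (op (Piece.tripod false) i (Sl3.incl N x)) =
      splitOp true (i + 2) (op (Piece.tripod true) i (Sl3.incl N x)) := splitOp_sink i _
  refine .split (k := i + 3) (by rw [h1]; exact splitOp_true_mem_right (i + 2) _) ?_
  refine .split (k := i + 2) ?_ ?_
  · rw [splitOp_apply, h1]
    exact letterSub_op_of_lt _ (letterSub_op_of_lt _ (splitOp_true_mem_left (i + 2) _)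
      (by omega)) (by omega)
  · rw [splitOp_splitOp_splitOp_sink, ← incl_tri, ← incl_tri, ← incl_lad]
    rcases Nat.lt_or_ge N i with hi | hi
    · rw [tri_eq_zero hi, map_zero, map_zero]
      exact .incl (Submodule.zero_mem _)
    · exact .incl (lad_mem (by omega) (tri_mem _ (tri_mem _ hx)))

theorem incl_mem_lengthSub {N : ℕ} (x : WebN N) : incl N x ∈ lengthSub N := by
  obtain ⟨z, rfl⟩ := (webRelations (List.replicate N true)).mkQ_surjective x
  change z ∈ (lengthSub N).comap (incl N ∘ₗ (webRelations (List.replicate N true)).mkQ)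
  induction z using Finsupp.induction_linear with
  | zero => exact Submodule.zero_mem _
  | add y z hy hz => exact Submodule.add_mem _ hy hz
  | single d c =>
    have e : Finsupp.single d c = c • fw d := by simp [fw]
    rw [e]
    exact Submodule.smul_mem _ _ (Submodule.subset_span ⟨_, d, by simp, rfl⟩)

theorem IsTripodSpanned.sink {x : BigWeb} (hx : IsTripodSpanned x) :
    ∀ i, IsTripodSpanned (sinkOp i x) := by
  induction hx with
  | @incl N x hx =>
    intro i
    rcases Nat.lt_or_ge N (i + 3) with hi | hi
    · rw [sinkOp_eq_zero_of_length (incl_mem_lengthSub x) hi]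
      exact zero
    · obtain ⟨N, rfl⟩ : ∃ M, N = M + 3 := ⟨N - 3, by omega⟩
      rw [← incl_snk]
      exact .incl (snk_mem (by omega) hx)
  | @split k x hk _ ih =>
    intro i
    rcases Nat.lt_or_ge k i with hi | hi
    · refine .split (letterSub_sinkOp_of_lt hk hi) ?_
      rw [← sinkOp_splitOp false i k]
      exact ih _
    · rcases Nat.lt_or_ge k (i + 3) with hi' | hi'
      · rw [sinkOp_eq_zero_of_letter hk hi hi']
        exact zero
      · obtain ⟨k, rfl⟩ : ∃ k', k = k' + 3 := ⟨k - 3, by omega⟩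
        refine .split (letterSub_sinkOp_of_ge hk (by omega)) ?_
        rw [splitOp_sinkOp false i k]
        exact ih _

theorem op_cap_incl (s : Bool) (i : ℕ) {N : ℕ} (x : WebN N) :
    op (Piece.cap s) i (incl N x) = 0 := by
  have : op (Piece.cap s) i ∘ₗ incl N = 0 := by
    apply webN_hom_ext
    intro d
    rw [LinearMap.comp_apply, incl_clN, op_pic_of_not, LinearMap.zero_apply]
    rintro ⟨u, v, h, -⟩
    have h1 : s ∈ List.replicate N true := by rw [h]; simp
    have h2 : (!s) ∈ List.replicate N true := by rw [h]; simp
    rw [List.mem_replicate] at h1 h2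
    rw [h1.2] at h2
    simp at h2
  exact LinearMap.congr_fun this x

/-- A cap away from the chosen inward strand commutes with its vertex. If it meets that strand, x is
rewritten as -1/2 times the bigon obtained by splitting and merging the strand. Cap and merge
combine to a sink on the split picture, which is covered by `IsTripodSpanned.sink`. -/
theorem IsTripodSpanned.cap (s : Bool) {x : BigWeb} (hx : IsTripodSpanned x) :
    ∀ i, IsTripodSpanned (op (Piece.cap s) i x) := by
  induction hx with
  | incl hx =>
    intro i
    rw [op_cap_incl]
    exact zero
  | @split k x hk hx ih =>
    intro i
    rcases Nat.lt_or_ge k i with hi | hi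
    · refine .split (letterSub_op_of_lt _ hk hi) ?_
      rw [← op_splitOp _ false i k x hi]
      exact ih _
    · rcases Nat.lt_or_ge k (i + 2) with hi' | hi'
      · have hb : x = (-1 / 2 : ℂ) • mergeOp true k (splitOp false k x) := by
          rw [mergeOp_splitOp hk]
          refine Eq.symm ((smul_smul (-1 / 2 : ℂ) (-2 : ℂ) x).trans ?_)
          norm_num
        rcases (by omega : k = i ∨ k = i + 1) with rfl | rfl <;> cases s
        · rw [hb, map_smul, cap_false_mergeOp']
          exact (sink hx k).smul _
        · rw [op_eq_zero_of_letter (Piece.cap true) hk (i := 0) rfl rfl]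
          exact zero
        · rw [op_eq_zero_of_letter (Piece.cap false) hk (i := 1) rfl rfl]
          exact zero
        · rw [hb, map_smul]
          exact (sink hx i).smul _
      · obtain ⟨k, rfl⟩ : ∃ k', k = k' + 2 := ⟨k - 2, by omega⟩
        refine .split (k := k) (letterSub_op_of_ge _ hk) ?_
        rw [splitOp_op _ false i (k + 2) k x]
        exact ih i

theorem isTripodSpanned_pic {w : List Bool} (d : Web w) : IsTripodSpanned (pic d) := by
  induction d with
  | empty =>
    have : pic Web.empty = incl 0 (w0 0) := rfl
    rw [this]
    exact .incl w0_mem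
  | slice p u v hw hw' d ih =>
    rw [← op_pic p u v hw hw' d rfl]
    cases p with
    | cup s => exact ih.cup s _
    | cap s => exact ih.cap s _
    | tripod s =>
      cases s with
      | true => exact ih.tripod_true _
      | false => exact ih.tripod_false _

theorem projN_pic_of_ne {N : ℕ} {w : List Bool} (h : w ≠ List.replicate N true) (d : Web w) :
    projN N (pic d) = 0 :=
  DFinsupp.single_eq_of_ne h.symm

theorem projN_eq_zero_of_letter {N k : ℕ} {x : BigWeb} (hx : x ∈ letterSub k false) :
    projN N x = 0 := by
  have : letterSub k false ≤ LinearMap.ker (projN N) := by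
    refine Submodule.span_le.2 ?_
    rintro _ ⟨w, d, hw, rfl⟩
    refine projN_pic_of_ne ?_ d
    rintro rfl
    obtain ⟨_, h⟩ := List.getElem?_eq_some_iff.1 hw
    simp at h
  exact this hx

theorem IsTripodSpanned.projN_mem {x : BigWeb} (hx : IsTripodSpanned x) (N : ℕ) :
    projN N x ∈ tripodSpan N := by
  cases hx with
  | @incl M x hx =>
    by_cases h : M = N
    · subst h
      rwa [projN_incl]
    · have : projN N ∘ₗ Sl3.incl M = 0 := by
        apply webN_hom_ext
        intro d
        refine projN_pic_of_ne (fun e => h ?_) d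
        simpa using congrArg List.length e
      rw [← LinearMap.comp_apply, this, LinearMap.zero_apply]
      exact Submodule.zero_mem _
  | split hk _ =>
    rw [projN_eq_zero_of_letter hk]
    exact Submodule.zero_mem _

/-- The web space is spanned by the permutations of a row of tripods. -/
theorem tripodSpan_eq_top (N : ℕ) : tripodSpan N = ⊤ := by
  refine top_unique fun x _ => ?_
  have : (tripodSpan N).mkQ = 0 := by
    apply webN_hom_ext
    intro d
    have h := (isTripodSpanned_pic d).projN_mem N
    rw [← incl_clN, projN_incl] at h
    simpa using h
  have h := LinearMap.congr_fun this x
  simpa using h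

end Sl3

namespace Sl3

/-! ### Evaluation of webs as tensors -/

/-- The sign of `(i, j, k)` as a permutation of `(0, 1, 2)`, zero for repeated entries. -/
def eps (i j k : Fin 3) : ℤ :=
  ((j : ℤ) - (i : ℤ)) * ((k : ℤ) - (i : ℤ)) * ((k : ℤ) - (j : ℤ)) / 2

/-- The effect of a piece on tensors, which are functions of the sequence of colors. -/
def opEv {a b : List Bool} (p : Piece a b) : ℕ → (List (Fin 3) → ℂ) → List (Fin 3) → ℂ
  | 0, f => fun l => match p with
    | .cup _ => match l with
      | i :: j :: r => if i = j then f r else 0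
      | _ => 0
    | .cap _ => ∑ i, f (i :: i :: l)
    | .tripod _ => match l with
      | i :: j :: k :: r => (eps i j k : ℂ) * f r
      | _ => 0
  | n + 1, f => fun l => match l with
    | [] => 0
    | c :: l => opEv p n (fun l' => f (c :: l')) l

section

variable {a b : List Bool} (p : Piece a b) (s : Bool) (f : List (Fin 3) → ℂ)

theorem opEv_cup_zero (i j : Fin 3) (r : List (Fin 3)) :
    opEv (Piece.cup s) 0 f (i :: j :: r) = if i = j then f r else 0 := rfl

theorem opEv_cap_zero (l : List (Fin 3)) :
    opEv (Piece.cap s) 0 f l = ∑ i, f (i :: i :: l) := rfl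

theorem opEv_tripod_zero (i j k : Fin 3) (r : List (Fin 3)) :
    opEv (Piece.tripod s) 0 f (i :: j :: k :: r) = (eps i j k : ℂ) * f r := rfl

theorem opEv_succ_cons (n : ℕ) (c : Fin 3) (l : List (Fin 3)) :
    opEv p (n + 1) f (c :: l) = opEv p n (fun l' => f (c :: l')) l := rfl

theorem opEv_append (lu l : List (Fin 3)) (n : ℕ) :
    opEv p (lu.length + n) f (lu ++ l) = opEv p n (fun l' => f (lu ++ l')) l := by
  induction lu generalizing f with
  | nil => simp
  | cons c lu ih =>
    rw [List.length_cons, show lu.length + 1 + n = lu.length + n + 1 by omega, List.cons_append,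
      opEv_succ_cons, ih]
    rfl

theorem opEv_add (n : ℕ) (f g : List (Fin 3) → ℂ) (l : List (Fin 3)) :
    opEv p n (f + g) l = opEv p n f l + opEv p n g l := by
  induction n generalizing f g l with
  | zero =>
    cases p with
    | cup s =>
      rcases l with _ | ⟨i, _ | ⟨j, r⟩⟩
      · simp [opEv]
      · simp [opEv]
      · simp only [opEv_cup_zero, Pi.add_apply]
        split_ifs <;> simp
    | cap s => simp only [opEv_cap_zero, Pi.add_apply, Finset.sum_add_distrib]
    | tripod s =>
      rcases l with _ | ⟨i, _ | ⟨j, _ | ⟨k, r⟩⟩⟩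
      · simp [opEv]
      · simp [opEv]
      · simp [opEv]
      · simp only [opEv_tripod_zero, Pi.add_apply, mul_add]
  | succ n ih =>
    cases l with
    | nil => simp [opEv]
    | cons c l => exact ih _ _ l

theorem opEv_smul (n : ℕ) (c : ℂ) (f : List (Fin 3) → ℂ) (l : List (Fin 3)) :
    opEv p n (c • f) l = c • opEv p n f l := by
  induction n generalizing f l with
  | zero =>
    cases p with
    | cup s =>
      rcases l with _ | ⟨i, _ | ⟨j, r⟩⟩
      · simp [opEv]
      · simp [opEv]
      · simp only [opEv_cup_zero, Pi.smul_apply]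
        split_ifs <;> simp
    | cap s => simp only [opEv_cap_zero, Pi.smul_apply, Finset.smul_sum]
    | tripod s =>
      rcases l with _ | ⟨i, _ | ⟨j, _ | ⟨k, r⟩⟩⟩
      · simp [opEv]
      · simp [opEv]
      · simp [opEv]
      · simp only [opEv_tripod_zero, Pi.smul_apply, smul_eq_mul]
        ring
  | succ n ih =>
    cases l with
    | nil => simp [opEv]
    | cons c l => exact ih _ l

end

/-- The effect of a piece on tensors, as a linear map. -/
def opEvLin {a b : List Bool} (p : Piece a b) (n : ℕ) :
    (List (Fin 3) → ℂ) →ₗ[ℂ] (List (Fin 3) → ℂ) where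
  toFun := opEv p n
  map_add' f g := funext fun l => opEv_add p n f g l
  map_smul' c f := funext fun l => opEv_smul p n c f l

/-- The lengths are integers because removing colors on the left in the induction may make the
expected length negative. -/
theorem opEv_eq_zero_of_length {a b : List Bool} (p : Piece a b) (n : ℕ)
    {f : List (Fin 3) → ℂ} {m m' : ℤ} (hf : ∀ l : List (Fin 3), (l.length : ℤ) ≠ m → f l = 0)
    (hm : m + b.length = m' + a.length) (l : List (Fin 3)) (hl : (l.length : ℤ) ≠ m') :
    opEv p n f l = 0 := by
  induction n generalizing f m m' l with
  | zero =>
    cases p with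
    | cup s =>
      rcases l with _ | ⟨i, _ | ⟨j, r⟩⟩
      · simp [opEv]
      · simp [opEv]
      · simp only [List.length_cons, List.length_nil] at hm hl
        rw [opEv_cup_zero, hf r (by omega), ite_self]
    | cap s =>
      rw [opEv_cap_zero]
      simp only [List.length_cons, List.length_nil] at hm
      exact Finset.sum_eq_zero fun i _ => hf _ (by simp only [List.length_cons]; omega)
    | tripod s =>
      rcases l with _ | ⟨i, _ | ⟨j, _ | ⟨k, r⟩⟩⟩
      · simp [opEv]
      · simp [opEv]
      · simp [opEv]
      · simp only [List.length_cons, List.length_nil] at hm hl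
        rw [opEv_tripod_zero, hf r (by omega), mul_zero]
  | succ n ih =>
    cases l with
    | nil => simp [opEv]
    | cons c l =>
      rw [opEv_succ_cons]
      refine ih (m := m - 1) (m' := m' - 1) (fun l' hl' => hf _ ?_) (by omega) l ?_
      · simp only [List.length_cons]; omega
      · simp only [List.length_cons] at hl; omega

/-- The tensor of a web picture. -/
def ev : ∀ {w : List Bool}, Web w → List (Fin 3) → ℂ
  | _, .empty => fun l => if l = [] then 1 else 0
  | _, .slice p u _ _ _ d => opEv p u.length (ev d)

theorem ev_slice {a b w w' : List Bool} (p : Piece a b) (u v : List Bool)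
    (hw : w = u ++ a ++ v) (hw' : w' = u ++ b ++ v) (d : Web w) :
    ev (Web.slice p u v hw hw' d) = opEv p u.length (ev d) := rfl

theorem ev_eq_zero {w : List Bool} (d : Web w) : ∀ l : List (Fin 3), (l.length : ℤ) ≠ w.length →
    ev d l = 0 := by
  induction d with
  | empty =>
    intro l hl
    change (if l = [] then (1 : ℂ) else 0) = 0
    rw [if_neg]
    rintro rfl
    simp at hl
  | slice p u v hw hw' d ih =>
    intro l hl
    rw [ev_slice]
    refine opEv_eq_zero_of_length p _ ih ?_ l hl
    subst hw hw'
    simp only [List.length_append]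
    push_cast
    ring

/-- The formulas for `opEv` apply once a list has enough entries. On lists of any other length both
tensors vanish, so the relations need checking only where the length is right. -/
theorem ev_ext {w : List Bool} {d : Web w} {g : List (Fin 3) → ℂ}
    (hg : ∀ l : List (Fin 3), (l.length : ℤ) ≠ w.length → g l = 0)
    (h : ∀ l : List (Fin 3), l.length = w.length → ev d l = g l) : ev d = g := by
  funext l
  by_cases hl : l.length = w.length
  · exact h l hl
  · rw [ev_eq_zero d l (by exact_mod_cast hl), hg l (by exact_mod_cast hl)]

theorem ev_cap {w w' : List Bool} (s : Bool) (u v : List Bool) (d : Web w) (hw) (hw') :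
    ev (Web.cap s u v d hw hw' : Web w') = opEv (Piece.cap s) u.length (ev d) := rfl

theorem ev_cup {w w' : List Bool} (s : Bool) (u v : List Bool) (d : Web w) (hw) (hw') :
    ev (Web.cup s u v d hw hw' : Web w') = opEv (Piece.cup s) u.length (ev d) := rfl

theorem ev_tripod {w w' : List Bool} (s : Bool) (u v : List Bool) (d : Web w) (hw) (hw') :
    ev (Web.tripod s u v d hw hw' : Web w') = opEv (Piece.tripod s) u.length (ev d) := rfl

theorem ev_split {w w' : List Bool} (t : Bool) (u v : List Bool) (d : Web w) (hw) (hw') :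
    ev (Web.split t u v d hw hw' : Web w') =
      opEv (Piece.cap t) u.length (opEv (Piece.tripod (!t)) (u.length + 1) (ev d)) := by
  rw [Web.split, ev_cap, ev_tripod, List.length_append]
  rfl

theorem ev_merge {w w' : List Bool} (t : Bool) (u v : List Bool) (d : Web w) (hw) (hw') :
    ev (Web.merge t u v d hw hw' : Web w') =
      opEv (Piece.cap t) u.length (opEv (Piece.cap t) (u.length + 1)
        (opEv (Piece.tripod (!t)) (u.length + 2) (ev d))) := by
  rw [Web.merge, ev_cap, ev_cap, ev_tripod, List.length_append, List.length_append]
  rfl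

theorem exists_append_of_length {α : Type*} {l : List α} {m n : ℕ} (h : l.length = m + n) :
    ∃ l1 l2, l = l1 ++ l2 ∧ l1.length = m ∧ l2.length = n :=
  ⟨l.take m, l.drop m, by simp, by simp; omega, by simp; omega⟩

/-- Once the strands left of `p` are stripped off, `p` acts at position zero by an explicit linear
formula in the remaining tensor, and the linear map `opEvLin q m` commutes with it. -/
theorem opEv_opEv_comm {a b a' b' : List Bool} (p : Piece a b) (q : Piece a' b') (n m k : ℕ)
    (f : List (Fin 3) → ℂ) (l : List (Fin 3)) (hl : l.length = n + b.length + m + b'.length + k) :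
    opEv q (n + b.length + m) (opEv p n f) l = opEv p n (opEv q (n + a.length + m) f) l := by
  obtain ⟨lu, l, rfl, rfl, hl'⟩ := exists_append_of_length
    (show l.length = n + (b.length + (m + (b'.length + k))) by omega)
  clear hl
  rw [add_assoc, add_assoc, opEv_append]
  have e1 : (fun l' => opEv p lu.length f (lu ++ l')) = opEv p 0 (fun l' => f (lu ++ l')) :=
    funext fun l' => opEv_append p f lu l' 0
  have e2 := opEv_append p (opEv q (lu.length + (a.length + m)) f) lu l 0
  have e3 : (fun l' => opEv q (lu.length + (a.length + m)) f (lu ++ l')) =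
      opEv q (a.length + m) (fun l' => f (lu ++ l')) :=
    funext fun l' => opEv_append q f lu l' _
  rw [e1]
  rw [e3] at e2
  refine Eq.trans ?_ e2.symm
  generalize (fun l' => f (lu ++ l')) = f
  clear e1 e2 e3
  obtain ⟨lb, l, rfl, hlb, -⟩ := exists_append_of_length hl'
  cases p with
  | cup s =>
    obtain ⟨i, j, rfl⟩ := List.length_eq_two.1 hlb
    rw [show [s, !s].length + m = m + 1 + 1 by simp; omega]
    simp only [List.cons_append, List.nil_append, opEv_succ_cons, opEv_cup_zero, List.length_nil,
      zero_add]
    split_ifs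
    · rfl
    · exact congrFun ((opEvLin q m).map_zero) l
  | cap s =>
    obtain rfl := List.length_eq_zero_iff.1 hlb
    rw [show [s, !s].length + m = m + 1 + 1 by simp; omega]
    simp only [List.nil_append, opEv_succ_cons, opEv_cap_zero, List.length_nil, zero_add]
    have h := congrFun (map_sum (opEvLin q m) (fun (i : Fin 3) (l' : List (Fin 3)) =>
      f (i :: i :: l')) Finset.univ) l
    rw [Finset.sum_apply] at h
    refine Eq.trans (congrArg (fun g => opEvLin q m g l) ?_) h
    funext l'
    rw [Finset.sum_apply, opEv_cap_zero]
  | tripod s =>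
    obtain ⟨i, j, k, rfl⟩ := List.length_eq_three.1 hlb
    rw [show [s, s, s].length + m = m + 1 + 1 + 1 by simp; omega]
    simp only [List.cons_append, List.nil_append, opEv_succ_cons, opEv_tripod_zero,
      List.length_nil, zero_add]
    exact congrFun ((opEvLin q m).map_smul (eps i j k : ℂ) f) l

theorem opEv_append_of_eq {a b : List Bool} (p : Piece a b) (f : List (Fin 3) → ℂ)
    {k : ℕ} {lu : List (Fin 3)} (h : lu.length = k) (l : List (Fin 3)) (n : ℕ) :
    opEv p (k + n) f (lu ++ l) = opEv p n (fun l' => f (lu ++ l')) l := by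
  subst h
  exact opEv_append p f lu l n

theorem opEv_append_of_eq_zero {a b : List Bool} (p : Piece a b) (f : List (Fin 3) → ℂ)
    {k : ℕ} {lu : List (Fin 3)} (h : lu.length = k) (l : List (Fin 3)) :
    opEv p k f (lu ++ l) = opEv p 0 (fun l' => f (lu ++ l')) l :=
  opEv_append_of_eq p f h l 0

section

variable {a b : List Bool} (p : Piece a b) (f : List (Fin 3) → ℂ) (c1 c2 c3 c4 : Fin 3)
  (l : List (Fin 3))

theorem opEv_one_cons : opEv p 1 f (c1 :: l) = opEv p 0 (fun l' => f (c1 :: l')) l := rfl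

theorem opEv_two_cons : opEv p 2 f (c1 :: c2 :: l) =
    opEv p 0 (fun l' => f (c1 :: c2 :: l')) l := rfl

theorem opEv_three_cons : opEv p 3 f (c1 :: c2 :: c3 :: l) =
    opEv p 0 (fun l' => f (c1 :: c2 :: c3 :: l')) l := rfl

theorem opEv_four_cons : opEv p 4 f (c1 :: c2 :: c3 :: c4 :: l) =
    opEv p 0 (fun l' => f (c1 :: c2 :: c3 :: c4 :: l')) l := rfl

end

/-! ### Contractions of the alternating tensor. -/

theorem eps_rotate : ∀ i j k : Fin 3, eps j k i = eps i j k := by decide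

/-- The nested caps of a bigon contract the two vertices in opposite orders, `y x` against `x y`.
This is the origin of the sign in -2. -/
theorem sum_eps_mul_eps : ∀ c z : Fin 3, ∑ x : Fin 3, ∑ y : Fin 3, eps y x c * eps z x y =
    if z = c then -2 else 0 := by decide

theorem eps_square (i j k m : Fin 3) :
    ∑ x : Fin 3, ∑ y : Fin 3, eps y x k * ∑ z : Fin 3, eps z j x * ∑ t : Fin 3,
      eps t y m * eps t i z = (if k = m then if i = j then 1 else 0 else 0) +
        if j = k then if i = m then 1 else 0 else 0 := by
  revert i j k m
  decide +kernel

/-- The evaluation of formal linear combinations of pictures. -/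
def evLin (w : List Bool) : (Web w →₀ ℂ) →ₗ[ℂ] (List (Fin 3) → ℂ) :=
  Finsupp.linearCombination ℂ ev

theorem evLin_fw {w : List Bool} (d : Web w) : evLin w (fw d) = ev d := by
  simp [evLin, fw]

theorem evLin_mapDomain {a b w w' : List Bool} (p : Piece a b) (u v : List Bool)
    (hw : w = u ++ a ++ v) (hw' : w' = u ++ b ++ v) (x : Web w →₀ ℂ) :
    evLin w' (Finsupp.mapDomain (Web.slice p u v hw hw') x) =
      opEvLin p u.length (evLin w x) := by
  induction x using Finsupp.induction_linear with
  | zero => simp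
  | add x y hx hy => rw [Finsupp.mapDomain_add, map_add, map_add, map_add, hx, hy]
  | single d c =>
    rw [Finsupp.mapDomain_single]
    simp only [evLin, Finsupp.linearCombination_single, map_smul]
    rfl

theorem ev_zigzagLeft (s : Bool) (u v : List Bool) (d : Web (u ++ [s] ++ v)) :
    ev (Web.cap (!s) (u ++ [s]) v (Web.cup s u ([s] ++ v) d : Web (u ++ [s, !s, s] ++ v)) :
      Web (u ++ [s] ++ v)) = ev d := by
  refine ev_ext (ev_eq_zero d) fun l hl => ?_
  obtain ⟨lu, l, rfl, hu, hl⟩ := exists_append_of_length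
    (show l.length = u.length + (1 + v.length) by simp at hl; omega)
  obtain ⟨c, l, rfl⟩ := List.exists_cons_of_length_pos (show 0 < l.length by omega)
  simp only [ev_cap, ev_cup, List.length_append, List.length_cons, List.length_nil, zero_add,
    opEv_append_of_eq _ _ hu, opEv_append_of_eq_zero _ _ hu, opEv_one_cons, opEv_cap_zero,
    opEv_cup_zero, Finset.sum_ite_eq, Finset.mem_univ, if_true]

theorem ev_zigzagRight (s : Bool) (u v : List Bool) (d : Web (u ++ [s] ++ v)) :
    ev (Web.cap s u ([s] ++ v) (Web.cup (!s) (u ++ [s]) v d : Web (u ++ [s, !s, s] ++ v)) :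
      Web (u ++ [s] ++ v)) = ev d := by
  refine ev_ext (ev_eq_zero d) fun l hl => ?_
  obtain ⟨lu, l, rfl, hu, hl⟩ := exists_append_of_length
    (show l.length = u.length + (1 + v.length) by simp at hl; omega)
  obtain ⟨c, l, rfl⟩ := List.exists_cons_of_length_pos (show 0 < l.length by omega)
  simp only [ev_cap, ev_cup, List.length_append, List.length_cons, List.length_nil, zero_add,
    opEv_append_of_eq _ _ hu, opEv_append_of_eq_zero _ _ hu, opEv_one_cons, opEv_cap_zero,
    opEv_cup_zero, Finset.sum_ite_eq', Finset.mem_univ, if_true]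

theorem ev_rotateRight (s : Bool) (u v : List Bool) (d : Web (u ++ v)) :
    ev (Web.cap (w' := u ++ [s, s, s] ++ v) s (u ++ [s, s, s]) v
      (Web.tripod s (u ++ [s]) ([!s] ++ v) (Web.cup s u v d : Web (u ++ [s, !s] ++ v)) :
        Web (u ++ [s, s, s, s, !s] ++ v))) =
      ev (Web.tripod s u v d : Web (u ++ [s, s, s] ++ v)) := by
  refine ev_ext (ev_eq_zero _) fun l hl => ?_
  obtain ⟨lu, l, rfl, hu, hl⟩ := exists_append_of_length
    (show l.length = u.length + (3 + v.length) by simp at hl; omega)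
  obtain ⟨l3, l, rfl, h3, -⟩ := exists_append_of_length hl
  obtain ⟨i, j, k, rfl⟩ := List.length_eq_three.1 h3
  simp only [ev_cap, ev_cup, ev_tripod, List.length_append, List.length_cons, List.length_nil,
    zero_add, Nat.reduceAdd, List.cons_append, List.nil_append,
    opEv_append_of_eq _ _ hu, opEv_append_of_eq_zero _ _ hu, opEv_one_cons, opEv_three_cons,
    opEv_cap_zero, opEv_tripod_zero, opEv_cup_zero, mul_ite, mul_zero, Finset.sum_ite_eq,
    Finset.mem_univ, if_true]
  rw [eps_rotate]

theorem ev_rotateLeft (s : Bool) (u v : List Bool) (d : Web (u ++ v)) :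
    ev (Web.cap (w' := u ++ [s, s, s] ++ v) (!s) u ([s, s, s] ++ v)
      (Web.tripod s (u ++ [!s]) ([s] ++ v) (Web.cup (!s) u v d : Web (u ++ [!s, s] ++ v)) :
        Web (u ++ [!s, s, s, s, s] ++ v))) =
      ev (Web.tripod s u v d : Web (u ++ [s, s, s] ++ v)) := by
  refine ev_ext (ev_eq_zero _) fun l hl => ?_
  obtain ⟨lu, l, rfl, hu, hl⟩ := exists_append_of_length
    (show l.length = u.length + (3 + v.length) by simp at hl; omega)
  obtain ⟨l3, l, rfl, h3, -⟩ := exists_append_of_length hl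
  obtain ⟨i, j, k, rfl⟩ := List.length_eq_three.1 h3
  simp only [ev_cap, ev_cup, ev_tripod, List.length_append, List.length_cons, List.length_nil,
    zero_add, List.cons_append, List.nil_append,
    opEv_append_of_eq _ _ hu, opEv_append_of_eq_zero _ _ hu, opEv_one_cons,
    opEv_cap_zero, opEv_tripod_zero, opEv_cup_zero, mul_ite, mul_zero, Finset.sum_ite_eq',
    Finset.mem_univ, if_true]
  rw [← eps_rotate]

theorem ev_loop (s : Bool) (u v : List Bool) (d : Web (u ++ v)) :
    ev (Web.cap s u v (Web.cup s u v d : Web (u ++ [s, !s] ++ v)) : Web (u ++ v)) =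
      (3 : ℂ) • ev d := by
  refine ev_ext (fun l hl => by rw [Pi.smul_apply, ev_eq_zero d l hl, smul_zero]) fun l hl => ?_
  obtain ⟨lu, l, rfl, hu, hl⟩ := exists_append_of_length
    (show l.length = u.length + v.length by simp at hl; omega)
  simp only [ev_cap, ev_cup, opEv_append_of_eq_zero _ _ hu, opEv_cap_zero, opEv_cup_zero,
    if_true, Pi.smul_apply, Finset.sum_const, Finset.card_univ, Fintype.card_fin, nsmul_eq_mul,
    smul_eq_mul]
  norm_num

theorem ev_bigon (t : Bool) (u v : List Bool) (d : Web (u ++ [t] ++ v)) :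
    ev (Web.merge (!t) u v (Web.split t u v d : Web (u ++ [!t, !t] ++ v)) :
      Web (u ++ [t] ++ v)) = (-2 : ℂ) • ev d := by
  refine ev_ext (fun l hl => by rw [Pi.smul_apply, ev_eq_zero d l hl, smul_zero]) fun l hl => ?_
  obtain ⟨lu, l, rfl, hu, hl⟩ := exists_append_of_length
    (show l.length = u.length + (1 + v.length) by simp at hl; omega)
  obtain ⟨c, l, rfl⟩ := List.exists_cons_of_length_pos (show 0 < l.length by omega)
  simp only [ev_merge, ev_split, opEv_append_of_eq _ _ hu, opEv_append_of_eq_zero _ _ hu,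
    opEv_one_cons, opEv_two_cons, opEv_cap_zero, opEv_tripod_zero, Pi.smul_apply, smul_eq_mul]
  have h : ∀ z : Fin 3, (∑ x : Fin 3, ∑ y : Fin 3, (eps y x c : ℂ) * (eps z x y : ℂ)) =
      if z = c then -2 else 0 := fun z => by
    have := congrArg (Int.cast : ℤ → ℂ) (sum_eps_mul_eps c z)
    push_cast at this
    exact this
  calc _ = ∑ z : Fin 3, (∑ x : Fin 3, ∑ y : Fin 3, (eps y x c : ℂ) * (eps z x y : ℂ)) *
        ev d (lu ++ z :: l) := by
        simp only [Fin.sum_univ_three]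
        ring
    _ = _ := by
        simp only [h, ite_mul, zero_mul, Finset.sum_ite_eq', Finset.mem_univ, if_true]

theorem ev_square (s : Bool) (u v : List Bool) (d : Web (u ++ v)) :
    ev (Web.cap (w' := u ++ [s, !s, s, !s] ++ v) (!s) (u ++ [s, !s]) ([s, !s] ++ v)
          (Web.split (!s) (u ++ [s, !s, !s]) ([!s] ++ v)
            (Web.split s (u ++ [s]) ([!s, !s] ++ v)
              (Web.split s (u ++ [s, s]) v
                (Web.split (!s) u ([s] ++ v)
                  (Web.cup (!s) u v d : Web (u ++ [!s, s] ++ v)) :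
                  Web (u ++ [s, s, s] ++ v)) :
                Web (u ++ [s, s, !s, !s] ++ v)) :
              Web (u ++ [s, !s, !s, !s, !s] ++ v)) :
            Web (u ++ [s, !s, !s, s, s, !s] ++ v))) =
      ev (Web.cup (w' := u ++ [s, !s, s, !s] ++ v) s (u ++ [s, !s]) v
            (Web.cup s u v d : Web (u ++ [s, !s] ++ v))) +
          ev (Web.cup (w' := u ++ [s, !s, s, !s] ++ v) (!s) (u ++ [s]) ([!s] ++ v)
            (Web.cup s u v d : Web (u ++ [s, !s] ++ v))) := by
  refine ev_ext (fun l hl => by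
    rw [Pi.add_apply, ev_eq_zero _ l hl, ev_eq_zero _ l hl, add_zero]) fun l hl => ?_
  obtain ⟨lu, l, rfl, hu, hl⟩ := exists_append_of_length
    (show l.length = u.length + (2 + (2 + v.length)) by simp at hl; omega)
  obtain ⟨l2, l, rfl, h2, hl⟩ := exists_append_of_length hl
  obtain ⟨l2', l, rfl, h2', -⟩ := exists_append_of_length hl
  obtain ⟨i, j, rfl⟩ := List.length_eq_two.1 h2
  obtain ⟨k, m, rfl⟩ := List.length_eq_two.1 h2'
  simp only [ev_cap, ev_cup, ev_split, List.length_append, List.length_cons, List.length_nil,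
    zero_add, Nat.reduceAdd, List.cons_append, List.nil_append, Pi.add_apply, add_assoc,
    opEv_append_of_eq _ _ hu, opEv_append_of_eq_zero _ _ hu, opEv_one_cons, opEv_two_cons,
    opEv_three_cons, opEv_four_cons, opEv_cap_zero, opEv_tripod_zero, opEv_cup_zero]
  generalize ev d (lu ++ l) = z
  simp only [mul_ite, mul_zero, Finset.sum_ite_eq', Finset.mem_univ, if_true]
  have h := congrArg (Int.cast : ℤ → ℂ) (eps_square i j k m)
  push_cast at h
  have e : (if k = m then if i = j then z else 0 else 0) + (if j = k then if i = m then z else 0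
      else 0) = ((if k = m then if i = j then 1 else 0 else 0) +
        if j = k then if i = m then 1 else 0 else 0) * z := by
    split_ifs <;> ring
  rw [e, ← h]
  simp only [Finset.sum_mul, Finset.mul_sum, mul_assoc]

theorem evLin_eq_of_rel {w : List Bool} {x y : Web w →₀ ℂ} (h : WebRel x y) :
    evLin w x = evLin w y := by
  induction h with
  | exchange p q u m v d =>
    rw [evLin_fw, evLin_fw]
    refine ev_ext (ev_eq_zero _) fun l hl => ?_
    simp only [ev_slice, List.length_append]
    exact opEv_opEv_comm p q _ _ v.length _ l (by rw [hl]; simp only [List.length_append])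
  | zigzagLeft s u v d => rw [evLin_fw, evLin_fw, ev_zigzagLeft]
  | zigzagRight s u v d => rw [evLin_fw, evLin_fw, ev_zigzagRight]
  | rotateRight s u v d => rw [evLin_fw, evLin_fw, ev_rotateRight]
  | rotateLeft s u v d => rw [evLin_fw, evLin_fw, ev_rotateLeft]
  | loop s u v d => rw [map_smul, evLin_fw, evLin_fw, ev_loop]
  | bigon t u v d => rw [map_smul, evLin_fw, evLin_fw, ev_bigon]
  | square s u v d => rw [map_add, evLin_fw, evLin_fw, evLin_fw, ev_square]
  | slice p u v hw hw' _ ih => rw [evLin_mapDomain, evLin_mapDomain, ih]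

end Sl3

namespace Sl3

/-! ### Evaluation of webs with outward oriented boundary -/

variable {N : ℕ}

/-- The tensor of a web with outward oriented boundary. -/
def evN (N : ℕ) : WebN N →ₗ[ℂ] (List (Fin 3) → ℂ) :=
  (webRelations (List.replicate N true)).liftQ (evLin _) (by
    refine Submodule.span_le.2 ?_
    rintro _ ⟨x, y, h, rfl⟩
    rw [SetLike.mem_coe, LinearMap.mem_ker, map_sub, evLin_eq_of_rel h, sub_self])

theorem evN_clN (d : Web (List.replicate N true)) : evN N (clN d) = ev d := by
  rw [← evLin_fw]
  rfl

/-- By this contraction a ladder evaluates to the flip of two factors minus the identity. Hence a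
crossing evaluates to the flip itself, without a sign. -/
theorem sum_eps_mul_eps' : ∀ a b x y : Fin 3, ∑ z : Fin 3, eps z a b * eps y x z =
    (if x = b ∧ y = a then 1 else 0) - (if x = a ∧ y = b then 1 else 0) := by decide

theorem sum_eps_mul_eps_mul : ∀ (a b : Fin 3) (f : Fin 3 → Fin 3 → ℂ),
    ∑ z : Fin 3, (eps z a b : ℂ) * ∑ x : Fin 3, ∑ y : Fin 3, (eps y x z : ℂ) * f x y =
      f b a - f a b := by
  intro a b f
  have h : ∀ x y : Fin 3, ∑ z : Fin 3, (eps z a b : ℂ) * (eps y x z : ℂ) =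
      (if x = b ∧ y = a then 1 else 0) - if x = a ∧ y = b then 1 else 0 := by
    intro x y
    have h1 := congrArg (Int.cast : ℤ → ℂ) (sum_eps_mul_eps' a b x y)
    push_cast at h1
    exact h1
  calc _ = ∑ x : Fin 3, ∑ y : Fin 3, (∑ z : Fin 3, (eps z a b : ℂ) * (eps y x z : ℂ)) * f x y := by
        simp only [Fin.sum_univ_three]
        ring
    _ = _ := by
        simp only [h, sub_mul, Finset.sum_sub_distrib, ite_and, ite_mul, one_mul, zero_mul,
          Finset.sum_ite_irrel, Finset.sum_ite_eq', Finset.mem_univ, if_true,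
          Finset.sum_const_zero]

theorem evN_lad {i : ℕ} (hi : i + 2 ≤ N) (x : WebN N) (lu lv : List (Fin 3))
    (hu : lu.length = i) (a b : Fin 3) :
    evN N (lad i x) (lu ++ a :: b :: lv) =
      evN N x (lu ++ b :: a :: lv) - evN N x (lu ++ a :: b :: lv) := by
  have : LinearMap.proj (R := ℂ) (φ := fun _ : List (Fin 3) => ℂ) (lu ++ a :: b :: lv) ∘ₗ
      evN N ∘ₗ lad i =
    LinearMap.proj (lu ++ b :: a :: lv) ∘ₗ evN N -
      LinearMap.proj (lu ++ a :: b :: lv) ∘ₗ evN N := by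
    apply webN_hom_ext
    intro d
    have h : lad i (clN d) = clN (Web.split false (List.replicate i true)
      (List.replicate (N - i - 2) true)
      (Web.merge true (List.replicate i true) (List.replicate (N - i - 2) true) d
        (replicate_split hi true) :
        Web (List.replicate i true ++ [false] ++ List.replicate (N - i - 2) true))
      (by simp) (replicate_split hi true) : Web (List.replicate N true)) := by
      apply incl_injective
      rw [incl_lad, incl_clN, incl_clN, ladderOp_pic hi]
    simp only [LinearMap.comp_apply, LinearMap.sub_apply, LinearMap.proj_apply, h, evN_clN,
      ev_split, ev_merge, List.length_replicate, opEv_append_of_eq _ _ hu,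
      opEv_append_of_eq_zero _ _ hu, opEv_one_cons, opEv_two_cons, opEv_cap_zero, opEv_tripod_zero]
    exact sum_eps_mul_eps_mul a b fun x y => ev d (lu ++ x :: y :: lv)
  exact LinearMap.congr_fun this x

theorem evN_crs {i : ℕ} (hi : i + 2 ≤ N) (x : WebN N) (lu lv : List (Fin 3))
    (hu : lu.length = i) (a b : Fin 3) :
    evN N (crs i x) (lu ++ a :: b :: lv) = evN N x (lu ++ b :: a :: lv) := by
  rw [crs_apply, map_add, Pi.add_apply, evN_lad hi x lu lv hu, sub_add_cancel]

theorem evN_tri_last (x : WebN N) (l : List (Fin 3)) (hl : l.length = N) (a b c : Fin 3) :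
    evN (N + 3) (tri N x) (l ++ [a, b, c]) = (eps a b c : ℂ) * evN N x l := by
  have : LinearMap.proj (R := ℂ) (φ := fun _ : List (Fin 3) => ℂ) (l ++ [a, b, c]) ∘ₗ
      evN (N + 3) ∘ₗ tri N = (eps a b c : ℂ) • LinearMap.proj l ∘ₗ evN N := by
    apply webN_hom_ext
    intro d
    have h : tri N (clN d) = clN (Web.tripod true (List.replicate N true) [] d (by simp)
        (by rw [List.replicate_add]; simp [List.replicate]) :
        Web (List.replicate (N + 3) true)) := by
      apply incl_injective
      rw [incl_tri, incl_clN, incl_clN, Web.tripod]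
      exact op_pic _ _ _ _ _ d (by simp)
    simp only [LinearMap.comp_apply, LinearMap.smul_apply, LinearMap.proj_apply, h, evN_clN,
      ev_tripod, List.length_replicate, opEv_append_of_eq_zero _ _ hl, opEv_tripod_zero,
      List.append_nil, smul_eq_mul]
  exact LinearMap.congr_fun this x

/-- The coefficients of the tensor of a web. -/
def evF (N : ℕ) : WebN N →ₗ[ℂ] ((Fin N → Fin 3) → ℂ) :=
  LinearMap.funLeft ℂ ℂ List.ofFn ∘ₗ evN N

theorem evF_apply (x : WebN N) (c : Fin N → Fin 3) : evF N x c = evN N x (List.ofFn c) := rfl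

theorem ofFn_split {α : Type*} {i k : ℕ} (c : Fin (i + (k + 1 + 1)) → α) :
    List.ofFn c = List.ofFn (fun j : Fin i => c (Fin.castAdd _ j)) ++ c ⟨i, by omega⟩ ::
      c ⟨i + 1, by omega⟩ :: List.ofFn (fun j : Fin k => c ⟨i + (j + 1 + 1), by omega⟩) :=
  List.ofFn_add.trans (congrArg (_ ++ ·) (List.ofFn_succ.trans
    (congrArg (_ :: ·) List.ofFn_succ)))

theorem evF_crs {i : ℕ} (hi : i + 1 < N) (x : WebN N) (c : Fin N → Fin 3) :
    evF N (crs i x) c = evF N x (c ∘ adj i) := by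
  obtain ⟨k, rfl⟩ : ∃ k, N = i + (k + 1 + 1) := ⟨N - i - 2, by omega⟩
  rw [evF_apply, evF_apply, ofFn_split, ofFn_split, evN_crs (by omega) _ _ _ (by simp)]
  have h : ∀ x y : Fin (i + (k + 1 + 1)), y.val = (if x.val = i then i + 1 else
      if x.val = i + 1 then i else x.val) → c y = (c ∘ adj i) x := fun x y hy =>
    congrArg c (Fin.ext (hy.trans (adj_val hi x).symm))
  refine congrArg _ (congrArg₂ _ ?_ ?_)
  · refine congrArg List.ofFn (funext fun j => h _ _ ?_)
    have := j.isLt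
    simp only [Fin.val_castAdd]
    rw [if_neg (by omega), if_neg (by omega)]
  · congr 1
    · exact h _ _ (by simp)
    · congr 1
      · exact h _ _ (by simp)
      · refine congrArg List.ofFn (funext fun j => h _ _ ?_)
        dsimp only
        rw [if_neg (by omega), if_neg (by omega)]

theorem evF_webHom (σ : Equiv.Perm (Fin N)) (x : WebN N) (c : Fin N → Fin 3) :
    evF N (webHom N σ x) c = evF N x (c ∘ σ) := by
  induction σ using adj_induction generalizing c with
  | one => simp
  | mul i σ hi ih =>
    rw [map_mul, Module.End.mul_apply, webHom_adj hi, evF_crs hi, ih]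
    rfl

theorem evF_w0 (n : ℕ) (c : Fin (3 * n) → Fin 3) :
    evF (3 * n) (w0 (3 * n)) c =
      ∏ k : Fin n, (eps (c (point k 0)) (c (point k 1)) (c (point k 2)) : ℂ) := by
  induction n with
  | zero =>
    have h : w0 0 = clN (N := 0) Web.empty := by rw [w0]
    have h' : evN 0 (w0 0) (List.ofFn (n := 0) c) = 1 := by
      rw [h, evN_clN, List.ofFn_zero]
      rfl
    exact h'.trans (by simp)
  | succ n ih =>
    rw [Fin.prod_univ_castSucc, evF_apply]
    have e : List.ofFn c = List.ofFn (fun j : Fin (3 * n) => c (Fin.castAdd 3 j)) ++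
        [c (point (Fin.last n) 0), c (point (Fin.last n) 1), c (point (Fin.last n) 2)] := by
      refine (List.ofFn_add (m := 3) (n := 3 * n) (f := c)).trans (congrArg₂ _ rfl ?_)
      rw [List.ofFn_succ, List.ofFn_succ, List.ofFn_succ, List.ofFn_zero]
      rfl
    rw [e]
    change evN (3 * n + 3) (w0 (3 * n + 3)) _ = _
    rw [w0_add_three, evN_tri_last _ _ (by simp), ← evF_apply, ih, mul_comm]
    rfl

theorem webSpaceEquiv_webZero (n : ℕ) : webSpaceEquiv n (webZero n) = w0 (3 * n) := by
  change clN (tripods n) = w0 (3 * n)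
  induction n with
  | zero =>
    have h : w0 0 = clN (N := 0) Web.empty := by rw [w0]
    exact h.symm
  | succ n ih =>
    refine Eq.trans ?_ (w0_add_three (3 * n)).symm
    rw [← ih]
    apply incl_injective
    change _ = incl (3 * n + 3) (tri (3 * n) _)
    rw [incl_tri, incl_clN, incl_clN]
    exact (op_pic (Piece.tripod true) (outWord n) [] (by simp)
      (by rw [outWord, Nat.mul_succ, List.replicate_add]; simp [List.replicate]) _ (by simp)).symm

end Sl3

namespace Sl3

/-! ### Relations between permuted rows of tripods -/

variable {N : ℕ}

theorem webHom_mul_apply (σ τ : Equiv.Perm (Fin N)) (x : WebN N) :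
    webHom N (σ * τ) x = webHom N σ (webHom N τ x) := by
  rw [map_mul, Module.End.mul_apply]

theorem webHom_inv_apply (σ : Equiv.Perm (Fin N)) (x : WebN N) :
    webHom N σ⁻¹ (webHom N σ x) = x := by
  rw [← webHom_mul_apply, inv_mul_cancel, map_one, Module.End.one_apply]

/-- The `i`-th strand. -/
def fin3 (N : ℕ) (j : Fin 3) : Fin (N + 3) := ⟨j, by omega⟩

theorem adj_zero_eq : (adj 0 : Equiv.Perm (Fin (N + 3))) = Equiv.swap (fin3 N 0) (fin3 N 1) :=
  adj_of_lt (by omega)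

theorem adj_one_eq : (adj 1 : Equiv.Perm (Fin (N + 3))) = Equiv.swap (fin3 N 1) (fin3 N 2) :=
  adj_of_lt (by omega)

theorem webHom_swap_tri_zero {i j : Fin 3} (h : i ≠ j) (y : WebN N) :
    webHom (N + 3) (Equiv.swap (fin3 N i) (fin3 N j)) (tri 0 y) = -tri 0 y := by
  have h01 : webHom (N + 3) (Equiv.swap (fin3 N 0) (fin3 N 1)) (tri 0 y) = -tri 0 y := by
    rw [← adj_zero_eq, webHom_adj (by omega), crs_tri_self 0 y (by omega)]
  have h12 : webHom (N + 3) (Equiv.swap (fin3 N 1) (fin3 N 2)) (tri 0 y) = -tri 0 y := by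
    rw [← adj_one_eq, webHom_adj (by omega), crs_succ_tri 0 y (by omega)]
  have h02 : webHom (N + 3) (Equiv.swap (fin3 N 0) (fin3 N 2)) (tri 0 y) = -tri 0 y := by
    have e : Equiv.swap (fin3 N 0) (fin3 N 2) = Equiv.swap (fin3 N 0) (fin3 N 1) *
        Equiv.swap (fin3 N 1) (fin3 N 2) * Equiv.swap (fin3 N 0) (fin3 N 1) := by
      rw [Equiv.swap_comm (fin3 N 0) (fin3 N 1), Equiv.swap_comm (fin3 N 1) (fin3 N 2),
        Equiv.swap_mul_swap_mul_swap, Equiv.swap_comm] <;> simp [fin3]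
    rw [e, webHom_mul_apply, webHom_mul_apply, h01, map_neg, h12, map_neg, map_neg, h01, neg_neg]
  fin_cases i <;> fin_cases j
  · exact absurd rfl h
  · exact h01
  · exact h02
  · rw [Equiv.swap_comm]; exact h01
  · exact absurd rfl h
  · exact h12
  · rw [Equiv.swap_comm]; exact h02
  · rw [Equiv.swap_comm]; exact h12
  · exact absurd rfl h

/-- This is `tri_exchange` at 0. In each term the crossings multiply to a transposition of the
strand 3 with a leg, up to transpositions of legs, and these account for the alternating signs. -/
theorem tri_zero_eq_sum_three (y : WebN (N + 1)) : tri 0 y = ∑ j,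
    webHom (N + 1 + 3) (Equiv.swap ⟨3, by omega⟩ (fin3 (N + 1) j)) (tri 0 y) := by
  have e2 : (adj 2 : Equiv.Perm (Fin (N + 1 + 3))) = Equiv.swap ⟨3, by omega⟩ (fin3 (N + 1) 2) :=
    (adj_of_lt (by omega)).trans (Equiv.swap_comm _ _)
  have e1 : Equiv.swap ⟨3, by omega⟩ (fin3 (N + 1) 1) =
      adj 1 * adj 2 * Equiv.swap (fin3 (N + 1) 1) (fin3 (N + 1) 2) := by
    rw [e2, adj_one_eq, Equiv.swap_comm (fin3 (N + 1) 1), Equiv.swap_mul_swap_mul_swap,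
      Equiv.swap_comm] <;> simp [fin3]
  have e0 : Equiv.swap ⟨3, by omega⟩ (fin3 (N + 1) 0) =
      adj 0 * Equiv.swap ⟨3, by omega⟩ (fin3 (N + 1) 1) *
        Equiv.swap (fin3 (N + 1) 0) (fin3 (N + 1) 1) := by
    rw [adj_zero_eq, Equiv.swap_comm (fin3 (N + 1) 0), Equiv.swap_mul_swap_mul_swap,
      Equiv.swap_comm] <;> simp [fin3]
  have h := tri_exchange 0 y (by omega)
  rw [← webHom_adj (by omega), ← webHom_adj (by omega), ← webHom_adj (by omega)] at h
  rw [Fin.sum_univ_three, ← e2, e0, e1]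
  simp only [webHom_mul_apply, webHom_swap_tri_zero (show (0 : Fin 3) ≠ 1 by decide),
    webHom_swap_tri_zero (show (1 : Fin 3) ≠ 2 by decide), map_neg, neg_neg]
  nth_rw 1 [← h]
  module

/-- The case of the strand 3 is conjugated by the transposition of 3 and `p`, which preserves the
three legs and so keeps the tripod at the left end. -/
theorem tri_zero_eq_sum (p : Fin (N + 3)) (hp : 3 ≤ p.val) (y : WebN N) : tri 0 y = ∑ j,
    webHom (N + 3) (Equiv.swap p (fin3 N j)) (tri 0 y) := by
  obtain ⟨N, rfl⟩ : ∃ M, N = M + 1 := ⟨N - 1, by omega⟩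
  set t : Fin (N + 1 + 3) := ⟨3, by omega⟩ with ht
  have hg : ∀ x : Fin (N + 1 + 3), (Equiv.swap t p x).val < 3 ↔ x.val < 3 := by
    intro x
    rw [Equiv.swap_apply_def]
    split_ifs with h1 h2
    · subst h1; simp [ht]; omega
    · subst h2; simp [ht]; omega
    · rfl
  obtain ⟨y', hy, -⟩ := exists_webHom_tri_zero hg y
  have h := tri_zero_eq_sum_three y'
  have h2 := congrArg (webHom _ (Equiv.swap t p)⁻¹) h
  rw [← hy, webHom_inv_apply, map_sum] at h2
  refine h2.trans (Finset.sum_congr rfl fun j _ => ?_)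
  rw [← webHom_mul_apply, ← webHom_mul_apply]
  congr 2
  have := Equiv.swap_apply_apply (Equiv.swap t p)⁻¹ t (fin3 (N + 1) j)
  rw [inv_inv] at this
  rw [← ht, ← this, Equiv.swap_inv, Equiv.swap_apply_left, Equiv.swap_apply_of_ne_of_ne]
  · simp [ht, fin3, Fin.ext_iff]; omega
  · simp [fin3, Fin.ext_iff]; omega

theorem exists_w0_eq_tri (n : ℕ) : ∀ k ≤ n, ∃ x : WebN (3 * n), w0 (3 * n + 3) = tri (3 * k) x := by
  induction n with
  | zero =>
    intro k hk
    obtain rfl : k = 0 := by omega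
    exact ⟨_, w0_add_three _⟩
  | succ n ih =>
    intro k hk
    rcases Nat.lt_or_ge n k with h | h
    · obtain rfl : k = n + 1 := by omega
      exact ⟨_, w0_add_three _⟩
    · obtain ⟨x, hx⟩ := ih k h
      refine ⟨tri (3 * n) x, (w0_add_three (3 * n + 3)).trans ?_⟩
      rw [hx, tri_tri (3 * k) (3 * n)]

theorem exists_w0_eq_tri_tri (n : ℕ) : ∀ k ≤ n, ∃ z : WebN (3 * n),
    w0 (3 * n + 3 + 3) = tri (3 * k) (tri (3 * k) z) := by
  induction n with
  | zero =>
    intro k hk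
    obtain rfl : k = 0 := by omega
    refine ⟨w0 _, ?_⟩
    rw [w0_add_three, w0_add_three, tri_tri 0 0]
  | succ n ih =>
    intro k hk
    rcases Nat.lt_or_ge n k with h | h
    · obtain rfl : k = n + 1 := by omega
      refine ⟨w0 _, ?_⟩
      rw [w0_add_three, w0_add_three, tri_tri (3 * (n + 1)) (3 * (n + 1))]
    · obtain ⟨x, hx⟩ := ih k h
      refine ⟨tri (3 * n) x, (w0_add_three (3 * n + 3 + 3)).trans ?_⟩
      rw [hx, tri_tri (3 * k) (3 * n), tri_tri (3 * k) (3 * n + 3)]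

theorem exists_webHom_w0_eq_tri {n : ℕ} (k : Fin (n + 1)) :
    ∃ (h : Equiv.Perm (Fin (3 * n + 3))) (y : WebN (3 * n)),
      webHom (3 * n + 3) h (w0 (3 * n + 3)) = tri 0 y ∧
      ∀ j : Fin 3, h (point k j) = fin3 (3 * n) j := by
  obtain ⟨y, hy⟩ := exists_w0_eq_tri n k (by omega)
  obtain ⟨τ, h1, h2⟩ := exists_webHom_tri (N := 3 * n) (3 * k) (by omega)
  refine ⟨τ⁻¹, y, ?_, fun j => ?_⟩
  · rw [hy, ← h1, webHom_inv_apply]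
  · rw [Equiv.Perm.inv_eq_iff_eq, Fin.ext_iff, h2 _ (by simp [fin3])]
    rfl

/-- The class of the row of tripods with its ends permuted. -/
def forkVec {n : ℕ} (σ : Equiv.Perm (Fin (3 * n))) : WebN (3 * n) := webHom (3 * n) σ (w0 (3 * n))

theorem forkVec_mul {n : ℕ} (σ τ : Equiv.Perm (Fin (3 * n))) :
    forkVec (σ * τ) = webHom (3 * n) σ (forkVec τ) := webHom_mul_apply _ _ _

theorem forkVec_one {n : ℕ} : forkVec (1 : Equiv.Perm (Fin (3 * n))) = w0 (3 * n) := by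
  rw [forkVec, map_one, Module.End.one_apply]

theorem point_inj {n : ℕ} {k k' : Fin n} {j j' : Fin 3} :
    point k j = point k' j' ↔ k = k' ∧ j = j' := by
  simp only [point, Fin.ext_iff]
  omega

/-- The tripod `k` is moved to the left end, where exchanging two of its legs is a sign. -/
theorem forkVec_mul_swap {n : ℕ} (σ : Equiv.Perm (Fin (3 * n))) (k : Fin n) {i j : Fin 3}
    (hij : i ≠ j) : forkVec (σ * Equiv.swap (point k i) (point k j)) = -forkVec σ := by
  rw [← mul_one σ, mul_assoc, forkVec_mul, forkVec_mul σ, ← map_neg, one_mul]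
  congr 1
  obtain ⟨n, rfl⟩ : ∃ m, n = m + 1 := ⟨n - 1, by have := k.isLt; omega⟩
  obtain ⟨h, y, h1, h2⟩ := exists_webHom_w0_eq_tri k
  rw [forkVec_one]
  have e : Equiv.swap (point k i) (point k j) =
      h⁻¹ * Equiv.swap (fin3 (3 * n) i) (fin3 (3 * n) j) * h := by
    have := Equiv.swap_apply_apply h⁻¹ (fin3 (3 * n) i) (fin3 (3 * n) j)
    rw [inv_inv, ← h2, ← h2] at this
    rw [← h2, ← h2, ← this]
    simp
  rw [forkVec, e]
  change webHom (3 * n + 3) _ (w0 (3 * n + 3)) = - w0 (3 * n + 3)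
  rw [webHom_mul_apply, webHom_mul_apply, h1, webHom_swap_tri_zero hij, ← h1, map_neg,
    webHom_inv_apply]

/-- The exchange relation between two blocks. -/
theorem forkVec_eq_sum {n : ℕ} (σ : Equiv.Perm (Fin (3 * n))) {k k' : Fin n} (hk : k ≠ k')
    (i : Fin 3) :
    forkVec σ = ∑ j, forkVec (σ * Equiv.swap (point k i) (point k' j)) := by
  simp only [forkVec_mul]
  rw [← map_sum, forkVec]
  congr 1
  obtain ⟨n, rfl⟩ : ∃ m, n = m + 1 := ⟨n - 1, by have := k.isLt; omega⟩
  obtain ⟨h, y, h1, h2⟩ := exists_webHom_w0_eq_tri k'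
  have hp : 3 ≤ (h (point k i)).val := by
    by_contra hlt
    have : h (point k i) = h (point k' ⟨(h (point k i)).val, by omega⟩) := by
      rw [h2]
      rfl
    exact hk (point_inj.1 (h.injective this)).1
  have h3 := congrArg (webHom _ h⁻¹) (tri_zero_eq_sum _ hp y)
  rw [← h1, webHom_inv_apply, map_sum] at h3
  refine h3.trans (Finset.sum_congr rfl fun j _ => ?_)
  rw [← webHom_mul_apply, ← webHom_mul_apply, ← h2, Equiv.swap_apply_apply h]
  simp only [mul_assoc, inv_mul_cancel, inv_mul_cancel_left, mul_one]
  rfl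

/-- The permutation of the ends which permutes the tripods by `π`. -/
def blockPerm {n : ℕ} (π : Equiv.Perm (Fin n)) : Equiv.Perm (Fin (3 * n)) :=
  (tableauZero n).permCongr (Equiv.prodCongr (Equiv.refl _) π)

theorem tableauZero_symm_point {n : ℕ} (k : Fin n) (j : Fin 3) :
    (tableauZero n).symm (point k j) = (j, k) :=
  (tableauZero n).symm_apply_apply (j, k)

theorem blockPerm_point {n : ℕ} (π : Equiv.Perm (Fin n)) (k : Fin n) (j : Fin 3) :
    blockPerm π (point k j) = point (π k) j := by
  rw [blockPerm, Equiv.permCongr_apply, tableauZero_symm_point]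
  rfl

theorem exists_point {n : ℕ} (p : Fin (3 * n)) : ∃ k j, p = point k j :=
  ⟨((tableauZero n).symm p).2, ((tableauZero n).symm p).1,
    ((tableauZero n).apply_symm_apply p).symm⟩

theorem perm_ext_point {n : ℕ} {σ τ : Equiv.Perm (Fin (3 * n))}
    (h : ∀ k j, σ (point k j) = τ (point k j)) : σ = τ := by
  ext p
  obtain ⟨k, j, rfl⟩ := exists_point p
  rw [h]

theorem blockPerm_mul {n : ℕ} (π π' : Equiv.Perm (Fin n)) :
    blockPerm (π * π') = blockPerm π * blockPerm π' :=
  perm_ext_point fun k j => by simp [blockPerm_point]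

/-- The permutation which slides a tripod below a strand. -/
def adjCycle (i : ℕ) : Equiv.Perm (Fin N) := adj i * (adj (i + 1) * adj (i + 2))

theorem adjCycle_val {i : ℕ} (hi : i + 3 < N) (x : Fin N) :
    x.val = i + 3 ∧ (adjCycle i x).val = i ∨
      (i ≤ x.val ∧ x.val < i + 3) ∧ (adjCycle i x).val = x.val + 1 ∨
      (x.val < i ∨ i + 3 < x.val) ∧ (adjCycle i x).val = x.val := by
  simp only [adjCycle, Equiv.Perm.mul_apply]
  rw [adj_val (by omega), adj_val (by omega), adj_val (by omega)]
  split_ifs <;> omega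

theorem webHom_adjCycle_tri {i : ℕ} (hi : i < N) (x : WebN N) :
    webHom (N + 3) (adjCycle i) (tri i x) = tri (i + 1) x := by
  rw [adjCycle, webHom_mul_apply, webHom_mul_apply, webHom_adj (by omega), webHom_adj (by omega),
    webHom_adj (by omega), crs_crs_crs_tri i x hi]

/-- The left one of two neighbouring tripods slides past the three legs of the other, one leg at a
time. Afterwards `tri_tri` identifies the picture with the original one. -/
theorem forkVec_blockPerm_adj {n i : ℕ} (hi : i + 1 < n) :
    forkVec (blockPerm (adj i : Equiv.Perm (Fin n))) = w0 (3 * n) := by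
  obtain ⟨n, rfl⟩ : ∃ m, n = m + 1 + 1 := ⟨n - 2, by omega⟩
  obtain ⟨z, hz⟩ := exists_w0_eq_tri_tri n i (by omega)
  have e : blockPerm (adj i : Equiv.Perm (Fin (n + 1 + 1))) =
      adjCycle (3 * i + 2) * (adjCycle (3 * i + 1) * adjCycle (3 * i)) := by
    refine perm_ext_point fun k j => Fin.ext ?_
    rw [Equiv.Perm.mul_apply, Equiv.Perm.mul_apply, blockPerm_point]
    have h0 := adjCycle_val (i := 3 * i) (by omega) (point k j)
    generalize adjCycle (3 * i) (point k j) = x at h0 ⊢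
    have h1 := adjCycle_val (i := 3 * i + 1) (by omega) x
    generalize adjCycle (3 * i + 1) x = y at h1 ⊢
    have h2 := adjCycle_val (i := 3 * i + 2) (by omega) y
    generalize adjCycle (3 * i + 2) y = z at h2 ⊢
    have h3 := adj_val hi k
    generalize adj i k = k' at h3 ⊢
    simp only [point] at h0 ⊢
    split_ifs at h3 <;> omega
  rw [e, forkVec]
  change webHom (3 * n + 3 + 3) _ (w0 (3 * n + 3 + 3)) = w0 (3 * n + 3 + 3)
  rw [webHom_mul_apply, webHom_mul_apply, hz]
  rw [webHom_adjCycle_tri (by omega), webHom_adjCycle_tri (by omega),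
    webHom_adjCycle_tri (by omega), ← tri_tri (3 * i) (3 * i)]

theorem forkVec_mul_blockPerm {n : ℕ} (σ : Equiv.Perm (Fin (3 * n))) (π : Equiv.Perm (Fin n)) :
    forkVec (σ * blockPerm π) = forkVec σ := by
  induction π using adj_induction generalizing σ with
  | one =>
    congr 1
    exact perm_ext_point fun k j => by simp [blockPerm_point]
  | mul i π hi ih =>
    rw [blockPerm_mul, ← mul_assoc, ih, forkVec_mul, forkVec_blockPerm_adj hi, forkVec]

end Sl3

namespace Sl3

/-! ### Straightening -/

/-- The weights of the boundary points. -/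
def weight (p : ℕ) : ℚ := (1 / 2) ^ p

theorem weight_pos (p : ℕ) : 0 < weight p := by
  unfold weight
  positivity

/-- Weights at least halve from one point to a later one, so in a change of `spread` the leftmost
affected point decides the sign. -/
theorem two_mul_weight_le {p q : ℕ} (h : p < q) : 2 * weight q ≤ weight p := by
  have h1 : weight q ≤ weight (p + 1) :=
    pow_le_pow_of_le_one (by norm_num) (by norm_num) h
  have h2 : 2 * weight (p + 1) = weight p := by
    unfold weight
    ring
  linarith

/-- The weight of the largest minus the weight of the smallest entry. -/
def spread (x y z : ℕ) : ℚ := weight (max x (max y z)) - weight (min x (min y z))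

/-- The middle entry. -/
def middle (x y z : ℕ) : ℕ := x + y + z - max x (max y z) - min x (min y z)

/-- The product of the middle entry with the sum of the two others, with a negative sign. -/
def nesting (x y z : ℕ) : ℚ := -((middle x y z : ℚ) * (x + y + z - middle x y z))

theorem spread_eq {x y z m M : ℕ} (hm : min x (min y z) = m) (hM : max x (max y z) = M) :
    spread x y z = weight M - weight m := by
  rw [spread, hm, hM]

theorem spread_of_lt {x y z : ℕ} (h : x < y) (h' : y < z) :
    spread x y z = weight z - weight x := spread_eq (by omega) (by omega)

theorem nesting_of_lt {x y z : ℕ} (h : x < y) (h' : y < z) :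
    nesting x y z = -((y : ℚ) * (x + z)) := by
  rw [nesting, show middle x y z = y by unfold middle; omega]
  ring

/-- The pair of blocks on the right is larger than the pair of blocks on the left. -/
def Improves (x y z x' y' z' X Y Z X' Y' Z' : ℕ) : Prop :=
  spread x y z + spread x' y' z' < spread X Y Z + spread X' Y' Z' ∨
    spread x y z + spread x' y' z' = spread X Y Z + spread X' Y' Z' ∧
      nesting x y z + nesting x' y' z' < nesting X Y Z + nesting X' Y' Z'

section

variable {a b c a' b' c' : ℕ}

/-- The blocks trade their smallest entries, which leaves the total spread unchanged, while the
nesting grows by (a' - a)(b' - b). The second statistic exists for this case and for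
`improves_right_two`. -/
theorem improves_left_zero (h1 : a < a') (h2 : a' < b) (h3 : b < b') (h4 : b < c) (h5 : b' < c') :
    Improves a b c a' b' c' a' b c a b' c' := by
  refine Or.inr ⟨?_, ?_⟩
  · rw [spread_of_lt (h1.trans h2) h4, spread_of_lt (h2.trans h3) h5, spread_of_lt h2 h4,
      spread_of_lt (h1.trans (h2.trans h3)) h5]
    ring
  · rw [nesting_of_lt (h1.trans h2) h4, nesting_of_lt (h2.trans h3) h5, nesting_of_lt h2 h4,
      nesting_of_lt (h1.trans (h2.trans h3)) h5]
    have e1 : (a : ℚ) < a' := by exact_mod_cast h1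
    have e2 : (b : ℚ) < b' := by exact_mod_cast h3
    nlinarith [mul_pos (sub_pos.2 e1) (sub_pos.2 e2)]

/-- The minima of the blocks change from a, a' to a, b with a' < b. The gain weight a' - weight b
exceeds any loss at the maxima, which is below weight c. -/
theorem improves_left_one (h1 : a < a') (h2 : a' < b) (h3 : b < b') (h4 : b < c) (h5 : b' < c') :
    Improves a b c a' b' c' b' b c a' a c' := by
  refine Or.inl ?_
  rw [spread_of_lt (h1.trans h2) h4, spread_of_lt (h2.trans h3) h5,
    spread_eq (x := b') (y := b) (z := c) (m := b) (by omega) rfl,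
    spread_eq (x := a') (y := a) (z := c') (m := a) (M := c') (by omega) (by omega)]
  have := two_mul_weight_le h2
  have := two_mul_weight_le h4
  have := weight_pos c
  have := weight_pos (max b' (max b c))
  linarith

theorem improves_left_two (h1 : a < a') (h2 : a' < b) (h3 : b < b') (h4 : b < c) (h5 : b' < c') :
    Improves a b c a' b' c' c' b c a' b' a := by
  refine Or.inl ?_
  rw [spread_of_lt (h1.trans h2) h4, spread_of_lt (h2.trans h3) h5,
    spread_eq (x := c') (y := b) (z := c) (m := b) (by omega) rfl,
    spread_eq (x := a') (y := b') (z := a) (m := a) (M := b') (by omega) (by omega)]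
  have := two_mul_weight_le h2
  have := two_mul_weight_le h4
  have := two_mul_weight_le h5
  have := weight_pos c
  have := weight_pos b
  have := weight_pos c'
  have := weight_pos (max c' (max b c))
  linarith

theorem improves_right_zero (h1 : b < b') (h2 : b' < c) (h3 : c < c') (h4 : a < b) (h5 : a' < b') :
    Improves a b c a' b' c' a b a' c b' c' := by
  refine Or.inl ?_
  rw [spread_of_lt h4 (h1.trans h2), spread_of_lt h5 (h2.trans h3),
    spread_eq (x := c) (y := b') (z := c') (m := b') (M := c') (by omega) (by omega)]
  have := two_mul_weight_le h1
  have := two_mul_weight_le h2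
  have := two_mul_weight_le h4
  have := two_mul_weight_le h5
  have := weight_pos b'
  have := weight_pos b
  have := weight_pos c
  rcases Nat.lt_or_ge a a' with h | h
  · rw [spread_eq (x := a) (y := b) (z := a') (m := a) (by omega) rfl]
    have := weight_pos (max a (max b a'))
    linarith
  · rw [spread_eq (x := a) (y := b) (z := a') (m := a') (M := b) (by omega) (by omega)]
    linarith

theorem improves_right_one (h1 : b < b') (h2 : b' < c) (h3 : c < c') (h4 : a < b) (h5 : a' < b') :
    Improves a b c a' b' c' a b b' a' c c' := by
  refine Or.inl ?_
  rw [spread_of_lt h4 (h1.trans h2), spread_of_lt h5 (h2.trans h3), spread_of_lt h4 h1,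
    spread_of_lt (h5.trans h2) h3]
  have := two_mul_weight_le h2
  have := weight_pos c
  linarith

theorem improves_right_two (h1 : b < b') (h2 : b' < c) (h3 : c < c') (h4 : a < b) (h5 : a' < b') :
    Improves a b c a' b' c' a b c' a' b' c := by
  have h6 := h1.trans (h2.trans h3)
  refine Or.inr ⟨?_, ?_⟩
  · rw [spread_of_lt h4 (h1.trans h2), spread_of_lt h5 (h2.trans h3), spread_of_lt h4 h6,
      spread_of_lt h5 h2]
    ring
  · rw [nesting_of_lt h4 (h1.trans h2), nesting_of_lt h5 (h2.trans h3), nesting_of_lt h4 h6,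
      nesting_of_lt h5 h2]
    have e1 : (b : ℚ) < b' := by exact_mod_cast h1
    have e2 : (c : ℚ) < c' := by exact_mod_cast h3
    nlinarith [mul_pos (sub_pos.2 e1) (sub_pos.2 e2)]

end

variable {n : ℕ}

/-- The position of the end at `point k j`. -/
def pos (σ : Equiv.Perm (Fin (3 * n))) (k : Fin n) (j : Fin 3) : ℕ := (σ (point k j)).val

theorem pos_inj {σ : Equiv.Perm (Fin (3 * n))} {k k' : Fin n} {j j' : Fin 3} :
    pos σ k j = pos σ k' j' ↔ k = k' ∧ j = j' := by
  rw [pos, pos, ← Fin.ext_iff, σ.injective.eq_iff, point_inj]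

theorem pos_mul_swap (σ : Equiv.Perm (Fin (3 * n))) (k k' l : Fin n) (i j m : Fin 3) :
    pos (σ * Equiv.swap (point k i) (point k' j)) l m =
      if l = k ∧ m = i then pos σ k' j else if l = k' ∧ m = j then pos σ k i else pos σ l m := by
  simp only [pos, Equiv.Perm.mul_apply, Equiv.swap_apply_def, point_inj]
  split_ifs <;> rfl

/-- The sum of a function over the blocks. -/
def blockSum (φ : ℕ → ℕ → ℕ → ℚ) (σ : Equiv.Perm (Fin (3 * n))) : ℚ :=
  ∑ k, φ (pos σ k 0) (pos σ k 1) (pos σ k 2)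

theorem blockSum_sub (φ : ℕ → ℕ → ℕ → ℚ) {σ τ : Equiv.Perm (Fin (3 * n))} {k k' : Fin n}
    (hk : k ≠ k') (h : ∀ l m, l ≠ k → l ≠ k' → pos τ l m = pos σ l m) :
    blockSum φ τ - blockSum φ σ =
      (φ (pos τ k 0) (pos τ k 1) (pos τ k 2) + φ (pos τ k' 0) (pos τ k' 1) (pos τ k' 2)) -
      (φ (pos σ k 0) (pos σ k 1) (pos σ k 2) + φ (pos σ k' 0) (pos σ k' 1) (pos σ k' 2)) := by
  rw [blockSum, blockSum, ← Finset.sum_sub_distrib, Fintype.sum_eq_add k k' hk]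
  · ring
  · rintro l ⟨h1, h2⟩
    rw [h l 0 h1 h2, h l 1 h1 h2, h l 2 h1 h2, sub_self]

theorem blockSum_sub_self (φ : ℕ → ℕ → ℕ → ℚ) {σ τ : Equiv.Perm (Fin (3 * n))} {k : Fin n}
    (h : ∀ l m, l ≠ k → pos τ l m = pos σ l m) :
    blockSum φ τ - blockSum φ σ =
      φ (pos τ k 0) (pos τ k 1) (pos τ k 2) - φ (pos σ k 0) (pos σ k 1) (pos σ k 2) := by
  rw [blockSum, blockSum, ← Finset.sum_sub_distrib, Fintype.sum_eq_single k]
  intro l h1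
  rw [h l 0 h1, h l 1 h1, h l 2 h1, sub_self]

/-- The order of straightening. -/
def rank (σ : Equiv.Perm (Fin (3 * n))) : ℚ ×ₗ ℚ ×ₗ ℚ :=
  toLex (blockSum spread σ, toLex (blockSum nesting σ, blockSum (fun _ y z => y + 2 * z) σ))

theorem rank_lt {σ τ : Equiv.Perm (Fin (3 * n))} (h : blockSum spread σ < blockSum spread τ ∨
    blockSum spread σ = blockSum spread τ ∧ (blockSum nesting σ < blockSum nesting τ ∨
      blockSum nesting σ = blockSum nesting τ ∧
      blockSum (fun _ y z => y + 2 * z) σ < blockSum (fun _ y z => y + 2 * z) τ)) :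
    rank σ < rank τ := by
  rw [rank, rank, Prod.Lex.toLex_lt_toLex]
  refine h.imp_right (And.imp_right fun h => ?_)
  rw [Prod.Lex.toLex_lt_toLex]
  exact h

theorem rank_lt_of_improves {σ : Equiv.Perm (Fin (3 * n))} {k k' : Fin n} (hk : k ≠ k')
    (i j : Fin 3) {τ : Equiv.Perm (Fin (3 * n))}
    (hτ : τ = σ * Equiv.swap (point k i) (point k' j))
    (h : Improves (pos σ k 0) (pos σ k 1) (pos σ k 2) (pos σ k' 0) (pos σ k' 1) (pos σ k' 2)
      (pos τ k 0) (pos τ k 1) (pos τ k 2) (pos τ k' 0) (pos τ k' 1) (pos τ k' 2)) :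
    rank σ < rank τ := by
  have hs : ∀ φ, _ := fun φ => blockSum_sub φ (σ := σ) (τ := τ) hk (by
    intro l m h1 h2
    rw [hτ, pos_mul_swap, if_neg (fun h => h1 h.1), if_neg (fun h => h2 h.1)])
  have h1 := hs spread
  have h2 := hs nesting
  refine rank_lt ?_
  rcases h with h | ⟨h, h'⟩
  · left; linarith
  · exact Or.inr ⟨by linarith, Or.inl (by linarith)⟩

/-- The span of the M-diagrams. -/
def mSpan (n : ℕ) : Submodule ℂ (WebN (3 * n)) :=
  Submodule.span ℂ {x | ∃ τ : Equiv.Perm (Fin (3 * n)),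
    IsForkPerm τ ∧ PartialNonCrossing (arcs τ) ∧ x = forkVec τ}

theorem isForkPerm_iff {σ : Equiv.Perm (Fin (3 * n))} :
    IsForkPerm σ ↔ ∀ k, pos σ k 0 < pos σ k 1 ∧ pos σ k 1 < pos σ k 2 := by
  refine forall_congr' fun k => ?_
  rw [Fin.strictMono_iff_lt_succ, Fin.forall_fin_two]
  rfl

/-! ### Every rewriting step raises the rank. -/

theorem exists_rank_lt_of_not_isForkPerm {σ : Equiv.Perm (Fin (3 * n))} (h : ¬ IsForkPerm σ) :
    ∃ τ, rank σ < rank τ ∧ forkVec σ = - forkVec τ := by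
  rw [isForkPerm_iff] at h
  push Not at h
  obtain ⟨k, hk⟩ := h
  -- `spread` and `nesting` are symmetric in the three entries of a block, so sorting a tripod is
  -- detected only by the third component of the rank.
  have key : ∀ i j : Fin 3, i ≠ j → ∀ τ, τ = σ * Equiv.swap (point k i) (point k j) →
      (∀ φ : ℕ → ℕ → ℕ → ℚ, (∀ x y z, φ x y z = φ y x z) → (∀ x y z, φ x y z = φ x z y) →
        φ (pos τ k 0) (pos τ k 1) (pos τ k 2) = φ (pos σ k 0) (pos σ k 1) (pos σ k 2)) →
      pos σ k 1 + 2 * pos σ k 2 < pos τ k 1 + 2 * pos τ k 2 →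
      rank σ < rank τ ∧ forkVec σ = - forkVec τ := by
    intro i j hij τ hτ hφ hR
    have hs : ∀ φ, _ := fun φ => blockSum_sub_self φ (σ := σ) (τ := τ) (k := k) (by
      intro l m h1
      rw [hτ, pos_mul_swap, if_neg (fun h => h1 h.1), if_neg (fun h => h1 h.1)])
    refine ⟨rank_lt (Or.inr ⟨?_, Or.inr ⟨?_, ?_⟩⟩), ?_⟩
    · have h1 := hs spread
      rw [hφ spread] at h1
      · linarith
      · intro x y z
        rw [spread, spread, max_left_comm, min_left_comm]
      · intro x y z
        rw [spread, spread, max_comm y, min_comm y]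
    · have h1 := hs nesting
      rw [hφ nesting] at h1
      · linarith
      · intro x y z
        rw [nesting, nesting, show middle x y z = middle y x z by unfold middle; omega]
        ring
      · intro x y z
        rw [nesting, nesting, show middle x y z = middle x z y by unfold middle; omega]
        ring
    · have h1 := hs (fun _ y z => y + 2 * z)
      have h2 : (pos σ k 1 : ℚ) + 2 * pos σ k 2 < pos τ k 1 + 2 * pos τ k 2 := by exact_mod_cast hR
      dsimp only at h1
      linarith
    · rw [hτ, forkVec_mul_swap σ k hij, neg_neg]
  by_cases h0 : pos σ k 0 < pos σ k 1
  · have h1 : pos σ k 2 < pos σ k 1 := lt_of_le_of_ne (hk h0) fun e => by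
      simpa using (pos_inj.1 e).2
    refine ⟨_, key 1 2 (by decide) _ rfl (fun φ h1 h2 => ?_) ?_⟩
    · simp [pos_mul_swap]
      exact h2 _ _ _
    · simp [pos_mul_swap]
      omega
  · have h1 : pos σ k 1 < pos σ k 0 := lt_of_le_of_ne (not_lt.1 h0) fun e => by
      simpa using (pos_inj.1 e).2
    refine ⟨_, key 0 1 (by decide) _ rfl (fun φ h1 h2 => ?_) ?_⟩
    · simp [pos_mul_swap]
      exact h1 _ _ _
    · simp [pos_mul_swap]
      omega

theorem exists_crossing_of_not {σ : Equiv.Perm (Fin (3 * n))}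
    (h : ¬ PartialNonCrossing (arcs σ)) : ∃ k k',
      (pos σ k 0 < pos σ k' 0 ∧ pos σ k' 0 < pos σ k 1 ∧ pos σ k 1 < pos σ k' 1) ∨
      (pos σ k 1 < pos σ k' 1 ∧ pos σ k' 1 < pos σ k 2 ∧ pos σ k 2 < pos σ k' 2) := by
  by_contra hc
  refine h fun x hx y hy => ?_
  simp only [arcs, Finset.mem_image, Finset.mem_univ, true_and] at hx hy
  obtain ⟨k, rfl⟩ := hx
  obtain ⟨k', rfl⟩ := hy
  exact ⟨fun h => hc ⟨k, k', Or.inl h⟩, fun h => hc ⟨k, k', Or.inr h⟩⟩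

/-- For crossing left arcs the left end of `k` is exchanged with every end of `k'`; for crossing
right arcs the right end is used. In both cases all three terms of the exchange relation have larger
rank. -/
theorem exists_rank_lt_of_crossing {σ : Equiv.Perm (Fin (3 * n))} (hf : IsForkPerm σ)
    (h : ¬ PartialNonCrossing (arcs σ)) :
    ∃ τ : Fin 3 → Equiv.Perm (Fin (3 * n)), (∀ j, rank σ < rank (τ j)) ∧
      forkVec σ = ∑ j, forkVec (τ j) := by
  obtain ⟨k, k', h⟩ := exists_crossing_of_not h
  rw [isForkPerm_iff] at hf
  obtain ⟨f1, f2⟩ := hf k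
  obtain ⟨f3, f4⟩ := hf k'
  rcases h with ⟨h1, h2, h3⟩ | ⟨h1, h2, h3⟩
  · have hk : k ≠ k' := by
      rintro rfl
      exact h1.ne rfl
    refine ⟨_, fun j => rank_lt_of_improves hk 0 j rfl ?_, forkVec_eq_sum σ hk 0⟩
    fin_cases j <;> simp [pos_mul_swap, hk, hk.symm]
    · exact improves_left_zero h1 h2 h3 f2 f4
    · exact improves_left_one h1 h2 h3 f2 f4
    · exact improves_left_two h1 h2 h3 f2 f4
  · have hk : k ≠ k' := by
      rintro rfl
      exact h1.ne rfl
    refine ⟨_, fun j => rank_lt_of_improves hk 2 j rfl ?_, forkVec_eq_sum σ hk 2⟩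
    fin_cases j <;> simp [pos_mul_swap, hk, hk.symm]
    · exact improves_right_zero h1 h2 h3 f1 f3
    · exact improves_right_one h1 h2 h3 f1 f3
    · exact improves_right_two h1 h2 h3 f1 f3

theorem forkVec_mem_mSpan (σ : Equiv.Perm (Fin (3 * n))) : forkVec σ ∈ mSpan n := by
  -- There are finitely many permutations, so ranks cannot increase forever.
  have wf : WellFounded fun τ σ : Equiv.Perm (Fin (3 * n)) => rank σ < rank τ := by
    have : IsTrans (Equiv.Perm (Fin (3 * n))) fun τ σ => rank σ < rank τ :=
      ⟨fun _ _ _ h h' => h'.trans h⟩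
    have : Std.Irrefl fun τ σ : Equiv.Perm (Fin (3 * n)) => rank σ < rank τ :=
      ⟨fun _ => lt_irrefl _⟩
    exact Finite.wellFounded_of_trans_of_irrefl _
  induction σ using wf.induction with
  | _ σ ih =>
  by_cases hf : IsForkPerm σ
  · by_cases hc : PartialNonCrossing (arcs σ)
    · exact Submodule.subset_span ⟨σ, hf, hc, rfl⟩
    · obtain ⟨τ, h1, h2⟩ := exists_rank_lt_of_crossing hf hc
      rw [h2]
      exact Submodule.sum_mem _ fun j _ => ih _ (h1 j)
  · obtain ⟨τ, h1, h2⟩ := exists_rank_lt_of_not_isForkPerm hf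
    rw [h2]
    exact Submodule.neg_mem _ (ih τ h1)

theorem mSpan_eq_top (n : ℕ) : mSpan n = ⊤ := by
  refine top_unique ?_
  rw [← tripodSpan_eq_top (3 * n), tripodSpan, Submodule.span_le]
  rintro _ ⟨σ, rfl⟩
  exact forkVec_mem_mSpan σ

end Sl3

namespace Sl3

/-! ### Independence of the M-diagrams -/

variable {n : ℕ}

/-- Noncrossing matchings with the same left ends and the same right ends are equal. -/
theorem matching_unique {ι : Type*} {x y x' y' : ι → ℕ} (hx : ∀ k, ∃ l, x k = x' l)
    (hx' : ∀ l, ∃ k, x' l = x k) (hy : ∀ k, ∃ l, y k = y' l) (hy' : ∀ l, ∃ k, y' l = y k)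
    (ix : x.Injective) (iy : y.Injective) (ix' : x'.Injective) (iy' : y'.Injective)
    (hxy : ∀ k, x k < y k) (hxy' : ∀ l, x' l < y' l)
    (h : ∀ k r, ¬ (x k < x r ∧ x r < y k ∧ y k < y r))
    (h' : ∀ k r, ¬ (x' k < x' r ∧ x' r < y' k ∧ y' k < y' r)) {k l : ι} (hkl : y k = y' l) :
    x k = x' l := by
  induction hm : y k using Nat.strong_induction_on generalizing k l with
  | _ m ih =>
  subst hm
  by_contra hne
  rcases lt_or_gt_of_ne hne with hlt | hlt
  -- The point x' l lies between x k and y k, and y r is its partner in the first matching. If y r <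
  -- y k, the induction hypothesis pairs x' l with y r in the second matching too, which contradicts
  -- y' l = y k. If y r > y k, the arcs k and r cross.
  · obtain ⟨r, hr⟩ := hx' l
    have hrk : y r ≠ y k := fun e => by
      rw [iy e] at hr
      exact hne hr.symm
    rcases lt_or_gt_of_ne hrk with h1 | h1
    · obtain ⟨s, hs⟩ := hy r
      have := ih _ h1 hs rfl
      rw [← hr] at this
      rw [← ix' this, ← hkl] at hs
      exact hrk hs
    · exact h k r ⟨by omega, by have := hxy' l; omega, h1⟩
  · obtain ⟨r, hr⟩ := hx k
    have hrl : y' r ≠ y' l := fun e => by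
      rw [iy' e] at hr
      exact hne hr
    rcases lt_or_gt_of_ne hrl with h1 | h1
    · obtain ⟨s, hs⟩ := hy' r
      have := ih (y s) (by omega) hs.symm rfl
      rw [← hr] at this
      rw [ix this] at hs
      exact hrl (hs.trans hkl)
    · exact h' l r ⟨by omega, by have := hxy k; omega, h1⟩

theorem PartialNonCrossing.left {σ : Equiv.Perm (Fin (3 * n))} (h : PartialNonCrossing (arcs σ))
    (k r : Fin n) : ¬ (pos σ k 0 < pos σ r 0 ∧ pos σ r 0 < pos σ k 1 ∧ pos σ k 1 < pos σ r 1) :=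
  (h _ (Finset.mem_image_of_mem _ (Finset.mem_univ k)) _
    (Finset.mem_image_of_mem _ (Finset.mem_univ r))).1

theorem PartialNonCrossing.right {σ : Equiv.Perm (Fin (3 * n))} (h : PartialNonCrossing (arcs σ))
    (k r : Fin n) : ¬ (pos σ k 1 < pos σ r 1 ∧ pos σ r 1 < pos σ k 2 ∧ pos σ k 2 < pos σ r 2) :=
  (h _ (Finset.mem_image_of_mem _ (Finset.mem_univ k)) _
    (Finset.mem_image_of_mem _ (Finset.mem_univ r))).2

/-- The row of a boundary point in a tabloid. -/
def row (t : Tabloid n) : Fin (3 * n) → Fin 3 :=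
  Quotient.lift (fun (T : Tableau n) p => (T.symm p).1) (fun _ _ h => h) t

theorem row_injective : Function.Injective (row (n := n)) := by
  intro t t' h
  induction t using Quotient.inductionOn
  induction t' using Quotient.inductionOn
  exact Quotient.sound h

theorem row_smul (σ : Equiv.Perm (Fin (3 * n))) (t : Tabloid n) (p : Fin (3 * n)) :
    row (σ • t) (σ p) = row t p := by
  induction t using Quotient.inductionOn with
  | _ T =>
  change ((T.trans σ).symm (σ p)).1 = (T.symm p).1
  simp

/-- The tabloid whose rows contain the left, middle and right ends of the arcs. -/
def leading (σ : Equiv.Perm (Fin (3 * n))) : Tabloid n := Tabloid.mk ((tableauZero n).trans σ)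

theorem row_leading (σ : Equiv.Perm (Fin (3 * n))) (k : Fin n) (j : Fin 3) :
    row (leading σ) (σ (point k j)) = j := by
  change ((tableauZero n).symm (σ.symm (σ (point k j)))).1 = j
  rw [Equiv.symm_apply_apply, tableauZero_symm_point]

theorem exists_pos_eq {σ τ : Equiv.Perm (Fin (3 * n))} (h : leading σ = leading τ) (k : Fin n)
    (j : Fin 3) : ∃ l, pos σ k j = pos τ l j := by
  obtain ⟨l, i, hl⟩ := exists_point (τ.symm (σ (point k j)))
  rw [Equiv.symm_apply_eq] at hl
  have h1 := row_leading σ k j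
  rw [h, hl, row_leading] at h1
  subst h1
  exact ⟨l, congrArg Fin.val hl⟩

/-- Equal tabloids mean equal sets of left, of middle and of right ends. The left arcs and the right
arcs are noncrossing matchings, each determined by its ends, and they are glued at the middle ends.
-/
theorem arcs_subset_of_leading_eq {σ τ : Equiv.Perm (Fin (3 * n))} (h : leading σ = leading τ)
    (hσ : IsForkPerm σ) (hτ : IsForkPerm τ) (cσ : PartialNonCrossing (arcs σ))
    (cτ : PartialNonCrossing (arcs τ)) : arcs σ ⊆ arcs τ := by
  have inj : ∀ (σ : Equiv.Perm (Fin (3 * n))) (j : Fin 3), Function.Injective fun k => pos σ k j :=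
    fun σ j k l e => (pos_inj.1 e).1
  rw [isForkPerm_iff] at hσ hτ
  have left : ∀ {k l}, pos σ k 1 = pos τ l 1 → pos σ k 0 = pos τ l 0 := fun {k l} e =>
    matching_unique (x := fun k => pos σ k 0) (y := fun k => pos σ k 1) (x' := fun k => pos τ k 0)
      (y' := fun k => pos τ k 1) (exists_pos_eq h · 0) (exists_pos_eq h.symm · 0)
      (exists_pos_eq h · 1) (exists_pos_eq h.symm · 1) (inj σ 0) (inj σ 1) (inj τ 0) (inj τ 1)
      (fun k => (hσ k).1) (fun k => (hτ k).1) cσ.left cτ.left e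
  have right : ∀ {k l}, pos σ k 2 = pos τ l 2 → pos σ k 1 = pos τ l 1 := fun {k l} e =>
    matching_unique (x := fun k => pos σ k 1) (y := fun k => pos σ k 2) (x' := fun k => pos τ k 1)
      (y' := fun k => pos τ k 2) (exists_pos_eq h · 1) (exists_pos_eq h.symm · 1)
      (exists_pos_eq h · 2) (exists_pos_eq h.symm · 2) (inj σ 1) (inj σ 2) (inj τ 1) (inj τ 2)
      (fun k => (hσ k).2) (fun k => (hτ k).2) cσ.right cτ.right e
  intro x hx
  simp only [arcs, Finset.mem_image, Finset.mem_univ, true_and] at hx ⊢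
  obtain ⟨k, rfl⟩ := hx
  obtain ⟨l, h2⟩ := exists_pos_eq h k 2
  have h1 := right h2
  have h0 := left h1
  exact ⟨l, by rw [Fin.ext h0, Fin.ext h1, Fin.ext h2]⟩

theorem arcs_eq_of_leading_eq {σ τ : Equiv.Perm (Fin (3 * n))} (h : leading σ = leading τ)
    (hσ : IsForkPerm σ) (hτ : IsForkPerm τ) (cσ : PartialNonCrossing (arcs σ))
    (cτ : PartialNonCrossing (arcs τ)) : arcs σ = arcs τ :=
  (arcs_subset_of_leading_eq h hσ hτ cσ cτ).antisymm
    (arcs_subset_of_leading_eq h.symm hτ hσ cτ cσ)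

instance : Finite (Tabloid n) := Quotient.finite _

/-- The combination of tabloids defined by the tensor of a web. -/
def tabloidMap (n : ℕ) : WebN (3 * n) →ₗ[ℂ] (Tabloid n →₀ ℂ) :=
  (Finsupp.linearEquivFunOnFinite ℂ ℂ (Tabloid n)).symm.toLinearMap ∘ₗ
    LinearMap.funLeft ℂ ℂ row ∘ₗ evF (3 * n)

theorem tabloidMap_apply (x : WebN (3 * n)) (t : Tabloid n) :
    tabloidMap n x t = evF (3 * n) x (row t) := rfl

theorem tabloidMap_webHom (σ : Equiv.Perm (Fin (3 * n))) (x : WebN (3 * n)) :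
    tabloidMap n (webHom (3 * n) σ x) = permTabloids σ (tabloidMap n x) := by
  ext t
  obtain ⟨s, rfl⟩ : ∃ s, t = σ • s := ⟨σ⁻¹ • t, by rw [smul_inv_smul]⟩
  rw [permTabloids, Finsupp.lmapDomain_apply, Finsupp.mapDomain_apply (MulAction.injective σ),
    tabloidMap_apply, tabloidMap_apply, evF_webHom]
  exact congrArg _ (funext fun p => row_smul σ s p)

theorem tabloidMap_forkVec (σ : Equiv.Perm (Fin (3 * n))) (t : Tabloid n) :
    tabloidMap n (forkVec σ) t = ∏ k : Fin n, (eps (row t (σ (point k 0)))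
      (row t (σ (point k 1))) (row t (σ (point k 2))) : ℂ) := by
  rw [tabloidMap_apply, forkVec, evF_webHom, evF_w0]
  rfl

theorem tabloidMap_forkVec_leading (σ : Equiv.Perm (Fin (3 * n))) :
    tabloidMap n (forkVec σ) (leading σ) = 1 := by
  rw [tabloidMap_forkVec]
  refine Finset.prod_eq_one fun k _ => ?_
  rw [row_leading, row_leading, row_leading]
  have : eps 0 1 2 = 1 := by decide
  rw [this, Int.cast_one]

/-- The order of the tabloids. -/
def height (t : Tabloid n) : ℕ := ∑ p : Fin (3 * n), p * row t p

theorem height_eq_sum (t : Tabloid n) (σ : Equiv.Perm (Fin (3 * n))) :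
    height t = ∑ k, (pos σ k 0 * row t (σ (point k 0)) + pos σ k 1 * row t (σ (point k 1)) +
      pos σ k 2 * row t (σ (point k 2))) := by
  rw [height, ← Equiv.sum_comp ((tableauZero n).trans σ), Fintype.sum_prod_type_right]
  refine Finset.sum_congr rfl fun k _ => ?_
  rw [Fin.sum_univ_three]
  rfl

theorem eps_ne_zero : ∀ i j k : Fin 3, eps i j k ≠ 0 →
    (i = 0 ∧ j = 1 ∧ k = 2) ∨ (i = 0 ∧ j = 2 ∧ k = 1) ∨ (i = 1 ∧ j = 0 ∧ k = 2) ∨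
    (i = 1 ∧ j = 2 ∧ k = 0) ∨ (i = 2 ∧ j = 0 ∧ k = 1) ∨ (i = 2 ∧ j = 1 ∧ k = 0) := by decide

/-- The rearrangement inequality for the colors 0, 1, 2 on one arc, with its case of equality. -/
theorem sum_mul_le_of_eps_ne_zero {i j k : Fin 3} (h : eps i j k ≠ 0) {x y z : ℕ} (hxy : x < y)
    (hyz : y < z) : x * i + y * j + z * k ≤ y + 2 * z ∧
      (x * i + y * j + z * k = y + 2 * z → i = 0 ∧ j = 1 ∧ k = 2) := by
  rcases eps_ne_zero i j k h with ⟨rfl, rfl, rfl⟩ | ⟨rfl, rfl, rfl⟩ | ⟨rfl, rfl, rfl⟩ |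
    ⟨rfl, rfl, rfl⟩ | ⟨rfl, rfl, rfl⟩ | ⟨rfl, rfl, rfl⟩ <;> simp <;> omega

/-- A nonzero coefficient forces three distinct colors on every arc. The height is then maximal
exactly when the colors increase from left to right on each arc, which characterizes the leading
tabloid. -/
theorem height_le_of_ne_zero {σ : Equiv.Perm (Fin (3 * n))} (hσ : IsForkPerm σ) {t : Tabloid n}
    (h : tabloidMap n (forkVec σ) t ≠ 0) :
    height t ≤ height (leading σ) ∧ (height t = height (leading σ) → t = leading σ) := by
  rw [isForkPerm_iff] at hσ
  rw [tabloidMap_forkVec, Finset.prod_ne_zero_iff] at h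
  have key := fun k => sum_mul_le_of_eps_ne_zero
    (fun h0 => h k (Finset.mem_univ k) (by rw [h0, Int.cast_zero])) (hσ k).1 (hσ k).2
  have hlead : height (leading σ) = ∑ k, (pos σ k 1 + 2 * pos σ k 2) := by
    rw [height_eq_sum _ σ]
    refine Finset.sum_congr rfl fun k _ => ?_
    rw [row_leading, row_leading, row_leading]
    simp [mul_comm]
  rw [hlead, height_eq_sum t σ]
  refine ⟨Finset.sum_le_sum fun k _ => (key k).1, fun heq => row_injective (funext fun p => ?_)⟩
  rw [Finset.sum_eq_sum_iff_of_le fun k _ => (key k).1] at heq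
  obtain ⟨k, j, hp⟩ := exists_point (σ.symm p)
  rw [Equiv.symm_apply_eq] at hp
  obtain ⟨h0, h1, h2⟩ := (key k).2 (heq k (Finset.mem_univ k))
  rw [hp, row_leading]
  fin_cases j
  · exact h0
  · exact h1
  · exact h2

/-- The permutations differ by a permutation of whole tripods on the right, and
`forkVec_mul_blockPerm` shows that this has no effect. -/
theorem forkVec_eq_of_arcs_eq {σ τ : Equiv.Perm (Fin (3 * n))} (h : arcs σ = arcs τ) :
    forkVec σ = forkVec τ := by
  have h1 : ∀ k, ∃ l, ∀ j, τ (point k j) = σ (point l j) := by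
    intro k
    have hk : (τ (point k 0), τ (point k 1), τ (point k 2)) ∈ arcs σ := by
      rw [h]
      exact Finset.mem_image_of_mem _ (Finset.mem_univ k)
    simp only [arcs, Finset.mem_image, Finset.mem_univ, true_and, Prod.mk.injEq] at hk
    obtain ⟨l, h0, h1, h2⟩ := hk
    refine ⟨l, fun j => ?_⟩
    fin_cases j
    · exact h0.symm
    · exact h1.symm
    · exact h2.symm
  choose f hf using h1
  have inj : Function.Injective f := by
    intro k l e
    have := hf k 0
    rw [e, ← hf l 0] at this
    exact (point_inj.1 (τ.injective this)).1
  have e : τ = σ * blockPerm (Equiv.ofBijective f (Finite.injective_iff_bijective.1 inj)) :=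
    perm_ext_point fun k j => by
      rw [Equiv.Perm.mul_apply, blockPerm_point, hf]
      rfl
  rw [e, forkVec_mul_blockPerm]

/-- A permutation which defines the M-diagram. -/
def mPerm (m : MDiagram n) : Equiv.Perm (Fin (3 * n)) := m.2.1.choose

theorem mPerm_isForkPerm (m : MDiagram n) : IsForkPerm (mPerm m) := m.2.1.choose_spec.1

theorem arcs_mPerm (m : MDiagram n) : arcs (mPerm m) = m.1 := m.2.1.choose_spec.2

theorem mPerm_partialNonCrossing (m : MDiagram n) : PartialNonCrossing (arcs (mPerm m)) := by
  rw [arcs_mPerm]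
  exact m.2.2

/-- Unitriangularity: among the diagrams with nonzero coefficient in a relation, one is chosen whose
leading tabloid is highest. Any other that contained this tabloid would have it as its own leading
tabloid, hence the same arcs. -/
theorem linearIndependent_tabloidMap (n : ℕ) :
    LinearIndependent ℂ fun m : MDiagram n => tabloidMap n (forkVec (mPerm m)) := by
  rw [linearIndependent_iff']
  intro s g hg
  by_contra hne
  push Not at hne
  obtain ⟨m0, hm0, hg0⟩ := hne
  obtain ⟨m, hm, hmax⟩ := Finset.exists_max_image (s.filter fun m => g m ≠ 0)
    (fun m => height (leading (mPerm m))) ⟨m0, by simp [hm0, hg0]⟩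
  rw [Finset.mem_filter] at hm
  refine hm.2 ?_
  have h := DFunLike.congr_fun hg (leading (mPerm m))
  rw [Finsupp.finsetSum_apply, Finset.sum_eq_single m, Finsupp.smul_apply,
    tabloidMap_forkVec_leading, smul_eq_mul, mul_one] at h
  · exact h
  · intro m' hm' hmm
    rw [Finsupp.smul_apply]
    by_contra hne
    have h1 : g m' ≠ 0 := fun e => hne (by rw [e, zero_smul])
    have h2 : tabloidMap n (forkVec (mPerm m')) (leading (mPerm m)) ≠ 0 :=
      fun e => hne (by rw [e, smul_zero])
    have h3 := height_le_of_ne_zero (mPerm_isForkPerm m') h2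
    have h4 := h3.2 (h3.1.antisymm (hmax m' (by simp [hm', h1])))
    refine hmm (Subtype.ext ?_)
    rw [← arcs_mPerm, ← arcs_mPerm]
    exact arcs_eq_of_leading_eq h4.symm (mPerm_isForkPerm _) (mPerm_isForkPerm _)
      (mPerm_partialNonCrossing _) (mPerm_partialNonCrossing _)
  · intro h
    exact absurd hm.1 h

/-! ### The basis of M-diagrams and the faithfulness of the evaluation. -/

theorem span_forkVec_mPerm (n : ℕ) :
    Submodule.span ℂ (Set.range fun m : MDiagram n => forkVec (mPerm m)) = ⊤ := by
  rw [← mSpan_eq_top]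
  refine le_antisymm (Submodule.span_le.2 ?_) (Submodule.span_le.2 ?_)
  · rintro _ ⟨m, rfl⟩
    exact Submodule.subset_span ⟨_, mPerm_isForkPerm m, mPerm_partialNonCrossing m, rfl⟩
  · rintro _ ⟨τ, h1, h2, rfl⟩
    refine Submodule.subset_span ⟨(⟨arcs τ, ⟨τ, h1, rfl⟩, h2⟩ : MDiagram n), ?_⟩
    exact forkVec_eq_of_arcs_eq (arcs_mPerm _)

/-- The basis of M-diagrams. -/
def mBasis (n : ℕ) : Module.Basis (MDiagram n) ℂ (WebN (3 * n)) :=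
  Module.Basis.mk (LinearIndependent.of_comp (tabloidMap n) (linearIndependent_tabloidMap n))
    (span_forkVec_mPerm n).ge

theorem mBasis_apply (m : MDiagram n) : mBasis n m = forkVec (mPerm m) :=
  Module.Basis.mk_apply _ _ m

/-- A basis is mapped to an independent family. Faithfulness of the evaluation is thus a consequence
of straightening and needs no separate invariant theory. -/
theorem tabloidMap_injective (n : ℕ) : Function.Injective (tabloidMap n) := by
  have h := linearIndependent_tabloidMap n
  have e : (fun m : MDiagram n => tabloidMap n (forkVec (mPerm m))) = tabloidMap n ∘ mBasis n :=
    funext fun m => congrArg _ (mBasis_apply m).symm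
  rw [e] at h
  have h2 := Module.Basis.injective_constr_of_linearIndependent (R₂ := ℂ) (mBasis n) h
  rwa [show (mBasis n).constr ℂ (tabloidMap n ∘ mBasis n) = tabloidMap n from
    (mBasis n).constr_self ℂ _] at h2

end Sl3

namespace Sl3

/-! ### The Specht module -/

variable {n : ℕ}

open Equiv

/-- The permutation which acts by `f k` on the `k`-th column. -/
def columnPerm (f : Fin n → Perm (Fin 3)) : Perm (Fin (3 * n)) :=
  (tableauZero n).permCongr (prodCongrLeft f)

theorem columnPerm_point (f : Fin n → Perm (Fin 3)) (k : Fin n) (j : Fin 3) :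
    columnPerm f (point k j) = point k (f k j) := by
  rw [columnPerm, permCongr_apply, tableauZero_symm_point]
  rfl

theorem sign_columnPerm (f : Fin n → Perm (Fin 3)) :
    Perm.sign (columnPerm f) = ∏ k, Perm.sign (f k) := by
  rw [columnPerm, Perm.sign_permCongr, Perm.sign_prodCongrLeft]

theorem columnPerm_injective : Function.Injective (columnPerm (n := n)) := by
  intro f g h
  funext k
  ext j : 1
  have := congrArg (· (point k j)) h
  simp only [columnPerm_point, point_inj, true_and] at this
  exact this

theorem isColumnStabilizer_columnPerm (f : Fin n → Perm (Fin 3)) :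
    IsColumnStabilizer (tableauZero n) (columnPerm f) := by
  intro p
  obtain ⟨k, j, rfl⟩ := exists_point p
  rw [columnPerm_point, tableauZero_symm_point, tableauZero_symm_point]

theorem exists_columnPerm {σ : Perm (Fin (3 * n))}
    (h : IsColumnStabilizer (tableauZero n) σ) : ∃ f, columnPerm f = σ := by
  have h1 : ∀ k j, ∃ i, σ (point k j) = point k i := by
    intro k j
    obtain ⟨l, i, hl⟩ := exists_point (σ (point k j))
    have := h (point k j)
    rw [hl, tableauZero_symm_point, tableauZero_symm_point] at this
    dsimp only at this
    subst this
    exact ⟨i, hl⟩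
  choose f hf using h1
  have inj : ∀ k, Function.Injective (f k) := by
    intro k i j e
    have := hf k i
    rw [e, ← hf k j] at this
    exact (point_inj.1 (σ.injective this)).2
  refine ⟨fun k => ofBijective (f k) (Finite.injective_iff_bijective.1 (inj k)),
    perm_ext_point fun k j => ?_⟩
  rw [columnPerm_point, hf]
  rfl

/-- The Leibniz formula: the only contributing `g` is the inverse of `c`, which has the same sign,
and there is none if `c` is not bijective. -/
theorem sum_sign_eq_eps : ∀ c : Fin 3 → Fin 3,
    ∑ g : Perm (Fin 3), (if ∀ j, c (g j) = j then (Perm.sign g : ℤ) else 0) =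
      eps (c 0) (c 1) (c 2) := by
  decide +kernel

theorem leading_eq_iff {σ : Perm (Fin (3 * n))} {t : Tabloid n} :
    leading σ = t ↔ ∀ k j, row t (σ (point k j)) = j := by
  constructor
  · rintro rfl k j
    exact row_leading σ k j
  · intro h
    refine row_injective (funext fun p => ?_)
    obtain ⟨k, j, hp⟩ := exists_point (σ.symm p)
    rw [symm_apply_eq] at hp
    rw [hp, row_leading, h]

/-- The column stabilizer is a product of n symmetric groups of degree three. Expanding the product
over the tripods of the sums in `sum_sign_eq_eps` gives the signed sum over that product. -/
theorem tabloidMap_w0 (n : ℕ) : tabloidMap n (w0 (3 * n)) = polytabloid (tableauZero n) := by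
  classical
  ext t
  rw [← forkVec_one, tabloidMap_forkVec, polytabloid, Finsupp.finsetSum_apply]
  have h1 : ∑ σ : Perm (Fin (3 * n)) with IsColumnStabilizer (tableauZero n) σ,
      Finsupp.single (Tabloid.mk ((tableauZero n).trans σ)) ((Perm.sign σ : ℤ) : ℂ) t =
      ∑ f : Fin n → Perm (Fin 3), Finsupp.single (leading (columnPerm f))
        ((Perm.sign (columnPerm f) : ℤ) : ℂ) t := by
    symm
    refine Finset.sum_bij (fun f _ => columnPerm f) ?_ ?_ ?_ ?_
    · intro f _
      simpa using isColumnStabilizer_columnPerm f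
    · intro f _ g _ h
      exact columnPerm_injective h
    · intro σ hσ
      obtain ⟨f, hf⟩ := exists_columnPerm (by simpa using hσ)
      exact ⟨f, Finset.mem_univ f, hf⟩
    · intro f _
      rfl
  rw [h1]
  have h2 : ∀ f : Fin n → Perm (Fin 3), Finsupp.single (leading (columnPerm f))
      ((Perm.sign (columnPerm f) : ℤ) : ℂ) t =
      ∏ k, if ∀ j, row t (point k (f k j)) = j then ((Perm.sign (f k) : ℤ) : ℂ) else 0 := by
    intro f
    rw [Finsupp.single_apply, leading_eq_iff]
    simp only [columnPerm_point]
    split_ifs with h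
    · rw [sign_columnPerm]
      push_cast
      exact Finset.prod_congr rfl fun k _ => (if_pos (h k)).symm
    · push Not at h
      obtain ⟨k, j, h⟩ := h
      exact (Finset.prod_eq_zero (Finset.mem_univ k) (if_neg fun h' => h (h' j))).symm
  have h3 := Finset.prod_univ_sum (fun _ : Fin n => (Finset.univ : Finset (Perm (Fin 3))))
    fun k g => if ∀ j, row t (point k (g j)) = j then ((Perm.sign g : ℤ) : ℂ) else 0
  rw [Fintype.piFinset_univ] at h3
  rw [Finset.sum_congr rfl fun f _ => h2 f, ← h3]
  refine Finset.prod_congr rfl fun k _ => ?_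
  have := congrArg (Int.cast : ℤ → ℂ) (sum_sign_eq_eps fun j => row t (point k j))
  push_cast at this
  exact this.symm

theorem tabloidMap_forkVec_eq_polytabloid (σ : Perm (Fin (3 * n))) :
    tabloidMap n (forkVec σ) = polytabloid ((tableauZero n).trans σ) := by
  rw [forkVec, tabloidMap_webHom, tabloidMap_w0, perm_polytabloid]

/-- Every tableau arises from T_0 by a permutation, so the generating polytabloids are exactly the
images of the permuted rows of tripods. -/
theorem range_tabloidMap (n : ℕ) : LinearMap.range (tabloidMap n) = Specht n := by
  rw [LinearMap.range_eq_map, ← tripodSpan_eq_top, tripodSpan, Submodule.map_span, Specht,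
    ← Set.range_comp]
  congr 1
  ext x
  simp only [Set.mem_range, Function.comp_apply]
  constructor
  · rintro ⟨σ, rfl⟩
    exact ⟨_, (tabloidMap_forkVec_eq_polytabloid σ).symm⟩
  · rintro ⟨T, rfl⟩
    refine ⟨(tableauZero n).symm.trans T, (tabloidMap_forkVec_eq_polytabloid _).trans ?_⟩
    congr 1
    ext x
    simp

/-- The web space is the Specht module. -/
def spechtEquiv (n : ℕ) : WebN (3 * n) ≃ₗ[ℂ] Specht n :=
  (LinearEquiv.ofInjective (tabloidMap n) (tabloidMap_injective n)).trans
    (LinearEquiv.ofEq _ _ (range_tabloidMap n))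

/-- The action of the symmetric group on the web space. -/
def webRep (n : ℕ) : Representation ℂ (Perm (Fin (3 * n))) (WebSpace n) where
  toFun σ := (webSpaceEquiv n).symm.toLinearMap ∘ₗ webHom (3 * n) σ ∘ₗ
    (webSpaceEquiv n).toLinearMap
  map_one' := LinearMap.ext fun x => by simp
  map_mul' σ τ := LinearMap.ext fun x => by simp

theorem webSpaceEquiv_webRep (σ : Perm (Fin (3 * n))) (x : WebSpace n) :
    webSpaceEquiv n (webRep n σ x) = webHom (3 * n) σ (webSpaceEquiv n x) :=
  (webSpaceEquiv n).apply_symm_apply _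

theorem webRep_swap (n i : ℕ) (hi : i + 1 < 3 * n) :
    webRep n (swap ⟨i, Nat.lt_of_succ_lt hi⟩ ⟨i + 1, hi⟩) = crossing n i hi := by
  refine LinearMap.ext fun x => (webSpaceEquiv n).injective ?_
  rw [webSpaceEquiv_webRep, webSpaceEquiv_crossing, ← adj_of_lt hi, webHom_adj hi, crs_apply]

theorem spechtEquiv_webHom (σ : Perm (Fin (3 * n))) (x : WebN (3 * n)) :
    spechtEquiv n (webHom (3 * n) σ x) = spechtRep n σ (spechtEquiv n x) :=
  Subtype.ext (tabloidMap_webHom σ x)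

theorem spechtEquiv_w0 (n : ℕ) : spechtEquiv n (w0 (3 * n)) = spechtZero n :=
  Subtype.ext (tabloidMap_w0 n)

end Sl3

end

/-! ### Assembly of the action, the isomorphism and the two bases. -/

theorem mainTheorem1 (n : ℕ) :
    ∃ (ρ : Representation ℂ (Equiv.Perm (Fin (3 * n))) (Sl3.WebSpace n))
      (Φ : Sl3.Specht n ≃ₗ[ℂ] Sl3.WebSpace n)
      (b : Module.Basis (Sl3.MDiagram n) ℂ (Sl3.WebSpace n))
      (c : Module.Basis (Sl3.MDiagram n) ℂ (Sl3.Specht n)),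
      -- the symmetric group acts on webs by stacking swaps at the bottom
      (∀ (i : ℕ) (hi : i + 1 < 3 * n),
        ρ (Equiv.swap ⟨i, Nat.lt_of_succ_lt hi⟩ ⟨i + 1, hi⟩) = Sl3.crossing n i hi) ∧
      -- the web space is isomorphic to the Specht module, with `v_{T_0}` sent to `W_0`
      (∀ (σ : Equiv.Perm (Fin (3 * n))) (x : Sl3.Specht n),
        Φ (Sl3.spechtRep n σ x) = ρ σ (Φ x)) ∧
      Φ (Sl3.spechtZero n) = Sl3.webZero n ∧
      -- the M-diagrams are a basis of the web space
      (∀ (m : Sl3.MDiagram n) (σ : Equiv.Perm (Fin (3 * n))),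
        Sl3.IsForkPerm σ → Sl3.arcs σ = m.1 → b m = ρ σ (Sl3.webZero n)) ∧
      -- and, through the isomorphism, of the Specht module
      (∀ m : Sl3.MDiagram n, Φ (c m) = b m) := by
  have hE : ∀ x y, (((Sl3.webSpaceEquiv n).trans (Sl3.spechtEquiv n)).symm x = y ↔
      x = Sl3.spechtEquiv n (Sl3.webSpaceEquiv n y)) := fun x y => LinearEquiv.symm_apply_eq _
  refine ⟨Sl3.webRep n, ((Sl3.webSpaceEquiv n).trans (Sl3.spechtEquiv n)).symm,
    (Sl3.mBasis n).map (Sl3.webSpaceEquiv n).symm, (Sl3.mBasis n).map (Sl3.spechtEquiv n),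
    fun i hi => Sl3.webRep_swap n i hi, fun σ x => ?_, ?_, fun m σ _ hm => ?_, fun m => ?_⟩
  · obtain ⟨y, rfl⟩ := ((Sl3.webSpaceEquiv n).trans (Sl3.spechtEquiv n)).surjective x
    rw [LinearEquiv.symm_apply_apply, hE, Sl3.webSpaceEquiv_webRep, Sl3.spechtEquiv_webHom]
    rfl
  · rw [hE, Sl3.webSpaceEquiv_webZero, Sl3.spechtEquiv_w0]
  -- The basis uses one chosen permutation for each diagram; any other with the same arcs gives the
  -- same web.
  · rw [Module.Basis.map_apply, LinearEquiv.symm_apply_eq, Sl3.webSpaceEquiv_webRep,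
      Sl3.webSpaceEquiv_webZero, Sl3.mBasis_apply,
      Sl3.forkVec_eq_of_arcs_eq ((Sl3.arcs_mPerm m).trans hm.symm), Sl3.forkVec]
  · rw [hE, Module.Basis.map_apply, Module.Basis.map_apply, LinearEquiv.apply_symm_apply]
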